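/- **Problems.** Let $\mathbb{F}$ be a field. An *isomorphism problem* over $\mathbb{F}$ has as instances pairs of objects of the same format, each object being given by the dimensions of its format and a list of field entries; the question is whether the two objects are isomorphic in the stated sense. - *3-Tensor Isomorphism*: given $A,B\in\mathbb{F}^{\ell\times n\times m}$, are there $(P,Q,R)\in \mathrm{GL}_\ell(\mathbb{F})\times\mathrm{GL}_n(\mathbb{F})\times\mathrm{GL}_m(\mathbb{F})$ with $\sum_{i,j,k}A(i,j,k)P_{ii'}Q_{jj'}R_{kk'}=B(i',j',k')$ for all $i',j',k'$? - *Matrix Space Isometry* (resp. *Conjugacy*): given bases of linear subspaces $\mathcal{A},\mathcal{B}\le M_n(\mathbb{F})$, is there $P\in\mathrm{GL}_n(\mathbb{F})$ with $P\mathcal{A}P^t=\mathcal{B}$ (resp. $P\mathcal{A}P^{-1}=\mathcal{B}$)? A space is alternating if $v^tMv=0$ for all of its elements $M$ and all $v$, and symmetric if all of its elements are symmetric matrices. - *Algebra Isomorphism*: given structure constants $A,B\in\mathbb{F}^{n\times n\times n}$ (with $x_i\cdot x_j=\sum_k A(i,j,k)x_k$), are the two (not necessarily associative, commutative or unital) algebras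 isomorphic? - *Cubic Form Equivalence*: given $A,B\in\mathbb{F}^{n\times n\times n}$, are the polynomials $\sum A(i,j,k)x_ix_jx_k$ and $\sum B(i,j,k)x_ix_jx_k$ in commuting variables related by an invertible linear substitution $x_i\mapsto\sum_{i'}P_{ii'}x_{i'}$? *Trilinear Form Equivalence* is the same question for noncommuting variables, i.e. whether $\sum_{i,j,k} A(i,j,k)P_{ii'}P_{jj'}P_{kk'}=B(i',j',k')$ for all $i',j',k'$, for some $P\in\mathrm{GL}_n(\mathbb{F})$. - *Group Isomorphism for $p$-groups of class $2$ and exponent $p$ given by generating matrices over $\mathbb{F}$*: given two tuples of matrices in $\mathrm{GL}_n(\mathbb{F})$ that generate $p$-groups of nilpotency class $2$ in which $g^p=1$ for all $g$, are these groups isomorphic as abstract groups? **Polynomial time.** Fix a function $\mathrm{sz}:\mathbb{F}\to\mathbb{N}$ such that the sizes of $a+b,\ ab$ are bounded by a polynomial in $\mathrm{sz}(a)+\mathrm{sz}(b)$ and the sizes of $-a,\ a^{-1}$ by a polynomial in $\mathrm{sz}(a)$ (with $0^{-1}=0$). The machine model is a random access machine over $\mathbb{F}$: a fixed program with finitely many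 constants from $\mathbb{F}$, natural-number registers used as counters and addresses, and arrays of field elements, with field operations, zero tests, branching and loops. An arithmetic operation on counters costs one plus an upper bound for its value (i.e. counters are paid for in unary), a field operation or copy costs one plus the sizes of the field elements involved, a zero test of a field element costs one plus its size, and a test of a counter costs one. The size of an instance is the sum of its dimensions plus $\sum(1+\mathrm{sz}(x))$ over all its entries $x$. Taking $\mathrm{sz}=0$ gives unit-cost (Blum–Shub–Smale type) time over $\mathbb{F}$; taking for $\mathrm{sz}$ the length of a standard binary encoding (finite fields, $\mathbb{Q}$, and algebraic extensions of these) gives polynomial time with bit costs. A problem $\mathsf{P}$ *reduces* to $\mathsf{Q}$ *in polynomial time* if some program maps every instance $(A,B)$ of $\mathsf{P}$, in time polynomial in its size, to an instance $(A',B')$ of $\mathsf{Q}$ such that $A\cong B$ if and only if $A'\cong B'$. For a problem restricted to a special class of objects, both output objects must lie in that class. **Theorem.** For every field $\mathbb{F}$ and every such $\mathrm{sz}$, 3-Tensor Isomorphism over $\mathbb{F}$ reduces in polynomial time to each of the following problems over $\mathbb{F}$. 1. If $\mathbb{F}=\mathbb{F}_{p^e}$ with $p$ an odd prime: Group Isomorphism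 for $p$-groups of class $2$ and exponent $p$ given by generating matrices over $\mathbb{F}_{p^e}$. 2. Matrix Space Isometry; also its restriction to alternating matrix spaces, and its restriction to symmetric matrix spaces. 3. Matrix Space Conjugacy; also its restriction to matrix spaces that are Lie algebras $L$ under the commutator, solvable of derived length $2$, with $L/[L,L]\cong\mathbb{F}$; and its restriction to matrix spaces that are associative algebras $A$ under multiplication (not necessarily unital) whose Jacobson radical satisfies $J(A)^2=0$ and $A/J(A)\cong\mathbb{F}$. Here $J(A)=\{a\in A:\forall b\in A\ \exists c\in A,\ c+ba=cba\}$. 4. Algebra Isomorphism; also its restrictions to commutative unital associative algebras, to commutative associative algebras with $abc=0$ for all $a,b,c$, and to Lie algebras with $[u,[v,w]]=0$ for all $u,v,w$. 5. Cubic Form Equivalence and Trilinear Form Equivalence. -/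

import Mathlib

universe u

namespace TensorIso

/-! ### Algebraic random access machines

A machine over a field `F` has finitely many registers holding natural numbers (used as counters
and addresses) and finitely many infinite arrays with entries in `F`.  An array cell is addressed
by the content of a register.  A program may use finitely many constants of `F`, the field
operations, equality tests, counters, branching and loops. -/

/-- Elementary instructions.  A pair `a i` stands for the cell of array `a` whose address is the
current content of register `i`. -/
inductive Op (F : Type u) : Type u
  | nconst (r k : ℕ)
  | nadd (r s t : ℕ)
  | nsub (r s t : ℕ)
  | nmul (r s t : ℕ)
  | fconst (a i : ℕ) (c : F)
  | fcopy (a i b j : ℕ)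
  | fneg (a i b j : ℕ)
  | finv (a i b j : ℕ)
  | fadd (a i b j c k : ℕ)
  | fmul (a i b j c k : ℕ)

/-- Programs.  `branchZero r P Q` runs `P` if register `r` contains `0` and `Q` otherwise;
`branchField a i P Q` runs `P` if the cell `a i` contains `0 : F` and `Q` otherwise;
`loop r P` repeats `P` as long as register `r` is nonzero. -/
inductive Program (F : Type u) : Type u
  | skip : Program F
  | op (o : Op F) : Program F
  | seq (P Q : Program F) : Program F
  | branchZero (r : ℕ) (P Q : Program F) : Program F
  | branchField (a i : ℕ) (P Q : Program F) : Program F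
  | loop (r : ℕ) (P : Program F) : Program F

/-- A memory configuration. -/
structure State (F : Type u) : Type u where
  reg : ℕ → ℕ
  mem : ℕ → ℕ → F

namespace State

variable {F : Type u}

/-- The content of the cell of array `a` addressed by register `i`. -/
def get (σ : State F) (a i : ℕ) : F := σ.mem a (σ.reg i)

/-- Write `v` into register `r`. -/
def setReg (σ : State F) (r v : ℕ) : State F :=
  { σ with reg := Function.update σ.reg r v }

/-- Write `x` into the cell of array `a` addressed by register `i`. -/
def set (σ : State F) (a i : ℕ) (x : F) : State F :=
  { σ with mem := Function.update σ.mem a (Function.update (σ.mem a) (σ.reg i) x) }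

end State

/-- The effect of an elementary instruction. -/
def Op.apply {F : Type u} [Field F] : Op F → State F → State F
  | .nconst r k, σ => σ.setReg r k
  | .nadd r s t, σ => σ.setReg r (σ.reg s + σ.reg t)
  | .nsub r s t, σ => σ.setReg r (σ.reg s - σ.reg t)
  | .nmul r s t, σ => σ.setReg r (σ.reg s * σ.reg t)
  | .fconst a i c, σ => σ.set a i c
  | .fcopy a i b j, σ => σ.set a i (σ.get b j)
  | .fneg a i b j, σ => σ.set a i (-σ.get b j)
  | .finv a i b j, σ => σ.set a i (σ.get b j)⁻¹
  | .fadd a i b j c k, σ => σ.set a i (σ.get b j + σ.get c k)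
  | .fmul a i b j c k, σ => σ.set a i (σ.get b j * σ.get c k)

/-- The cost of an elementary instruction, relative to a size function `sz` on the field.
Computing a natural number costs at least its value, so counters are paid for in unary;
a field instruction costs one plus the sizes of its operands and of its result. -/
def Op.cost {F : Type u} [Field F] (sz : F → ℕ) : Op F → State F → ℕ
  | .nconst _ k, _ => 1 + k
  | .nadd _ s t, σ => 1 + (σ.reg s + σ.reg t)
  | .nsub _ s t, σ => 1 + (σ.reg s - σ.reg t)
  | .nmul _ s t, σ => 1 + σ.reg s * σ.reg t
  | .fconst _ _ c, _ => 1 + sz c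
  | .fcopy _ _ b j, σ => 1 + sz (σ.get b j)
  | .fneg _ _ b j, σ => 1 + sz (σ.get b j) + sz (-σ.get b j)
  | .finv _ _ b j, σ => 1 + sz (σ.get b j) + sz (σ.get b j)⁻¹
  | .fadd _ _ b j c k, σ =>
      1 + sz (σ.get b j) + sz (σ.get c k) + sz (σ.get b j + σ.get c k)
  | .fmul _ _ b j c k, σ =>
      1 + sz (σ.get b j) + sz (σ.get c k) + sz (σ.get b j * σ.get c k)

/-- `Runs sz P σ t τ`: started in `σ`, the program `P` halts in `τ` at total cost `t`. -/
inductive Runs {F : Type u} [Field F] (sz : F → ℕ) :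
    Program F → State F → ℕ → State F → Prop
  | skip (σ) : Runs sz .skip σ 0 σ
  | op (o : Op F) (σ) : Runs sz (.op o) σ (o.cost sz σ) (o.apply σ)
  | seq {P Q σ τ ρ s t} (h₁ : Runs sz P σ s τ) (h₂ : Runs sz Q τ t ρ) :
      Runs sz (.seq P Q) σ (s + t) ρ
  | zero_yes {r P Q σ τ t} (h : σ.reg r = 0) (h₁ : Runs sz P σ t τ) :
      Runs sz (.branchZero r P Q) σ (1 + t) τ
  | zero_no {r P Q σ τ t} (h : σ.reg r ≠ 0) (h₁ : Runs sz Q σ t τ) :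
      Runs sz (.branchZero r P Q) σ (1 + t) τ
  | field_yes {a i P Q σ τ t} (h : σ.get a i = 0) (h₁ : Runs sz P σ t τ) :
      Runs sz (.branchField a i P Q) σ (1 + sz (σ.get a i) + t) τ
  | field_no {a i P Q σ τ t} (h : σ.get a i ≠ 0) (h₁ : Runs sz Q σ t τ) :
      Runs sz (.branchField a i P Q) σ (1 + sz (σ.get a i) + t) τ
  | loop_stop {r P σ} (h : σ.reg r = 0) : Runs sz (.loop r P) σ 1 σ
  | loop_step {r P σ τ ρ s t} (h : σ.reg r ≠ 0) (h₁ : Runs sz P σ s τ)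
      (h₂ : Runs sz (.loop r P) τ t ρ) : Runs sz (.loop r P) σ (1 + s + t) ρ

/-- Admissible size functions on a field: a field operation produces a result whose size is
polynomially bounded in the sizes of the operands.  The zero function gives unit-cost algebraic
(Blum-Shub-Smale) complexity over `F`; the length of a standard binary encoding of the elements of a
finite field, of the rationals or of an algebraic extension of these gives bit complexity. -/
def IsSizeMeasure {F : Type u} [Field F] (sz : F → ℕ) : Prop :=
  ∃ q : Polynomial ℕ, ∀ a b : F,
    sz (a + b) ≤ q.eval (sz a + sz b) ∧ sz (a * b) ≤ q.eval (sz a + sz b) ∧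
      sz (-a) ≤ q.eval (sz a) ∧ sz a⁻¹ ≤ q.eval (sz a)

/-! ### Isomorphism problems and reductions -/

/-- An isomorphism problem over `F`: an instance consists of two objects of the same format, and
the question is whether they are related by `Iso`.  An object is given by the natural numbers
`dims` of its format together with its list of entries from `F`. -/
structure IsoProblem (F : Type u) where
  Format : Type
  Obj : Format → Type u
  dims : Format → List ℕ
  entries : {f : Format} → Obj f → List F
  Iso : {f : Format} → Obj f → Obj f → Prop

/-- The special case of an isomorphism problem in which both objects satisfy `V`. -/
def IsoProblem.restrict {F : Type u} (P : IsoProblem F) (V : {f : P.Format} → P.Obj f → Prop) :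
    IsoProblem F where
  Format := P.Format
  Obj f := {A : P.Obj f // V A}
  dims := P.dims
  entries A := P.entries A.1
  Iso A B := P.Iso A.1 B.1

/-- The size of an instance. -/
def IsoProblem.size {F : Type u} (P : IsoProblem F) (sz : F → ℕ) {f : P.Format}
    (A B : P.Obj f) : ℕ :=
  (P.dims f).sum + ((P.entries A ++ P.entries B).map fun x => 1 + sz x).sum

/-- The initial configuration on an instance: the dimensions are in the first registers, the two
objects are in the arrays `0` and `1`, and everything else is zero. -/
def IsoProblem.input {F : Type u} [Field F] (P : IsoProblem F) {f : P.Format}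
    (A B : P.Obj f) : State F where
  reg r := (P.dims f).getD r 0
  mem a i :=
    if a = 0 then (P.entries A).getD i 0 else if a = 1 then (P.entries B).getD i 0 else 0

/-- The final configuration contains an instance: the dimensions are in the first registers and
the two objects are in the initial segments of the arrays `2` and `3`. -/
def IsoProblem.IsOutput {F : Type u} [Field F] (P : IsoProblem F) {f : P.Format}
    (A B : P.Obj f) (σ : State F) : Prop :=
  (∀ r < (P.dims f).length, σ.reg r = (P.dims f).getD r 0) ∧
  (∀ i < (P.entries A).length, σ.mem 2 i = (P.entries A).getD i 0) ∧
  (∀ i < (P.entries B).length, σ.mem 3 i = (P.entries B).getD i 0)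

/-- Polynomial-time many-one reducibility of isomorphism problems over `F`, where time is measured
relative to the size function `sz`. -/
def PolyTimeReduces {F : Type u} [Field F] (sz : F → ℕ) (P Q : IsoProblem F) : Prop :=
  ∃ (M : Program F) (p : Polynomial ℕ), ∀ (f : P.Format) (A B : P.Obj f),
    ∃ (t : ℕ) (σ : State F), Runs sz M (P.input A B) t σ ∧ t ≤ p.eval (P.size sz A B) ∧
      ∃ (g : Q.Format) (A' B' : Q.Obj g), Q.IsOutput A' B' σ ∧ (P.Iso A B ↔ Q.Iso A' B')

/-! ### Three-way arrays and tensors -/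

/-- `a × b × c` arrays over `F`. -/
abbrev Arr (F : Type u) (a b c : ℕ) : Type u := Fin a → Fin b → Fin c → F

/-- The entries of an array in lexicographic order. -/
def Arr.toList {F : Type u} {a b c : ℕ} (A : Arr F a b c) : List F :=
  (List.ofFn fun i => (List.ofFn fun j => List.ofFn fun k => A i j k).flatten).flatten

section Problems

variable (F : Type u) [Field F]

/-- 3-Tensor Isomorphism. -/
def tensorIso : IsoProblem F where
  Format := ℕ × ℕ × ℕ
  Obj f := Arr F f.1 f.2.1 f.2.2
  dims f := [f.1, f.2.1, f.2.2]
  entries A := Arr.toList A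
  Iso {f} A B := ∃ (P : GL (Fin f.1) F) (Q : GL (Fin f.2.1) F) (R : GL (Fin f.2.2) F),
    ∀ i' j' k', (∑ i, ∑ j, ∑ k, A i j k * P.1 i i' * Q.1 j j' * R.1 k k') = B i' j' k'

/-! ### Matrix spaces -/

/-- Linearly independent `d`-tuples of `n × n` matrices, i.e. ordered bases of matrix spaces. -/
abbrev MatrixBasis (n d : ℕ) : Type u :=
  {A : Fin d → Matrix (Fin n) (Fin n) F // LinearIndependent F A}

variable {F} in
/-- The matrix space with the given basis. -/
def MatrixBasis.space {n d : ℕ} (A : MatrixBasis F n d) :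
    Submodule F (Matrix (Fin n) (Fin n) F) :=
  Submodule.span F (Set.range A.1)

/-- Matrix Space Isometry. -/
def matrixSpaceIsometry : IsoProblem F where
  Format := ℕ × ℕ
  Obj f := MatrixBasis F f.1 f.2
  dims f := [f.1, f.2]
  entries {f} A := Arr.toList (fun (k : Fin f.2) (i j : Fin f.1) => A.1 k i j)
  Iso {f} A B := ∃ P : GL (Fin f.1) F,
    (fun M => P.1 * M * P.1.transpose) '' (A.space : Set (Matrix (Fin f.1) (Fin f.1) F)) =
      (B.space : Set (Matrix (Fin f.1) (Fin f.1) F))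

/-- Matrix Space Conjugacy. -/
def matrixSpaceConjugacy : IsoProblem F where
  Format := ℕ × ℕ
  Obj f := MatrixBasis F f.1 f.2
  dims f := [f.1, f.2]
  entries {f} A := Arr.toList (fun (k : Fin f.2) (i j : Fin f.1) => A.1 k i j)
  Iso {f} A B := ∃ P : GL (Fin f.1) F,
    (fun M => P.1 * M * P⁻¹.1) '' (A.space : Set (Matrix (Fin f.1) (Fin f.1) F)) =
      (B.space : Set (Matrix (Fin f.1) (Fin f.1) F))

variable {F} in
/-- A matrix space all of whose elements are alternating. -/
def IsAlternatingSpace {n d : ℕ} (A : MatrixBasis F n d) : Prop :=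
  ∀ M ∈ A.space, ∀ v : Fin n → F, v ⬝ᵥ M.mulVec v = 0

variable {F} in
/-- A matrix space all of whose elements are symmetric. -/
def IsSymmetricSpace {n d : ℕ} (A : MatrixBasis F n d) : Prop :=
  ∀ M ∈ A.space, M.IsSymm

attribute [local instance 100] LieRing.ofAssociativeRing

variable {F} in
/-- A matrix space that is a Lie algebra `L` under the commutator, solvable of derived length `2`
and such that `L / [L, L]` is isomorphic to `F`. -/
def IsLieDerivedLengthTwo {n d : ℕ} (A : MatrixBasis F n d) : Prop :=
  ∃ L : LieSubalgebra F (Matrix (Fin n) (Fin n) F), L.toSubmodule = A.space ∧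
    LieAlgebra.IsSolvable L ∧ LieAlgebra.derivedLength F L = 2 ∧
    Nonempty ((L ⧸ LieAlgebra.derivedSeries F L 1) ≃ₗ⁅F⁆ F)

/-- The Jacobson radical of a ring that need not have an identity: the elements `a` such that
every `b * a` is left quasi-regular. -/
def jacobsonRadical (R : Type u) [NonUnitalRing R] : Set R :=
  {a | ∀ b : R, ∃ c : R, c + b * a = c * (b * a)}

variable {F} in
/-- A matrix space that is an associative algebra `S` (not necessarily with identity) whose
Jacobson radical `J` satisfies `J ^ 2 = 0` and `S / J ≅ F`, the latter expressed by a surjective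
algebra homomorphism to `F` with kernel `J`. -/
def IsAssocRadicalSquareZero {n d : ℕ} (A : MatrixBasis F n d) : Prop :=
  ∃ S : NonUnitalSubalgebra F (Matrix (Fin n) (Fin n) F), S.toSubmodule = A.space ∧
    (∀ a ∈ jacobsonRadical S, ∀ b ∈ jacobsonRadical S, a * b = 0) ∧
    ∃ φ : S →ₙₐ[F] F, Function.Surjective φ ∧ ∀ a : S, φ a = 0 ↔ a ∈ jacobsonRadical S

/-- Alternating Matrix Space Isometry. -/
def alternatingIsometry : IsoProblem F :=
  (matrixSpaceIsometry F).restrict fun A => IsAlternatingSpace A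

/-- Symmetric Matrix Space Isometry. -/
def symmetricIsometry : IsoProblem F :=
  (matrixSpaceIsometry F).restrict fun A => IsSymmetricSpace A

/-- Matrix Lie Algebra Conjugacy for solvable Lie algebras `L` of derived length `2` with
`L / [L, L] ≅ F`. -/
def matrixLieConjugacy : IsoProblem F :=
  (matrixSpaceConjugacy F).restrict fun A => IsLieDerivedLengthTwo A

/-- Associative Matrix Algebra Conjugacy for algebras whose Jacobson radical squares to zero with
quotient `F`. -/
def matrixAssocConjugacy : IsoProblem F :=
  (matrixSpaceConjugacy F).restrict fun A => IsAssocRadicalSquareZero A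

/-! ### Matrix groups -/

variable {F} in
/-- The group generated by a tuple of invertible matrices. -/
def generatedGroup {n d : ℕ} (A : Fin d → GL (Fin n) F) : Subgroup (GL (Fin n) F) :=
  Subgroup.closure (Set.range A)

/-- Group Isomorphism for `p`-groups of class `2` and exponent `p` given by generating matrices
over `F`. -/
def matrixGroupIso (p : ℕ) : IsoProblem F where
  Format := ℕ × ℕ
  Obj f := {A : Fin f.2 → GL (Fin f.1) F //
    IsPGroup p (generatedGroup A) ∧ (∀ g : generatedGroup A, g ^ p = 1) ∧
      Group.nilpotencyClass (generatedGroup A) = 2}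
  dims f := [f.1, f.2]
  entries {f} A := Arr.toList (fun (k : Fin f.2) (i j : Fin f.1) => (A.1 k).1 i j)
  Iso A B := Nonempty (generatedGroup A.1 ≃* generatedGroup B.1)

/-! ### Algebras given by structure constants -/

variable {F} in
/-- The product on `F ^ n` with structure constants `A`, so that `e_i * e_j = ∑ k, A i j k * e_k`. -/
def algMul {n : ℕ} (A : Arr F n n n) (x y : Fin n → F) : Fin n → F :=
  fun k => ∑ i, ∑ j, x i * y j * A i j k

/-- Algebra Isomorphism, for algebras that need not be associative, commutative or unital. -/
def algebraIso : IsoProblem F where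
  Format := ℕ
  Obj n := Arr F n n n
  dims n := [n]
  entries A := Arr.toList A
  Iso {n} A B := ∃ φ : (Fin n → F) ≃ₗ[F] (Fin n → F),
    ∀ x y, φ (algMul A x y) = algMul B (φ x) (φ y)

variable {F} in
/-- Associativity. -/
def IsAssocAlg {n : ℕ} (A : Arr F n n n) : Prop :=
  ∀ x y z, algMul A (algMul A x y) z = algMul A x (algMul A y z)

variable {F} in
/-- Commutativity. -/
def IsCommAlg {n : ℕ} (A : Arr F n n n) : Prop :=
  ∀ x y, algMul A x y = algMul A y x

variable {F} in
/-- Existence of an identity element. -/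
def IsUnitalAlg {n : ℕ} (A : Arr F n n n) : Prop :=
  ∃ e, ∀ x, algMul A e x = x ∧ algMul A x e = x

variable {F} in
/-- `3`-nilpotency: all products of three elements vanish. -/
def IsThreeNilpotentAlg {n : ℕ} (A : Arr F n n n) : Prop :=
  ∀ x y z, algMul A (algMul A x y) z = 0 ∧ algMul A x (algMul A y z) = 0

variable {F} in
/-- The product is a Lie bracket. -/
def IsLieAlg {n : ℕ} (A : Arr F n n n) : Prop :=
  (∀ x, algMul A x x = 0) ∧
  ∀ x y z, algMul A x (algMul A y z) + algMul A y (algMul A z x) + algMul A z (algMul A x y) = 0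

variable {F} in
/-- `[u, [v, w]] = 0` for all `u, v, w`. -/
def IsTwoStepNilpotent {n : ℕ} (A : Arr F n n n) : Prop :=
  ∀ u v w, algMul A u (algMul A v w) = 0

/-- Isomorphism of commutative unital associative algebras. -/
def commUnitalAlgebraIso : IsoProblem F :=
  (algebraIso F).restrict fun A => IsAssocAlg A ∧ IsCommAlg A ∧ IsUnitalAlg A

/-- Isomorphism of commutative `3`-nilpotent associative algebras. -/
def commNilpotentAlgebraIso : IsoProblem F :=
  (algebraIso F).restrict fun A => IsAssocAlg A ∧ IsCommAlg A ∧ IsThreeNilpotentAlg A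

/-- Isomorphism of `2`-step nilpotent Lie algebras. -/
def nilpotentLieAlgebraIso : IsoProblem F :=
  (algebraIso F).restrict fun A => IsLieAlg A ∧ IsTwoStepNilpotent A

/-! ### Cubic and trilinear forms -/

variable {F} in
/-- The cubic form `∑ A i j k * x_i * x_j * x_k` in commuting variables. -/
noncomputable def cubicForm {n : ℕ} (A : Arr F n n n) : MvPolynomial (Fin n) F :=
  ∑ i, ∑ j, ∑ k, MvPolynomial.C (A i j k) *
    (MvPolynomial.X i * MvPolynomial.X j * MvPolynomial.X k)

/-- Cubic Form Equivalence. -/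
def cubicFormEquiv : IsoProblem F where
  Format := ℕ
  Obj n := Arr F n n n
  dims n := [n]
  entries A := Arr.toList A
  Iso {n} A B := ∃ P : GL (Fin n) F,
    MvPolynomial.bind₁ (fun i => ∑ i', MvPolynomial.C (P.1 i i') * MvPolynomial.X i')
      (cubicForm A) = cubicForm B

/-- Trilinear Form Equivalence. -/
def trilinearFormEquiv : IsoProblem F where
  Format := ℕ
  Obj n := Arr F n n n
  dims n := [n]
  entries A := Arr.toList A
  Iso {n} A B := ∃ P : GL (Fin n) F,
    ∀ i' j' k', (∑ i, ∑ j, ∑ k, A i j k * P.1 i i' * P.1 j j' * P.1 k k') = B i' j' k'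

end Problems

end TensorIso

/-!
Each reduction sends an array `A` to an object whose entries are constants or copies of entries of
`A`, selected by arithmetic in the indices.  A program with three nested loops computes such a map
in polynomial time, whatever the selection (`reduces_of_expr`), so the content lies in the proofs
that isomorphism of the images implies isomorphism of the arrays.

All of these use that two arrays are isomorphic once each arises from the other by linear
substitutions that may be singular (`exists_gl_trans_eq_of_mutual`).  It therefore suffices to
restrict and project an isomorphism of the images to the three directions of the array.

The reductions other than those to forms start from the *core array* of `A`, the bilinear map
`(F ⊕ U) × (V ⊕ S) → (F ⊕ U) ⊗ S`, `(t + u, v + s) ↦ 1 ⊗ A (u, v) + (t + u) ⊗ s`, where `S` contains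
the target of `A`.  Its elements with a nonzero annihilator in `F ⊕ U` form the subspace `V`
(`core_singular_iff`), so equivalences preserve `V`, and on `V` the core array is `A`
(`exists_gl_of_core`).

* Isometry: the core array is made symmetric or alternating as a bilinear map on the direct sum of
  `F ⊕ U` and `V ⊕ S`.  If `S` is large, then the totally isotropic subspace `V ⊕ S` is preserved
  (`sym_core_isotropic`), which leads back to the core array (`core_equiv_of_sym`).
* Algebras: a symmetric or alternating bilinear map is the multiplication of a nilpotent algebra on
  the sum of its source and its target (`nilAlg`), where the products span the target; to such an
  algebra an identity can be adjoined (`unitAlg`), and the nilpotent elements recover it.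
* Conjugacy: the slices of the core array are placed in the upper right block of square matrices,
  and the idempotent of the upper left block is added.  The elements of square zero are those of the
  upper right block, and conjugations that preserve them are block triangular
  (`exists_trans_of_conjIso`).  The structure of these algebras is the subject of `IsPeirce`.
* Cubic and trilinear forms: to `∑ A i j k * u i * v j * w k` terms `u i * h s * g (i, s)` and
  `v j * h s * g (j, s)` are added, more for `u` than for `v` and none for `w`, so that the rank of
  the polarization at a vector tells whether it has components in the first or in the second
  direction (`card_le_of_rank`).  The polarization consists of the third derivatives of the form,
  hence is determined by the form in all characteristics (`polar_eq_of_cubicForm_eq`).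
* Groups: an alternating bilinear map over a finite field of odd characteristic has a Heisenberg
  group of exponent `p` and class `2`, and commutators recover the bilinear map up to *additive*
  equivalence (`Heis.exists_addEquiv`).  For core arrays such an equivalence is semilinear
  (`core_semilinear`).  To make it linear, `A` is first enlarged by bilinear maps that mark four
  lines in a plane (`mark`), of slopes `0`, `∞`, `1` and `α` for a generator `α` of the
  multiplicative group: since the lines are preserved, so is `α` (`mark_smul_eq`), and hence every
  scalar.
-/


set_option linter.unusedSectionVars false

namespace TensorIso

/-! ### Straight-line expressions and their compilation -/

/-- Functions `ℕ → ℕ` dominated by a polynomial. -/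
def PolyBounded (f : ℕ → ℕ) : Prop := ∃ p : Polynomial ℕ, ∀ s, f s ≤ p.eval s

theorem PolyBounded.const (k : ℕ) : PolyBounded fun _ => k :=
  ⟨Polynomial.C k, fun s => by simp⟩

theorem PolyBounded.id : PolyBounded fun s => s :=
  ⟨Polynomial.X, fun s => by simp⟩

theorem PolyBounded.add {f g : ℕ → ℕ} (hf : PolyBounded f) (hg : PolyBounded g) :
    PolyBounded fun s => f s + g s := by
  obtain ⟨p, hp⟩ := hf
  obtain ⟨q, hq⟩ := hg
  exact ⟨p + q, fun s => by simpa using add_le_add (hp s) (hq s)⟩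

theorem PolyBounded.mul {f g : ℕ → ℕ} (hf : PolyBounded f) (hg : PolyBounded g) :
    PolyBounded fun s => f s * g s := by
  obtain ⟨p, hp⟩ := hf
  obtain ⟨q, hq⟩ := hg
  exact ⟨p * q, fun s => by simpa using Nat.mul_le_mul (hp s) (hq s)⟩

theorem eval_mono (p : Polynomial ℕ) : Monotone fun s => p.eval s := by
  intro a b h
  simp only [Polynomial.eval_eq_sum_range]
  gcongr

theorem PolyBounded.comp {f g : ℕ → ℕ} (hg : PolyBounded g) (hf : PolyBounded f) :
    PolyBounded fun s => g (f s) := by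
  obtain ⟨p, hp⟩ := hg
  obtain ⟨q, hq⟩ := hf
  exact ⟨p.comp q, fun s => by simpa using (hp _).trans (eval_mono p (hq s))⟩

theorem PolyBounded.eval (p : Polynomial ℕ) : PolyBounded fun s => p.eval s :=
  ⟨p, fun _ => le_rfl⟩

variable {F : Type u} [Field F]

/-- `Halts sz P σ c post`: started in `σ`, the program `P` halts at cost at most `c` in a
configuration satisfying `post`. -/
def Halts (sz : F → ℕ) (P : Program F) (σ : State F) (c : ℕ) (post : State F → Prop) : Prop :=
  ∃ t τ, Runs sz P σ t τ ∧ t ≤ c ∧ post τ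

theorem Halts.mono {sz : F → ℕ} {P : Program F} {σ : State F} {c c' : ℕ}
    {post post' : State F → Prop} (h : Halts sz P σ c post) (hc : c ≤ c')
    (hp : ∀ τ, post τ → post' τ) : Halts sz P σ c' post' := by
  obtain ⟨t, τ, h1, h2, h3⟩ := h
  exact ⟨t, τ, h1, h2.trans hc, hp _ h3⟩

theorem Halts.op {sz : F → ℕ} {o : Op F} {σ : State F} {c : ℕ} {post : State F → Prop}
    (hc : o.cost sz σ ≤ c) (hp : post (o.apply σ)) : Halts sz (.op o) σ c post :=
  ⟨_, _, Runs.op o σ, hc, hp⟩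

theorem Halts.seq {sz : F → ℕ} {P Q : Program F} {σ : State F} {c c' : ℕ}
    {mid post : State F → Prop} (h : Halts sz P σ c mid)
    (h' : ∀ τ, mid τ → Halts sz Q τ c' post) : Halts sz (.seq P Q) σ (c + c') post := by
  obtain ⟨t, τ, h1, h2, h3⟩ := h
  obtain ⟨t', τ', h1', h2', h3'⟩ := h' τ h3
  exact ⟨_, _, Runs.seq h1 h1', add_le_add h2 h2', h3'⟩

/-- Expressions for natural numbers in the contents of the first twenty registers. -/
inductive NatExpr : Type
  | var (r : Fin 20)
  | const (k : ℕ)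
  | add (a b : NatExpr)
  | sub (a b : NatExpr)
  | mul (a b : NatExpr)

namespace NatExpr

instance : Add NatExpr := ⟨add⟩
instance : Sub NatExpr := ⟨sub⟩
instance : Mul NatExpr := ⟨mul⟩
instance (k : ℕ) : OfNat NatExpr k := ⟨const k⟩

/-- The value of an expression. -/
def eval (ρ : ℕ → ℕ) : NatExpr → ℕ
  | var r => ρ r
  | const k => k
  | add a b => eval ρ a + eval ρ b
  | sub a b => eval ρ a - eval ρ b
  | mul a b => eval ρ a * eval ρ b

@[simp] theorem eval_var (ρ : ℕ → ℕ) (r : Fin 20) : (var r).eval ρ = ρ r := rfl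
@[simp] theorem eval_const (ρ : ℕ → ℕ) (k : ℕ) : (const k).eval ρ = k := rfl
@[simp] theorem eval_one (ρ : ℕ → ℕ) : (1 : NatExpr).eval ρ = 1 := (rfl)
@[simp] theorem eval_two (ρ : ℕ → ℕ) : (2 : NatExpr).eval ρ = 2 := (rfl)
@[simp] theorem eval_add (ρ : ℕ → ℕ) (a b : NatExpr) : (a + b).eval ρ = a.eval ρ + b.eval ρ := rfl
@[simp] theorem eval_sub (ρ : ℕ → ℕ) (a b : NatExpr) : (a - b).eval ρ = a.eval ρ - b.eval ρ := rfl
@[simp] theorem eval_mul (ρ : ℕ → ℕ) (a b : NatExpr) : (a * b).eval ρ = a.eval ρ * b.eval ρ := rfl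

/-- A program that puts the value of an expression into register `d`, using only registers from
`d` on. -/
def compile : NatExpr → ℕ → Program F
  | var r, d => .seq (.op (.nconst d 0)) (.op (.nadd d r d))
  | const k, d => .op (.nconst d k)
  | add a b, d => .seq (a.compile d) (.seq (b.compile (d + 1)) (.op (.nadd d d (d + 1))))
  | sub a b, d => .seq (a.compile d) (.seq (b.compile (d + 1)) (.op (.nsub d d (d + 1))))
  | mul a b, d => .seq (a.compile d) (.seq (b.compile (d + 1)) (.op (.nmul d d (d + 1))))

/-- A bound for the value of an expression, if the registers are bounded by `s`. -/
def bound : NatExpr → ℕ → ℕ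
  | var _, s => s
  | const k, _ => k
  | add a b, s => a.bound s + b.bound s
  | sub a _, s => a.bound s
  | mul a b, s => a.bound s * b.bound s

/-- A bound for the cost of computing an expression, if the registers are bounded by `s`. -/
def costBound : NatExpr → ℕ → ℕ
  | var _, s => 2 + s
  | const k, _ => 1 + k
  | add a b, s => a.costBound s + (b.costBound s + (1 + (a.bound s + b.bound s)))
  | sub a b, s => a.costBound s + (b.costBound s + (1 + a.bound s))
  | mul a b, s => a.costBound s + (b.costBound s + (1 + a.bound s * b.bound s))

theorem polyBounded_bound (e : NatExpr) : PolyBounded e.bound := by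
  induction e with
  | var r => exact PolyBounded.id
  | const k => exact PolyBounded.const k
  | add a b ha hb => exact ha.add hb
  | sub a b ha hb => exact ha
  | mul a b ha hb => exact ha.mul hb

theorem polyBounded_costBound (e : NatExpr) : PolyBounded e.costBound := by
  induction e with
  | var r => exact (PolyBounded.const 2).add PolyBounded.id
  | const k => exact PolyBounded.const (1 + k)
  | add a b ha hb =>
    exact ha.add (hb.add ((PolyBounded.const 1).add
      (a.polyBounded_bound.add b.polyBounded_bound)))
  | sub a b ha hb => exact ha.add (hb.add ((PolyBounded.const 1).add a.polyBounded_bound))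
  | mul a b ha hb =>
    exact ha.add (hb.add ((PolyBounded.const 1).add
      (a.polyBounded_bound.mul b.polyBounded_bound)))

theorem eval_le_bound (e : NatExpr) {ρ : ℕ → ℕ} {s : ℕ} (h : ∀ r < 20, ρ r ≤ s) :
    e.eval ρ ≤ e.bound s := by
  induction e with
  | var r => exact h r r.2
  | const k => exact le_rfl
  | add a b ha hb => exact add_le_add ha hb
  | sub a b ha hb => exact (Nat.sub_le _ _).trans ha
  | mul a b ha hb => exact Nat.mul_le_mul ha hb

theorem eval_congr (e : NatExpr) {ρ ρ' : ℕ → ℕ} (h : ∀ r < 20, ρ r = ρ' r) :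
    e.eval ρ = e.eval ρ' := by
  induction e with
  | var r => exact h r r.2
  | const k => rfl
  | add a b ha hb => simp only [eval, ha, hb]
  | sub a b ha hb => simp only [eval, ha, hb]
  | mul a b ha hb => simp only [eval, ha, hb]

theorem halts_compile (sz : F → ℕ) (e : NatExpr) {s : ℕ} :
    ∀ {d : ℕ} {σ : State F}, 20 ≤ d → (∀ r < 20, σ.reg r ≤ s) →
    Halts sz (e.compile d) σ (e.costBound s) fun τ =>
      τ.reg d = e.eval σ.reg ∧ (∀ r < d, τ.reg r = σ.reg r) ∧ τ.mem = σ.mem := by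
  -- the common part of the three binary operations
  have key : ∀ {a b : NatExpr} {o : Op F} {d c : ℕ} {σ : State F} {f : ℕ → ℕ → ℕ}, 20 ≤ d →
      (∀ r < 20, σ.reg r ≤ s) →
      (∀ {d : ℕ} {σ : State F}, 20 ≤ d → (∀ r < 20, σ.reg r ≤ s) →
        Halts sz (a.compile d) σ (a.costBound s) fun τ =>
        τ.reg d = a.eval σ.reg ∧ (∀ r < d, τ.reg r = σ.reg r) ∧ τ.mem = σ.mem) →
      (∀ {d : ℕ} {σ : State F}, 20 ≤ d → (∀ r < 20, σ.reg r ≤ s) →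
        Halts sz (b.compile d) σ (b.costBound s) fun τ =>
        τ.reg d = b.eval σ.reg ∧ (∀ r < d, τ.reg r = σ.reg r) ∧ τ.mem = σ.mem) →
      (∀ τ, τ.reg d = a.eval σ.reg → τ.reg (d + 1) = b.eval σ.reg → o.cost sz τ ≤ c ∧
        o.apply τ = τ.setReg d (f (a.eval σ.reg) (b.eval σ.reg))) →
      Halts sz (.seq (a.compile d) (.seq (b.compile (d + 1)) (.op o))) σ
        (a.costBound s + (b.costBound s + c)) fun τ =>
        τ.reg d = f (a.eval σ.reg) (b.eval σ.reg) ∧ (∀ r < d, τ.reg r = σ.reg r) ∧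
          τ.mem = σ.mem := by
    intro a b o d c σ f hd hs ha hb ho
    refine (ha hd hs).seq fun τ ⟨h1, h2, h3⟩ => ?_
    have hτ : ∀ r < 20, τ.reg r = σ.reg r := fun r hr => h2 r (by omega)
    refine (hb (by omega : 20 ≤ d + 1) fun r hr => by rw [hτ r hr]; exact hs r hr).seq
      fun υ ⟨g1, g2, g3⟩ => ?_
    rw [b.eval_congr hτ] at g1
    obtain ⟨ho1, ho2⟩ := ho υ ((g2 d (by omega)).trans h1) g1
    refine Halts.op ho1 ?_
    rw [ho2]
    refine ⟨by simp [State.setReg], fun r hr => ?_, by rw [← h3, ← g3]; rfl⟩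
    rw [← h2 r hr, ← g2 r (by omega)]
    simp [State.setReg, Function.update_of_ne (ne_of_lt hr)]
  induction e with
  | var r =>
    intro d σ hd hs
    have hr : (r : ℕ) ≠ d := by omega
    have h0 : Halts sz (.op (.nconst d 0)) σ 1 fun τ => τ = σ.setReg d 0 :=
      Halts.op (by simp [Op.cost]) rfl
    refine Halts.mono (c := 1 + (1 + s)) (h0.seq ?_) (by simp only [costBound]; omega)
      fun _ h => h
    rintro _ rfl
    refine Halts.op ?_ ?_
    · simpa [Op.cost, State.setReg, Function.update_of_ne hr] using hs r r.2
    · refine ⟨by simp [Op.apply, State.setReg, Function.update_of_ne hr], fun r' h' => ?_, rfl⟩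
      simp [Op.apply, State.setReg, Function.update_of_ne (ne_of_lt h')]
  | const k =>
    intro d σ hd hs
    refine Halts.op le_rfl ⟨by simp [Op.apply, State.setReg], fun r' h' => ?_, rfl⟩
    simp [Op.apply, State.setReg, Function.update_of_ne (ne_of_lt h')]
  | add a b ha hb =>
    intro d σ hd hs
    refine key (f := (· + ·)) hd hs ha hb fun τ h1 h2 => ⟨?_, by simp [Op.apply, h1, h2]⟩
    simpa [Op.cost, h1, h2] using add_le_add (a.eval_le_bound hs) (b.eval_le_bound hs)
  | sub a b ha hb =>
    intro d σ hd hs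
    refine key (f := (· - ·)) hd hs ha hb fun τ h1 h2 => ⟨?_, by simp [Op.apply, h1, h2]⟩
    simp only [Op.cost, h1, h2]
    have := a.eval_le_bound hs
    omega
  | mul a b ha hb =>
    intro d σ hd hs
    refine key (f := (· * ·)) hd hs ha hb fun τ h1 h2 => ⟨?_, by simp [Op.apply, h1, h2]⟩
    simpa [Op.cost, h1, h2] using Nat.mul_le_mul (a.eval_le_bound hs) (b.eval_le_bound hs)

end NatExpr

/-- Expressions for field elements: constants, constant multiples `c * x` of an entry `x` of the
input, and case distinctions `ite e f g` (`f` if `e` is zero and `g` otherwise). -/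
inductive FieldExpr (F : Type u) : Type u
  | const (c : F)
  | inp (c : F) (e : NatExpr)
  | ite (e : NatExpr) (f g : FieldExpr F)

namespace FieldExpr

/-- The value of an expression on the list of entries `x`. -/
def eval (ρ : ℕ → ℕ) (x : ℕ → F) : FieldExpr F → F
  | const c => c
  | inp c e => c * x (e.eval ρ)
  | ite e f g => if e.eval ρ = 0 then eval ρ x f else eval ρ x g

/-- `f` if `a < b` and `g` otherwise. -/
def ifLt (a b : NatExpr) (f g : FieldExpr F) : FieldExpr F := ite (b - a) g f

/-- `f` if `a = b` and `g` otherwise. -/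
def ifEq (a b : NatExpr) (f g : FieldExpr F) : FieldExpr F := ite ((a - b) + (b - a)) f g

/-- Multiplication of an expression by a constant. -/
def scale (c : F) : FieldExpr F → FieldExpr F
  | const a => const (c * a)
  | inp a e => inp (c * a) e
  | ite e f g => ite e (scale c f) (scale c g)

@[simp] theorem eval_const (ρ : ℕ → ℕ) (x : ℕ → F) (c : F) : (const c).eval ρ x = c := rfl

@[simp] theorem eval_inp (ρ : ℕ → ℕ) (x : ℕ → F) (c : F) (e : NatExpr) :
    (inp c e).eval ρ x = c * x (e.eval ρ) := rfl

@[simp] theorem eval_ifLt (ρ : ℕ → ℕ) (x : ℕ → F) (a b : NatExpr) (f g : FieldExpr F) :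
    (ifLt a b f g).eval ρ x = if a.eval ρ < b.eval ρ then f.eval ρ x else g.eval ρ x := by
  by_cases h : a.eval ρ < b.eval ρ
  · rw [if_pos h]; exact if_neg (by rw [NatExpr.eval_sub]; omega)
  · rw [if_neg h]; exact if_pos (by rw [NatExpr.eval_sub]; omega)

@[simp] theorem eval_ifEq (ρ : ℕ → ℕ) (x : ℕ → F) (a b : NatExpr) (f g : FieldExpr F) :
    (ifEq a b f g).eval ρ x = if a.eval ρ = b.eval ρ then f.eval ρ x else g.eval ρ x := by
  by_cases h : a.eval ρ = b.eval ρ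
  · rw [if_pos h]; exact if_pos (by simp [h])
  · rw [if_neg h]; exact if_neg (by simp only [NatExpr.eval_sub, NatExpr.eval_add]; omega)

@[simp] theorem eval_scale (ρ : ℕ → ℕ) (x : ℕ → F) (c : F) (f : FieldExpr F) :
    (f.scale c).eval ρ x = c * f.eval ρ x := by
  induction f with
  | const a => rfl
  | inp a e => simp [scale, mul_assoc]
  | ite e f g hf hg => simp only [scale, eval, hf, hg]; split_ifs <;> rfl

theorem eval_congr {F : Type u} [Field F] (f : FieldExpr F) {ρ ρ' : ℕ → ℕ} (x : ℕ → F)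
    (h : ∀ r < 20, ρ r = ρ' r) : f.eval ρ x = f.eval ρ' x := by
  induction f with
  | const c => rfl
  | inp c e => simp [e.eval_congr h]
  | ite e f g hf hg => simp only [eval, hf, hg, e.eval_congr h]

/-- A program that writes the value of an expression, evaluated on the array `a`, into the array
`b` at the address given by register `10`.  Array `4` serves for intermediate results. -/
def compile (a b : ℕ) : FieldExpr F → Program F
  | const c => .op (.fconst b 10 c)
  | inp c e => .seq (e.compile 20) (.seq (.op (.fconst 4 10 c)) (.op (.fmul b 10 4 10 a 20)))
  | ite e f g => .seq (e.compile 20) (.branchZero 20 (f.compile a b) (g.compile a b))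

/-- A bound for the cost of computing an expression; `q` bounds the growth of sizes under field
operations. -/
def costBound (sz : F → ℕ) (q : Polynomial ℕ) : FieldExpr F → ℕ → ℕ
  | const c, _ => 1 + sz c
  | inp c e, s => e.costBound s + ((1 + sz c) + (1 + sz c + s + q.eval (sz c + s)))
  | ite e f g, s => e.costBound s + (1 + (costBound sz q f s + costBound sz q g s))

theorem polyBounded_costBound {F : Type u} (sz : F → ℕ) (q : Polynomial ℕ) (f : FieldExpr F) :
    PolyBounded (f.costBound sz q) := by
  induction f with
  | const c => exact PolyBounded.const _
  | inp c e =>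
    exact e.polyBounded_costBound.add ((PolyBounded.const (1 + sz c)).add
      (((PolyBounded.const (1 + sz c)).add PolyBounded.id).add
        ((PolyBounded.eval q).comp ((PolyBounded.const (sz c)).add PolyBounded.id))))
  | ite e f g hf hg =>
    exact e.polyBounded_costBound.add ((PolyBounded.const 1).add (hf.add hg))

theorem halts_compile {sz : F → ℕ} {q : Polynomial ℕ}
    (hq : ∀ a b : F, sz (a * b) ≤ q.eval (sz a + sz b)) {a b : ℕ} (hab : a ≠ 4) (hb : b ≠ 4)
    (f : FieldExpr F) {s : ℕ} : ∀ {σ : State F}, (∀ r < 20, σ.reg r ≤ s) →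
    (∀ i, sz (σ.mem a i) ≤ s) →
    Halts sz (f.compile a b) σ (f.costBound sz q s) fun τ =>
      (∀ r < 20, τ.reg r = σ.reg r) ∧ (∀ c ≠ 4, c ≠ b → τ.mem c = σ.mem c) ∧
        τ.mem b = Function.update (σ.mem b) (σ.reg 10) (f.eval σ.reg (σ.mem a)) := by
  induction f with
  | const c =>
    intro σ hs hx
    refine Halts.op le_rfl ⟨fun r hr => rfl, fun c hc hcb => ?_, ?_⟩
    · simp [Op.apply, State.set, Function.update_of_ne hcb]
    · simp [Op.apply, State.set]
  | inp c e =>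
    intro σ hs hx
    refine (e.halts_compile sz le_rfl hs).seq fun τ ⟨h1, h2, h3⟩ => ?_
    refine Halts.seq (c := 1 + sz c) (mid := fun υ => υ = τ.set 4 10 c) (Halts.op le_rfl rfl) ?_
    rintro _ rfl
    have e1 : (τ.set 4 10 c).get 4 10 = c := by simp [State.get, State.set]
    have e2 : (τ.set 4 10 c).get a 20 = σ.mem a (e.eval σ.reg) := by
      simp [State.get, State.set, Function.update_of_ne hab, h1, h3]
    refine Halts.op ?_ ⟨fun r hr => h2 r hr, fun d hd hdb => ?_, ?_⟩
    · simp only [Op.cost, e1, e2]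
      have h5 := hx (e.eval σ.reg)
      have h6 := (hq c (σ.mem a (e.eval σ.reg))).trans
        (eval_mono q (Nat.add_le_add_left h5 (sz c)))
      simp only at h6
      omega
    · simp [Op.apply, State.set, Function.update_of_ne hdb, Function.update_of_ne hd, h3]
    · simp only [Op.apply, e1, e2]
      simp [State.set, Function.update_of_ne hb, h3, h2 10 (by norm_num)]
  | ite e f g hf hg =>
    intro σ hs hx
    refine (e.halts_compile sz le_rfl hs).seq fun τ ⟨h1, h2, h3⟩ => ?_
    have hs' : ∀ r < 20, τ.reg r ≤ s := fun r hr => by rw [h2 r hr]; exact hs r hr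
    have hev : ∀ h : FieldExpr F, h.eval τ.reg (τ.mem a) = h.eval σ.reg (σ.mem a) :=
      fun h => by rw [h3, h.eval_congr _ h2]
    have h10 := h2 10 (by norm_num)
    by_cases h0 : e.eval σ.reg = 0
    · obtain ⟨t, υ, r1, r2, r3, r4, r5⟩ := hf hs' (by rw [h3]; exact hx)
      refine ⟨1 + t, υ, Runs.zero_yes (h1.trans h0) r1, by omega, fun r hr => ?_,
        fun c h4 hcb => ?_, ?_⟩
      · rw [r3 r hr, h2 r hr]
      · rw [r4 c h4 hcb, h3]
      · rw [r5, hev, h10, h3]; simp [eval, h0]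
    · obtain ⟨t, υ, r1, r2, r3, r4, r5⟩ := hg hs' (by rw [h3]; exact hx)
      refine ⟨1 + t, υ, Runs.zero_no (by rw [h1]; exact h0) r1, by omega, fun r hr => ?_,
        fun c h4 hcb => ?_, ?_⟩
      · rw [r3 r hr, h2 r hr]
      · rw [r4 c h4 hcb, h3]
      · rw [r5, hev, h10, h3]; simp [eval, h0]

end FieldExpr

variable {F : Type u} [Field F]

/-! ### Loops and reductions given by expressions -/

/-- Copy register `s` to register `r`. -/
def copyReg (r s : ℕ) : Program F := .seq (.op (.nconst r 0)) (.op (.nadd r s r))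

theorem halts_copyReg (sz : F → ℕ) {r s : ℕ} (h : r ≠ s) (σ : State F) :
    Halts sz (copyReg r s) σ (2 + σ.reg s) fun τ => τ = σ.setReg r (σ.reg s) := by
  refine Halts.mono (c := 1 + (1 + σ.reg s)) (Halts.seq (mid := fun τ => τ = σ.setReg r 0)
    (Halts.op (by simp [Op.cost]) rfl) ?_) (by omega) fun _ h => h
  rintro _ rfl
  refine Halts.op ?_ ?_
  · simp [Op.cost, State.setReg, Function.update_of_ne h.symm]
  · simp [Op.apply, State.setReg, Function.update_of_ne h.symm]

/-- Run `body` with register `i` containing `0, 1, …, n - 1`, where `n` is the content of register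
`D`; register `c` is used as a countdown and register `9` is supposed to contain `1`. -/
def forLoop (c i D : ℕ) (body : Program F) : Program F :=
  .seq (copyReg c D) (.seq (.op (.nconst i 0))
    (.loop c (.seq body (.seq (.op (.nadd i i 9)) (.op (.nsub c c 9))))))

theorem halts_forLoop {sz : F → ℕ} {c i D n t : ℕ} {body : Program F} (I : ℕ → State F → Prop)
    (hci : c ≠ i) (hi9 : i ≠ 9) (hcD : c ≠ D)
    (hc : ∀ x σ v, v ≤ n → I x σ → I x (σ.setReg c v))
    (hi : ∀ x σ v, v ≤ n → I x σ → I x (σ.setReg i v))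
    (hI : ∀ x σ, I x σ → σ.reg 9 = 1 ∧ σ.reg D = n)
    (hbody : ∀ x < n, ∀ σ, I x σ → σ.reg i = x → σ.reg c = n - x →
      Halts sz body σ t fun τ => I (x + 1) τ ∧ τ.reg i = x ∧ τ.reg c = n - x)
    {σ : State F} (h0 : I 0 σ) :
    Halts sz (forLoop c i D body) σ (n * (t + 2 * n + 3) + n + 4) (I n) := by
  have loop : ∀ r x, x + r = n → ∀ σ, I x σ → σ.reg i = x → σ.reg c = n - x →
      Halts sz (.loop c (.seq body (.seq (.op (.nadd i i 9)) (.op (.nsub c c 9))))) σ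
        (r * (t + 2 * n + 3) + 1) (I n) := by
    intro r
    induction r with
    | zero =>
      intro x hx σ h1 h2 h3
      obtain rfl : x = n := by omega
      exact ⟨1, σ, Runs.loop_stop (by omega), by omega, h1⟩
    | succ r ih =>
      intro x hx σ h1 h2 h3
      have key : Halts sz (.seq body (.seq (.op (.nadd i i 9)) (.op (.nsub c c 9)))) σ
          (t + ((2 + n) + n)) fun τ => I (x + 1) τ ∧ τ.reg i = x + 1 ∧ τ.reg c = n - (x + 1) := by
        refine (hbody x (by omega) σ h1 h2 h3).seq fun τ ⟨g1, g2, g3⟩ => ?_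
        obtain ⟨g4, -⟩ := hI _ _ g1
        refine Halts.seq (mid := fun υ => υ = τ.setReg i (x + 1)) (Halts.op ?_ ?_) ?_
        · simp only [Op.cost, g2, g4]; omega
        · simp only [Op.apply, g2, g4]
        rintro _ rfl
        refine Halts.op ?_ ?_
        · simp only [Op.cost, State.setReg, Function.update_of_ne hci, g3, g4,
            Function.update_of_ne hi9.symm]
          omega
        · have e : (Op.nsub c c 9 : Op F).apply (τ.setReg i (x + 1)) =
              (τ.setReg i (x + 1)).setReg c (n - (x + 1)) := by
            simp only [Op.apply, State.setReg, Function.update_of_ne hci, g3, g4,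
              Function.update_of_ne hi9.symm, Nat.sub_sub]
          rw [e]
          refine ⟨hc _ _ _ (by omega) (hi _ _ _ (by omega) g1), ?_, ?_⟩
          · simp [State.setReg, Function.update_of_ne hci.symm]
          · simp [State.setReg]
      obtain ⟨s, τ, r1, r2, r3, r4, r5⟩ := key
      obtain ⟨s', υ, q1, q2, q3⟩ := ih (x + 1) (by omega) τ r3 r4 r5
      refine ⟨_, υ, Runs.loop_step (by omega) r1 q1, ?_, q3⟩
      rw [Nat.succ_mul]
      omega
  have hD := (hI _ _ h0).2
  refine Halts.mono (c := (2 + n) + (1 + (n * (t + 2 * n + 3) + 1))) ?_ (by omega) fun _ h => h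
  have hcopy := halts_copyReg sz hcD σ
  rw [hD] at hcopy
  refine hcopy.seq ?_
  rintro _ rfl
  refine Halts.seq (mid := fun υ => υ = (σ.setReg c n).setReg i 0) (Halts.op le_rfl rfl) ?_
  rintro _ rfl
  refine loop n 0 (by omega) _ (hi _ _ _ (by omega) (hc _ _ _ le_rfl h0)) ?_ ?_
  · simp [State.setReg]
  · simp [State.setReg, Function.update_of_ne hci]

/-- Put the value of an expression into register `r`. -/
def assign (r : ℕ) (e : NatExpr) : Program F := .seq (e.compile 20) (copyReg r 20)

theorem halts_assign (sz : F → ℕ) {r s : ℕ} (hr : r < 20) (e : NatExpr) {σ : State F}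
    (hs : ∀ r < 20, σ.reg r ≤ s) :
    Halts sz (assign r e) σ (e.costBound s + (2 + e.bound s)) fun τ =>
      τ.reg r = e.eval σ.reg ∧ (∀ r' < 20, r' ≠ r → τ.reg r' = σ.reg r') ∧ τ.mem = σ.mem := by
  refine (e.halts_compile sz le_rfl hs).seq fun τ ⟨h1, h2, h3⟩ => ?_
  refine (halts_copyReg sz (by omega) τ).mono ?_ ?_
  · rw [h1]; have := e.eval_le_bound hs; omega
  · rintro _ rfl
    refine ⟨by simp [State.setReg, h1], fun r' h hr' => ?_, h3⟩
    simp [State.setReg, Function.update_of_ne hr', h2 r' h]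

/-- The invariant of the three nested loops: `p` cells of the output have been written. -/
structure LoopInv {F : Type u} (d : ℕ → ℕ) (s : ℕ) (x : ℕ → ℕ → F) (o : ℕ → ℕ → F) (p : ℕ)
    (σ : State F) : Prop where
  dims : ∀ r < 10, r ≠ 3 → r ≠ 4 → r ≠ 5 → σ.reg r = d r
  ptr : σ.reg 10 = p
  le : ∀ r < 20, σ.reg r ≤ s
  inp : ∀ a < 2, σ.mem a = x a
  out : ∀ a < 2, ∀ q < p, σ.mem (2 + a) q = o a q

theorem LoopInv.setReg {F : Type u} {d : ℕ → ℕ} {s : ℕ} {x o : ℕ → ℕ → F} {p : ℕ} {σ : State F}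
    (h : LoopInv d s x o p σ) {r v : ℕ} (hv : v ≤ s)
    (hr : r = 3 ∨ r = 4 ∨ r = 5 ∨ 10 < r) : LoopInv d s x o p (σ.setReg r v) where
  dims r' h1 h2 h3 h4 := by
    rw [← h.dims r' h1 h2 h3 h4]
    exact Function.update_of_ne (by omega) _ _
  ptr := by
    rw [← h.ptr]
    exact Function.update_of_ne (by omega) _ _
  le r' h' := by
    by_cases e : r' = r
    · subst e; simpa [State.setReg] using hv
    · simpa [State.setReg, Function.update_of_ne e] using h.le r' h'
  inp := h.inp
  out := h.out

/-- The body of the loops: write one cell of each output object and advance the pointer. -/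
def emit (f : FieldExpr F) : Program F :=
  .seq (f.compile 0 2) (.seq (f.compile 1 3) (.op (.nadd 10 10 9)))

theorem halts_emit {sz : F → ℕ} {q : Polynomial ℕ}
    (hq : ∀ a b : F, sz (a * b) ≤ q.eval (sz a + sz b)) (f : FieldExpr F) {d : ℕ → ℕ} {s : ℕ}
    {x o : ℕ → ℕ → F} {p : ℕ} {σ : State F} (h : LoopInv d s x o p σ) (hd : d 9 = 1)
    (hp : p + 1 ≤ s) (hx : ∀ a i, sz (x a i) ≤ s)
    (ho : ∀ a < 2, o a p = f.eval σ.reg (x a)) :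
    Halts sz (emit f) σ (f.costBound sz q s + (f.costBound sz q s + (2 + s))) fun τ =>
      LoopInv d s x o (p + 1) τ ∧ ∀ r < 20, r ≠ 10 → τ.reg r = σ.reg r := by
  refine (f.halts_compile hq (by norm_num) (by norm_num) h.le
    (fun i => by rw [h.inp 0 (by norm_num)]; exact hx 0 i)).seq fun τ ⟨h1, h2, h3⟩ => ?_
  have m1 : τ.mem 1 = x 1 := by rw [h2 1 (by norm_num) (by norm_num), h.inp 1 (by norm_num)]
  refine (f.halts_compile hq (by norm_num) (by norm_num) (fun r hr => (h1 r hr).trans_le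
      (h.le r hr))
    (fun i => by rw [m1]; exact hx 1 i)).seq fun υ ⟨g1, g2, g3⟩ => ?_
  have hreg : ∀ r < 20, υ.reg r = σ.reg r := fun r hr => (g1 r hr).trans (h1 r hr)
  have r9 : υ.reg 9 = 1 := by
    rw [hreg 9 (by norm_num), h.dims 9 (by norm_num) (by norm_num) (by norm_num) (by norm_num), hd]
  have r10 : υ.reg 10 = p := by rw [hreg 10 (by norm_num), h.ptr]
  have hev : f.eval τ.reg (x 1) = f.eval σ.reg (x 1) := f.eval_congr _ h1
  refine Halts.op (by simp only [Op.cost, r9, r10]; omega) ?_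
  have happ : (Op.nadd 10 10 9 : Op F).apply υ = υ.setReg 10 (p + 1) := by
    simp only [Op.apply, r9, r10]
  rw [happ]
  refine ⟨⟨fun r h1 h2 h3 h4 => ?_, by simp [State.setReg], fun r hr => ?_, fun a ha => ?_,
    fun a ha t ht => ?_⟩, fun r hr hr' => ?_⟩
  · rw [← h.dims r h1 h2 h3 h4, ← hreg r (by omega)]
    exact Function.update_of_ne (by omega) _ _
  · by_cases e : r = 10
    · subst e; simpa [State.setReg] using hp
    · simpa [State.setReg, Function.update_of_ne e, hreg r hr] using h.le r hr
  · rw [← h.inp a ha]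
    change υ.mem a = σ.mem a
    rw [g2 a (by omega) (by omega), h2 a (by omega) (by omega)]
  · change υ.mem (2 + a) t = o a t
    have hp1 : τ.reg 10 = p := by rw [h1 10 (by norm_num), h.ptr]
    have hcases : a = 0 ∨ a = 1 := by omega
    rcases hcases with rfl | rfl
    · rw [g2 2 (by norm_num) (by norm_num), h3, h.ptr]
      by_cases e : t = p
      · subst e; rw [Function.update_self, ho 0 ha, h.inp 0 ha]
      · rw [Function.update_of_ne e, ← h.out 0 ha t (by omega)]
    · rw [g3, hp1, m1, hev]
      by_cases e : t = p
      · subst e; rw [Function.update_self, ho 1 ha]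
      · rw [Function.update_of_ne e, h2 3 (by norm_num) (by norm_num), ← h.out 1 ha t (by omega)]
  · rw [← hreg r hr]
    exact Function.update_of_ne hr' _ _

/-- Fill the output arrays in lexicographic order. -/
def fill (f : FieldExpr F) : Program F :=
  forLoop 11 3 6 (forLoop 12 4 7 (forLoop 13 5 8 (emit f)))

/-- A bound for the cost of one of the nested loops. -/
def loopCost (n t : ℕ) : ℕ := n * (t + 2 * n + 3) + n + 4

theorem loopCost_mono {n n' t t' : ℕ} (h : n ≤ n') (h' : t ≤ t') :
    loopCost n t ≤ loopCost n' t' := by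
  unfold loopCost
  gcongr

theorem PolyBounded.loopCost {f g : ℕ → ℕ} (hf : PolyBounded f) (hg : PolyBounded g) :
    PolyBounded fun s => TensorIso.loopCost (f s) (g s) :=
  ((hf.mul ((hg.add ((PolyBounded.const 2).mul hf)).add (PolyBounded.const 3))).add hf).add
    (PolyBounded.const 4)

/-- A bound for the cost of filling the output arrays. -/
def fillCost (sz : F → ℕ) (q : Polynomial ℕ) (f : FieldExpr F) (s : ℕ) : ℕ :=
  loopCost s (loopCost s (loopCost s (f.costBound sz q s + (f.costBound sz q s + (2 + s)))))

theorem halts_fill {sz : F → ℕ} {q : Polynomial ℕ}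
    (hq : ∀ a b : F, sz (a * b) ≤ q.eval (sz a + sz b)) (f : FieldExpr F) {d : ℕ → ℕ} {s : ℕ}
    {x o : ℕ → ℕ → F} {σ : State F} (h : LoopInv d s x o 0 σ) (hd : d 9 = 1)
    {a b c : ℕ} (ha : d 6 = a) (hb : d 7 = b) (hc : d 8 = c)
    (hs : a * b * c + 1 ≤ s) (has : a ≤ s) (hbs : b ≤ s) (hcs : c ≤ s)
    (hx : ∀ a i, sz (x a i) ≤ s)
    (ho : ∀ e < 2, ∀ i < a, ∀ j < b, ∀ k < c, ∀ ρ : ℕ → ℕ,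
      (∀ r < 10, r ≠ 3 → r ≠ 4 → r ≠ 5 → ρ r = d r) → ρ 3 = i → ρ 4 = j → ρ 5 = k →
      o e ((i * b + j) * c + k) = f.eval ρ (x e)) :
    Halts sz (fill f) σ (fillCost sz q f s) (LoopInv d s x o (a * b * c)) := by
  have hreg : ∀ {r v r' : ℕ} {σ : State F}, r' ≠ r → (σ.setReg r v).reg r' = σ.reg r' :=
    fun hr => Function.update_of_ne hr _ _
  refine Halts.mono (c := loopCost a (loopCost b (loopCost c
    (f.costBound sz q s + (f.costBound sz q s + (2 + s)))))) ?_
    (loopCost_mono has (loopCost_mono hbs (loopCost_mono hcs le_rfl))) fun _ h => h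
  refine (halts_forLoop (n := a) (fun i τ => LoopInv d s x o (i * (b * c)) τ) (by norm_num)
    (by norm_num) (by norm_num) (fun i τ v hv h => h.setReg (by omega) (by norm_num))
    (fun i τ v hv h => h.setReg (by omega) (by norm_num))
    (fun i τ h => ⟨by rw [h.dims 9 (by norm_num) (by norm_num) (by norm_num) (by norm_num), hd],
      by rw [h.dims 6 (by norm_num) (by norm_num) (by norm_num) (by norm_num), ha]⟩) ?_
    (by simpa using h)).mono le_rfl fun τ h => by rw [mul_assoc]; exact h
  intro i hi τ hτ hτ3 hτ11
  refine (halts_forLoop (n := b) (fun j τ => LoopInv d s x o ((i * b + j) * c) τ ∧ τ.reg 3 = i ∧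
      τ.reg 11 = a - i) (by norm_num)
    (by norm_num) (by norm_num)
    (fun j τ v hv h => ⟨h.1.setReg (by omega) (by norm_num), by
      rw [hreg (by norm_num), hreg (by norm_num)]; exact h.2⟩)
    (fun j τ v hv h => ⟨h.1.setReg (by omega) (by norm_num), by
      rw [hreg (by norm_num), hreg (by norm_num)]; exact h.2⟩)
    (fun j τ h => ⟨by rw [h.1.dims 9 (by norm_num) (by norm_num) (by norm_num) (by norm_num), hd],
      by rw [h.1.dims 7 (by norm_num) (by norm_num) (by norm_num) (by norm_num), hb]⟩) ?_
    ⟨by simpa [mul_assoc] using hτ, hτ3, hτ11⟩).mono le_rfl fun τ h =>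
      ⟨by convert h.1 using 1; ring, h.2⟩
  intro j hj τ hτ hτ4 hτ12
  refine (halts_forLoop (n := c) (fun k τ => LoopInv d s x o ((i * b + j) * c + k) τ ∧
      (τ.reg 3 = i ∧ τ.reg 11 = a - i) ∧ τ.reg 4 = j ∧ τ.reg 12 = b - j) (by norm_num)
    (by norm_num) (by norm_num)
    (fun k τ v hv h => ⟨h.1.setReg (by omega) (by norm_num), by
      rw [hreg (by norm_num), hreg (by norm_num), hreg (by norm_num), hreg (by norm_num)]
      exact h.2⟩)
    (fun k τ v hv h => ⟨h.1.setReg (by omega) (by norm_num), by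
      rw [hreg (by norm_num), hreg (by norm_num), hreg (by norm_num), hreg (by norm_num)]
      exact h.2⟩)
    (fun k τ h => ⟨by rw [h.1.dims 9 (by norm_num) (by norm_num) (by norm_num) (by norm_num), hd],
      by rw [h.1.dims 8 (by norm_num) (by norm_num) (by norm_num) (by norm_num), hc]⟩) ?_
    ⟨by simpa using hτ.1, hτ.2, hτ4, hτ12⟩).mono le_rfl fun τ h =>
      ⟨⟨by convert h.1 using 1; ring, h.2.1⟩, h.2.2⟩
  intro k hk τ ⟨hτ, ⟨h3, h11⟩, h4, h12⟩ hτ5 hτ13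
  have hlt : (i * b + j) * c + k + 1 ≤ a * b * c := by
    have h1 : i * b + j + 1 ≤ a * b := by
      calc i * b + j + 1 ≤ i * b + b := by omega
        _ = (i + 1) * b := by ring
        _ ≤ a * b := Nat.mul_le_mul_right _ hi
    calc (i * b + j) * c + k + 1 ≤ (i * b + j) * c + c := by omega
      _ = (i * b + j + 1) * c := by ring
      _ ≤ a * b * c := Nat.mul_le_mul_right _ h1
  refine (halts_emit hq f hτ hd (by omega) hx fun e he => ?_).mono le_rfl ?_
  · exact ho e he i hi j hj k hk _ hτ.dims h3 h4 hτ5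
  · rintro υ ⟨h1, h2⟩
    refine ⟨⟨h1, ⟨?_, ?_⟩, ?_, ?_⟩, ?_, ?_⟩ <;> rw [h2 _ (by norm_num) (by norm_num)] <;> assumption

theorem Arr.toList_eq_ofFn {F : Type u} {a b c : ℕ} (A : Arr F a b c) :
    A.toList = List.ofFn fun t : Fin (a * (b * c)) =>
      A t.divNat t.modNat.divNat t.modNat.modNat := by
  rw [List.ofFn_mul]
  have hd : ∀ {x y : ℕ} (i : Fin x) (j : Fin y) (h : (i : ℕ) * y + j < x * y),
      (⟨i * y + j, h⟩ : Fin (x * y)).divNat = i := by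
    intro x y i j h
    ext
    simp only [Fin.coe_divNat]
    rw [mul_comm, Nat.mul_add_div (by have := j.2; omega), Nat.div_eq_of_lt j.2, add_zero]
  have hm : ∀ {x y : ℕ} (i : Fin x) (j : Fin y) (h : (i : ℕ) * y + j < x * y),
      (⟨i * y + j, h⟩ : Fin (x * y)).modNat = j := by
    intro x y i j h
    ext
    simp only [Fin.coe_modNat]
    rw [mul_comm, Nat.mul_add_mod, Nat.mod_eq_of_lt j.2]
  simp only [hd, hm]
  unfold Arr.toList
  congr 2
  funext i
  rw [List.ofFn_mul]
  simp only [hd, hm]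

theorem Arr.length_toList {F : Type u} {a b c : ℕ} (A : Arr F a b c) :
    A.toList.length = a * (b * c) := by
  rw [Arr.toList_eq_ofFn, List.length_ofFn]

theorem Arr.getD_toList {F : Type u} {a b c : ℕ} (A : Arr F a b c) (i : Fin a) (j : Fin b)
    (k : Fin c) (z : F) : A.toList.getD ((i * b + j) * c + k) z = A i j k := by
  have h1 : (j : ℕ) * c + k < b * c := by
    calc (j : ℕ) * c + k < j * c + c := by omega
      _ = (j + 1) * c := by ring
      _ ≤ b * c := Nat.mul_le_mul_right _ j.2
  have h2 : (i : ℕ) * (b * c) + (j * c + k) < a * (b * c) := by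
    calc (i : ℕ) * (b * c) + (j * c + k) < i * (b * c) + b * c := by omega
      _ = (i + 1) * (b * c) := by ring
      _ ≤ a * (b * c) := Nat.mul_le_mul_right _ i.2
  have e : ((i : ℕ) * b + j) * c + k = i * (b * c) + (j * c + k) := by ring
  rw [e, Arr.toList_eq_ofFn, List.getD_eq_getElem _ _ (by simpa using h2), List.getElem_ofFn]
  have hbc : 0 < b * c := by omega
  have hc : 0 < c := by have := k.2; omega
  congr 1
  · ext
    simp only [Fin.coe_divNat]
    rw [mul_comm, Nat.mul_add_div hbc, Nat.div_eq_of_lt h1, add_zero]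
  · ext
    simp only [Fin.coe_divNat, Fin.coe_modNat]
    rw [mul_comm (i : ℕ), Nat.mul_add_mod, Nat.mod_eq_of_lt h1, mul_comm, Nat.mul_add_div hc,
      Nat.div_eq_of_lt k.2, add_zero]
  · ext
    simp only [Fin.coe_modNat]
    rw [mul_comm (i : ℕ), Nat.mul_add_mod, Nat.mod_eq_of_lt h1, mul_comm, Nat.mul_add_mod,
      Nat.mod_eq_of_lt k.2]

variable {F : Type u} [Field F]

theorem size_le_of_mem {P : IsoProblem F} (sz : F → ℕ) {f : P.Format} (A B : P.Obj f) {x : F}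
    (hx : x ∈ P.entries A ++ P.entries B) : sz x ≤ P.size sz A B := by
  unfold IsoProblem.size
  have : 1 + sz x ≤ ((P.entries A ++ P.entries B).map fun x => 1 + sz x).sum :=
    List.le_sum_of_mem (List.mem_map_of_mem hx)
  omega

theorem size_input_mem_le {P : IsoProblem F} (sz : F → ℕ) {f : P.Format} (A B : P.Obj f)
    (a i : ℕ) : sz ((P.input A B).mem a i) ≤ P.size sz A B + sz 0 := by
  have key : ∀ l : List F, (∀ x ∈ l, x ∈ P.entries A ++ P.entries B) →
      sz (l.getD i 0) ≤ P.size sz A B + sz 0 := by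
    intro l hl
    rcases lt_or_ge i l.length with h | h
    · rw [List.getD_eq_getElem _ _ h]
      exact (size_le_of_mem sz A B (hl _ (List.getElem_mem h))).trans (Nat.le_add_right _ _)
    · rw [List.getD_eq_default _ _ h]
      omega
  simp only [IsoProblem.input]
  split_ifs
  · exact key _ fun x hx => by simp [hx]
  · exact key _ fun x hx => by simp [hx]
  · omega

/-- The environments in which the first three registers contain the dimensions of a tensor. -/
structure IsEnv (ℓ n m : ℕ) (ρ : ℕ → ℕ) : Prop where
  h0 : ρ 0 = ℓ
  h1 : ρ 1 = n
  h2 : ρ 2 = m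

/-- The program that computes an array of format `D₁ × D₂ × D₃` with entries given by `f`, once from
each of the two input arrays.  Registers 0 to 2 hold the dimensions of the input, 3 to 5 the indices
of the current entry, 6 to 8 the dimensions of the output, 9 the constant one, 10 the position of
the current entry, 11 to 13 the numbers of remaining rounds; those from 20 on are scratch.  The
output format is the one of a tuple of matrices: the second dimension goes to register 0 and the
first one to register 1. -/
def exprProgram (D₁ D₂ D₃ : NatExpr) (f : FieldExpr F) : Program F :=
  .seq (assign 6 D₁) (.seq (assign 7 D₂) (.seq (assign 8 D₃) (.seq (.op (.nconst 9 1))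
    (.seq (fill f) (.seq (copyReg 0 7) (copyReg 1 6))))))

theorem halts_exprProgram {sz : F → ℕ} {q : Polynomial ℕ}
    (hq : ∀ a b : F, sz (a * b) ≤ q.eval (sz a + sz b)) (D₁ D₂ D₃ : NatExpr) (f : FieldExpr F) :
    ∃ cost : ℕ → ℕ, PolyBounded cost ∧
      ∀ (ℓ n m a b c s : ℕ) (x o : ℕ → ℕ → F) (σ : State F),
      (∀ ρ, IsEnv ℓ n m ρ → D₁.eval ρ = a ∧ D₂.eval ρ = b ∧ D₃.eval ρ = c) →
      IsEnv ℓ n m σ.reg → (∀ r, 3 ≤ r → σ.reg r = 0) → σ.mem = x → (∀ r < 20, σ.reg r ≤ s) →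
      (∀ a i, sz (x a i) ≤ s) →
      (∀ e < 2, ∀ i < a, ∀ j < b, ∀ k < c, ∀ ρ : ℕ → ℕ, IsEnv ℓ n m ρ → ρ 3 = i → ρ 4 = j →
        ρ 5 = k → o e ((i * b + j) * c + k) = f.eval ρ (x e)) →
      Halts sz (exprProgram D₁ D₂ D₃ f) σ (cost s) fun τ => τ.reg 0 = b ∧ τ.reg 1 = a ∧
        ∀ e < 2, ∀ t < a * b * c, τ.mem (2 + e) t = o e t := by
  let S : ℕ → ℕ := fun s => s + (D₁.bound s + D₂.bound s + D₃.bound s +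
    D₁.bound s * D₂.bound s * D₃.bound s + 1)
  have hS : PolyBounded S := PolyBounded.id.add ((((D₁.polyBounded_bound.add
    D₂.polyBounded_bound).add D₃.polyBounded_bound).add ((D₁.polyBounded_bound.mul
    D₂.polyBounded_bound).mul D₃.polyBounded_bound)).add (PolyBounded.const 1))
  have hassign : ∀ e : NatExpr, PolyBounded fun s => e.costBound s + (2 + e.bound s) := fun e =>
    e.polyBounded_costBound.add ((PolyBounded.const 2).add e.polyBounded_bound)
  have hfill : PolyBounded (fillCost sz q f) := by
    have hf := f.polyBounded_costBound sz q
    exact PolyBounded.id.loopCost (PolyBounded.id.loopCost (PolyBounded.id.loopCost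
      (hf.add (hf.add ((PolyBounded.const 2).add PolyBounded.id)))))
  let C : ℕ → ℕ := fun s => (D₁.costBound s + (2 + D₁.bound s)) +
    ((D₂.costBound s + (2 + D₂.bound s)) + ((D₃.costBound s + (2 + D₃.bound s)) +
    (2 + (fillCost sz q f s + ((2 + s) + (2 + s))))))
  have hC : PolyBounded C := (hassign D₁).add ((hassign D₂).add ((hassign D₃).add
    ((PolyBounded.const 2).add (hfill.add (((PolyBounded.const 2).add PolyBounded.id).add
      ((PolyBounded.const 2).add PolyBounded.id))))))
  refine ⟨fun s => C (S s), hC.comp hS, ?_⟩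
  intro ℓ n m a b c s x o σ hD henv h3 hmem hs hx ho
  have hsS : s ≤ S s := Nat.le_add_right _ _
  obtain ⟨ha, hb, hc⟩ := hD _ henv
  have ha' : a ≤ D₁.bound s := ha ▸ D₁.eval_le_bound hs
  have hb' : b ≤ D₂.bound s := hb ▸ D₂.eval_le_bound hs
  have hc' : c ≤ D₃.bound s := hc ▸ D₃.eval_le_bound hs
  have habc : a * b * c ≤ D₁.bound s * D₂.bound s * D₃.bound s := by gcongr
  have haS : a ≤ S s := by simp only [S]; omega
  have hbS : b ≤ S s := by simp only [S]; omega
  have hcS : c ≤ S s := by simp only [S]; omega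
  have habcS : a * b * c + 1 ≤ S s := by simp only [S]; omega
  -- bounds for the registers after an assignment
  have hle : ∀ {τ υ : State F} {r v : ℕ}, (∀ r < 20, τ.reg r ≤ S s) → υ.reg r = v → v ≤ S s →
      (∀ r' < 20, r' ≠ r → υ.reg r' = τ.reg r') → ∀ r < 20, υ.reg r ≤ S s := by
    intro τ υ r v h1 h2 h3 h4 r' hr'
    by_cases e : r' = r
    · subst e; rw [h2]; exact h3
    · rw [h4 r' hr' e]; exact h1 r' hr'
  have hs0 : ∀ r < 20, σ.reg r ≤ S s := fun r hr => (hs r hr).trans hsS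
  refine (halts_assign sz (by norm_num) D₁ hs0).seq fun σ₁ ⟨p1, p2, p3⟩ => ?_
  have env1 : IsEnv ℓ n m σ₁.reg := ⟨by rw [p2 0 (by norm_num) (by norm_num), henv.h0],
    by rw [p2 1 (by norm_num) (by norm_num), henv.h1],
    by rw [p2 2 (by norm_num) (by norm_num), henv.h2]⟩
  rw [ha] at p1
  have hs1 := hle hs0 p1 haS p2
  refine (halts_assign sz (by norm_num) D₂ hs1).seq fun σ₂ ⟨q1, q2, q3⟩ => ?_
  have env2 : IsEnv ℓ n m σ₂.reg := ⟨by rw [q2 0 (by norm_num) (by norm_num), env1.h0],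
    by rw [q2 1 (by norm_num) (by norm_num), env1.h1],
    by rw [q2 2 (by norm_num) (by norm_num), env1.h2]⟩
  rw [(hD _ env1).2.1] at q1
  have hs2 := hle hs1 q1 hbS q2
  refine (halts_assign sz (by norm_num) D₃ hs2).seq fun σ₃ ⟨t1, t2, t3⟩ => ?_
  rw [(hD _ env2).2.2] at t1
  have hs3 := hle hs2 t1 hcS t2
  refine Halts.seq (mid := fun τ => τ = σ₃.setReg 9 1)
    (Halts.op (by simp [Op.cost]) rfl) ?_
  rintro _ rfl
  let d : ℕ → ℕ := fun r => [ℓ, n, m, 0, 0, 0, a, b, c, 1].getD r 0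
  have r9 : ∀ r, r ≠ 9 → (σ₃.setReg 9 1).reg r = σ₃.reg r := fun r hr =>
    Function.update_of_ne hr _ _
  have inv : LoopInv d (S s) x o 0 (σ₃.setReg 9 1) := by
    refine ⟨fun r h1 h2 h3 h4 => ?_, ?_, ?_, fun e he => ?_, fun e he t ht => by omega⟩
    · have : r = 0 ∨ r = 1 ∨ r = 2 ∨ r = 6 ∨ r = 7 ∨ r = 8 ∨ r = 9 := by omega
      rcases this with rfl | rfl | rfl | rfl | rfl | rfl | rfl
      · rw [r9 0 (by norm_num), t2 0 (by norm_num) (by norm_num), env2.h0]; rfl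
      · rw [r9 1 (by norm_num), t2 1 (by norm_num) (by norm_num), env2.h1]; rfl
      · rw [r9 2 (by norm_num), t2 2 (by norm_num) (by norm_num), env2.h2]; rfl
      · rw [r9 6 (by norm_num), t2 6 (by norm_num) (by norm_num),
          q2 6 (by norm_num) (by norm_num), p1]; rfl
      · rw [r9 7 (by norm_num), t2 7 (by norm_num) (by norm_num), q1]; rfl
      · rw [r9 8 (by norm_num), t1]; rfl
      · simp [State.setReg, d]
    · rw [r9 10 (by norm_num), t2 10 (by norm_num) (by norm_num),
        q2 10 (by norm_num) (by norm_num), p2 10 (by norm_num) (by norm_num), h3 10 (by norm_num)]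
    · exact hle hs3 (r := 9) (v := 1) (by simp [State.setReg]) (by omega) fun r _ hr => r9 r hr
    · change σ₃.mem e = x e
      rw [t3, q3, p3, hmem]
  refine (halts_fill hq f inv rfl (a := a) (b := b) (c := c) rfl rfl rfl habcS haS hbS hcS
    (fun a i => (hx a i).trans hsS) ?_).seq fun τ hτ => ?_
  · intro e he i hi j hj k hk ρ hρ h3 h4 h5
    exact ho e he i hi j hj k hk ρ ⟨hρ 0 (by norm_num) (by norm_num) (by norm_num) (by norm_num),
      hρ 1 (by norm_num) (by norm_num) (by norm_num) (by norm_num),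
      hρ 2 (by norm_num) (by norm_num) (by norm_num) (by norm_num)⟩ h3 h4 h5
  have e7 : τ.reg 7 = b := hτ.dims 7 (by norm_num) (by norm_num) (by norm_num) (by norm_num)
  have e6 : τ.reg 6 = a := hτ.dims 6 (by norm_num) (by norm_num) (by norm_num) (by norm_num)
  have hcopy := halts_copyReg sz (r := 0) (s := 7) (by norm_num) τ
  rw [e7] at hcopy
  refine (hcopy.mono (c' := 2 + S s) (by omega) fun _ h => h).seq ?_
  rintro _ rfl
  have e6' : (τ.setReg 0 b).reg 6 = a := by simpa [State.setReg] using e6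
  have hcopy := halts_copyReg sz (r := 1) (s := 6) (by norm_num) (τ.setReg 0 b)
  rw [e6'] at hcopy
  refine hcopy.mono (by omega) ?_
  rintro _ rfl
  exact ⟨by simp [State.setReg], by simp [State.setReg], hτ.out⟩

/-- A map of instances whose dimensions and entries are given by expressions is computable in
polynomial time; if it respects and reflects isomorphism, it is a reduction.  The output problem may
read the array as a single object of size `b`, or as a tuple of `a` matrices of size `b`. -/
theorem reduces_of_expr {sz : F → ℕ} (hsz : IsSizeMeasure sz) {Q : IsoProblem F}
    (D₁ D₂ D₃ : NatExpr) (f : FieldExpr F) (a b c : ℕ → ℕ → ℕ → ℕ)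
    (hD : ∀ ℓ n m ρ, IsEnv ℓ n m ρ →
      D₁.eval ρ = a ℓ n m ∧ D₂.eval ρ = b ℓ n m ∧ D₃.eval ρ = c ℓ n m)
    (S : ∀ {ℓ n m : ℕ}, Arr F ℓ n m → Arr F (a ℓ n m) (b ℓ n m) (c ℓ n m))
    (hS : ∀ {ℓ n m : ℕ} (A : Arr F ℓ n m) (ρ : ℕ → ℕ), IsEnv ℓ n m ρ →
      ∀ i j k, ρ 3 = i.1 → ρ 4 = j.1 → ρ 5 = k.1 →
        f.eval ρ (fun t => A.toList.getD t 0) = S A i j k)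
    (h : ∀ {ℓ n m : ℕ} (A B : Arr F ℓ n m), ∃ (g : Q.Format) (A' B' : Q.Obj g),
      (Q.dims g = [b ℓ n m] ∨ Q.dims g = [b ℓ n m, a ℓ n m]) ∧
      Q.entries A' = (S A).toList ∧ Q.entries B' = (S B).toList ∧
      ((∃ (P : GL (Fin ℓ) F) (Q : GL (Fin n) F) (R : GL (Fin m) F), ∀ i' j' k',
        (∑ i, ∑ j, ∑ k, A i j k * P.1 i i' * Q.1 j j' * R.1 k k') = B i' j' k') ↔ Q.Iso A' B')) :
    PolyTimeReduces sz (tensorIso F) Q := by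
  obtain ⟨q, hq⟩ := hsz
  obtain ⟨cost, ⟨p, hp⟩, hrun⟩ := halts_exprProgram (fun a b => (hq a b).2.1) D₁ D₂ D₃ f
  refine ⟨exprProgram D₁ D₂ D₃ f, p.comp (Polynomial.X + Polynomial.C (sz 0)), ?_⟩
  rintro ⟨ℓ, n, m⟩ (A : Arr F ℓ n m) (B : Arr F ℓ n m)
  obtain ⟨g, A', B', hdims, hA, hB, hiso⟩ := h A B
  let s := (tensorIso F).size sz (f := (ℓ, n, m)) A B + sz 0
  let o : ℕ → ℕ → F := fun e t => if e = 0 then (S A).toList.getD t 0 else (S B).toList.getD t 0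
  obtain ⟨t, τ, h1, h2, h3, h4, h5⟩ := hrun ℓ n m (a ℓ n m) (b ℓ n m) (c ℓ n m) s
    ((tensorIso F).input (f := (ℓ, n, m)) A B).mem o ((tensorIso F).input (f := (ℓ, n, m)) A B)
    (hD ℓ n m) ⟨rfl, rfl, rfl⟩
    (fun r hr => by
      obtain ⟨r, rfl⟩ := Nat.exists_eq_add_of_le' hr
      rfl) rfl
    (fun r hr => by
      have hsize : ℓ + n + m ≤ s := by
        have : ((tensorIso F).dims (ℓ, n, m)).sum = ℓ + n + m := by
          simp [tensorIso, add_assoc]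
        simp only [s, IsoProblem.size, this]
        omega
      rcases r with _ | _ | _ | r
      · change ℓ ≤ s; omega
      · change n ≤ s; omega
      · change m ≤ s; omega
      · exact Nat.zero_le _)
    (fun a i => size_input_mem_le sz (P := tensorIso F) (f := (ℓ, n, m)) A B a i)
    (by
      intro e he i hi j hj k hk ρ hρ e3 e4 e5
      have : e = 0 ∨ e = 1 := by omega
      rcases this with rfl | rfl
      · exact (Arr.getD_toList (S A) ⟨i, hi⟩ ⟨j, hj⟩ ⟨k, hk⟩ 0).trans
          (hS A ρ hρ ⟨i, hi⟩ ⟨j, hj⟩ ⟨k, hk⟩ e3 e4 e5).symm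
      · exact (Arr.getD_toList (S B) ⟨i, hi⟩ ⟨j, hj⟩ ⟨k, hk⟩ 0).trans
          (hS B ρ hρ ⟨i, hi⟩ ⟨j, hj⟩ ⟨k, hk⟩ e3 e4 e5).symm)
  refine ⟨t, τ, h1, h2.trans ?_, g, A', B', ⟨?_, ?_, ?_⟩, hiso⟩
  · refine (hp s).trans (le_of_eq ?_)
    simp [s, Polynomial.eval_comp]
  · rcases hdims with e | e <;> rw [e] <;> intro r hr
    · have : r = 0 := by simpa using hr
      subst this
      simpa using h3
    · have : r = 0 ∨ r = 1 := by simp only [List.length_cons, List.length_nil] at hr; omega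
      rcases this with rfl | rfl
      · simpa using h3
      · simpa using h4
  · rw [hA]
    intro t ht
    rw [Arr.length_toList, ← mul_assoc] at ht
    exact h5 0 (by norm_num) t ht
  · rw [hB]
    intro t ht
    rw [Arr.length_toList, ← mul_assoc] at ht
    exact h5 1 (by norm_num) t ht

/-! ### Linear substitutions in three-way arrays -/

section Trans
variable {F : Type u} [Field F]
variable {I J K I' J' K' I'' J'' K'' : Type*} [Fintype I] [Fintype J] [Fintype K]
  [Fintype I'] [Fintype J'] [Fintype K']

/-- The trilinear form with coefficients `T`. -/
def tri (T : I → J → K → F) (x : I → F) (y : J → F) (z : K → F) : F :=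
  ∑ i, ∑ j, ∑ k, T i j k * x i * y j * z k

/-- The array obtained from `T` by linear substitutions in the three directions. -/
def trans (T : I → J → K → F) (P : Matrix I I' F) (Q : Matrix J J' F) (R : Matrix K K' F) :
    I' → J' → K' → F :=
  fun i' j' k' => ∑ i, ∑ j, ∑ k, T i j k * P i i' * Q j j' * R k k'

open Matrix in
theorem tri_trans (T : I → J → K → F) (P : Matrix I I' F) (Q : Matrix J J' F) (R : Matrix K K' F)
    (x : I' → F) (y : J' → F) (z : K' → F) :
    tri (trans T P Q R) x y z = tri T (P *ᵥ x) (Q *ᵥ y) (R *ᵥ z) := by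
  have h : ∀ (t : F) (a : I' → F) (b : J' → F) (c : K' → F),
      t * (∑ i, a i) * (∑ j, b j) * (∑ k, c k) = ∑ i, ∑ j, ∑ k, t * a i * b j * c k := by
    intro t a b c
    simp only [Finset.mul_sum, Finset.sum_mul]
    rw [Finset.sum_comm]
    refine (Finset.sum_congr rfl fun j _ => Finset.sum_comm).trans ?_
    rw [Finset.sum_comm]
  calc tri (trans T P Q R) x y z
      = ∑ p' : I' × J' × K', ∑ p : I × J × K, T p.1 p.2.1 p.2.2 * (P p.1 p'.1 * x p'.1) *
          (Q p.2.1 p'.2.1 * y p'.2.1) * (R p.2.2 p'.2.2 * z p'.2.2) := by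
        simp only [tri, trans, Fintype.sum_prod_type, Finset.sum_mul]
        congr! 6
        ring
    _ = ∑ p : I × J × K, ∑ p' : I' × J' × K', T p.1 p.2.1 p.2.2 * (P p.1 p'.1 * x p'.1) *
          (Q p.2.1 p'.2.1 * y p'.2.1) * (R p.2.2 p'.2.2 * z p'.2.2) := Finset.sum_comm
    _ = _ := by
        simp only [tri, Matrix.mulVec, dotProduct, h, Fintype.sum_prod_type]

section
variable [DecidableEq I] [DecidableEq J] [DecidableEq K]

theorem tri_single (T : I → J → K → F) (i : I) (j : J) (k : K) :
    tri T (Pi.single i 1) (Pi.single j 1) (Pi.single k 1) = T i j k := by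
  simp [tri, Pi.single_apply]

theorem eq_of_tri_eq {T T' : I → J → K → F} (h : ∀ x y z, tri T x y z = tri T' x y z) : T = T' := by
  funext i j k
  rw [← tri_single T, h, tri_single]

theorem trans_trans [DecidableEq I'] [DecidableEq J'] [DecidableEq K'] [Fintype I''] [Fintype J'']
    [Fintype K''] [DecidableEq I''] [DecidableEq J''] [DecidableEq K'']
    (T : I → J → K → F) (P : Matrix I I' F) (Q : Matrix J J' F) (R : Matrix K K' F)
    (P' : Matrix I' I'' F) (Q' : Matrix J' J'' F) (R' : Matrix K' K'' F) :
    trans (trans T P Q R) P' Q' R' = trans T (P * P') (Q * Q') (R * R') :=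
  eq_of_tri_eq fun x y z => by simp only [tri_trans, Matrix.mulVec_mulVec]

theorem trans_one (T : I → J → K → F) : trans T 1 1 1 = T :=
  eq_of_tri_eq fun x y z => by simp only [tri_trans, Matrix.one_mulVec]

theorem trans_symm {T T' : I → J → K → F} {P : GL I F} {Q : GL J F} {R : GL K F}
    (h : trans T P.1 Q.1 R.1 = T') : trans T' P⁻¹.1 Q⁻¹.1 R⁻¹.1 = T := by
  rw [← h, trans_trans, ← Units.val_mul, ← Units.val_mul, ← Units.val_mul, mul_inv_cancel,
    mul_inv_cancel, mul_inv_cancel]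
  exact trans_one T
end

theorem trans_swap₁₂ (T : I → J → K → F) (P : Matrix I I' F) (Q : Matrix J J' F)
    (R : Matrix K K' F) :
    trans (fun j i k => T i j k) Q P R = fun j i k => trans T P Q R i j k := by
  funext j i k
  simp only [trans]
  rw [Finset.sum_comm]
  congr! 3
  ring

theorem trans_swap₁₃ (T : I → J → K → F) (P : Matrix I I' F) (Q : Matrix J J' F)
    (R : Matrix K K' F) :
    trans (fun k j i => T i j k) R Q P = fun k j i => trans T P Q R i j k := by
  funext k j i
  simp only [trans]
  rw [Finset.sum_comm]
  refine (Finset.sum_congr rfl fun j _ => Finset.sum_comm).trans ?_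
  rw [Finset.sum_comm]
  congr! 3
  ring

end Trans

/-! ### Tuples with the same span -/

section Span
variable {F : Type u} [Field F]

/-- Linear maps from the same finite-dimensional space with the same range differ by an
automorphism of the source. -/
theorem exists_equiv_of_range_eq {V M : Type*} [AddCommGroup V] [Module F V]
    [FiniteDimensional F V] [AddCommGroup M] [Module F M] (X Y : V →ₗ[F] M)
    (h : LinearMap.range X = LinearMap.range Y) : ∃ e : V ≃ₗ[F] V, ∀ v, X (e v) = Y v := by
  obtain ⟨C, hC⟩ := (LinearMap.ker X).exists_isCompl
  obtain ⟨D, hD⟩ := (LinearMap.ker Y).exists_isCompl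
  have hker : Module.finrank F (LinearMap.ker Y) = Module.finrank F (LinearMap.ker X) := by
    have h1 := X.finrank_range_add_finrank_ker
    have h2 := Y.finrank_range_add_finrank_ker
    rw [h] at h1
    omega
  let k := LinearEquiv.ofFinrankEq _ _ hker
  let eX := X.kerComplementEquivRange hC.symm
  let eY := Y.kerComplementEquivRange hD.symm
  let c : D ≃ₗ[F] C := eY.trans ((LinearEquiv.ofEq _ _ h.symm).trans eX.symm)
  have hc : ∀ d : D, X (c d) = Y d := by
    intro d
    have h1 : (eX (c d) : M) = (eY d : M) := by
      simp only [c, LinearEquiv.trans_apply, LinearEquiv.apply_symm_apply]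
      rfl
    exact h1
  refine ⟨(Submodule.prodEquivOfIsCompl _ _ hD).symm.trans ((k.prodCongr c).trans
    (Submodule.prodEquivOfIsCompl _ _ hC)), fun v => ?_⟩
  obtain ⟨⟨a, d⟩, rfl⟩ := (Submodule.prodEquivOfIsCompl _ _ hD).surjective v
  simp [hc]

/-- Finite tuples with the same span differ by an invertible matrix. -/
theorem exists_gl_of_span_eq {ι M : Type*} [Fintype ι] [DecidableEq ι] [AddCommGroup M]
    [Module F M] (x y : ι → M)
    (h : Submodule.span F (Set.range x) = Submodule.span F (Set.range y)) :
    ∃ g : GL ι F, ∀ i', y i' = ∑ i, g.1 i i' • x i := by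
  obtain ⟨e, he⟩ := exists_equiv_of_range_eq (Fintype.linearCombination F x)
    (Fintype.linearCombination F y) (by rw [Fintype.range_linearCombination, h,
      Fintype.range_linearCombination])
  refine ⟨⟨LinearMap.toMatrix' e.toLinearMap, LinearMap.toMatrix' e.symm.toLinearMap, ?_, ?_⟩,
    fun i' => ?_⟩
  · rw [← LinearMap.toMatrix'_comp]; simp
  · rw [← LinearMap.toMatrix'_comp]; simp
  · have := he (Pi.single i' 1)
    rw [Fintype.linearCombination_apply_single, one_smul] at this
    rw [← this, Fintype.linearCombination_apply]
    simp [LinearMap.toMatrix'_apply]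

section
variable {I J K : Type*} [Fintype I] [Fintype J] [Fintype K] [DecidableEq I]

/-- If two arrays arise from each other by possibly singular substitutions, then the first of the
matrices carrying one to the other can be chosen invertible. -/
theorem exists_gl_trans_eq {A B : I → J → K → F} {P P' : Matrix I I F} {Q Q' : Matrix J J F}
    {R R' : Matrix K K F} (h : trans A P Q R = B) (h' : trans B P' Q' R' = A) :
    ∃ g : GL I F, trans A g.1 Q R = B := by
  -- `f Q R` applies substitutions to a matrix
  let f : Matrix J J F → Matrix K K F → (J → K → F) →ₗ[F] (J → K → F) := fun Q R =>
    { toFun := fun M j' k' => ∑ j, ∑ k, M j k * Q j j' * R k k'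
      map_add' := fun M N => by
        funext j' k'
        simp only [Pi.add_apply, add_mul, Finset.sum_add_distrib]
      map_smul' := fun c M => by
        funext j' k'
        simp only [Pi.smul_apply, smul_eq_mul, Finset.mul_sum, mul_assoc, RingHom.id_apply] }
  have hf : ∀ (A : I → J → K → F) (P : Matrix I I F) (Q : Matrix J J F) (R : Matrix K K F) (i' : I),
      trans A P Q R i' = ∑ i, P i i' • f Q R (A i) := by
    intro A P Q R i'
    funext j' k'
    simp only [trans, Finset.sum_apply, Pi.smul_apply, smul_eq_mul, f, LinearMap.coe_mk,
      AddHom.coe_mk, Finset.mul_sum]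
    congr! 3
    ring
  have hle : ∀ {A B : I → J → K → F} {P : Matrix I I F} {Q : Matrix J J F} {R : Matrix K K F},
      trans A P Q R = B → Submodule.span F (Set.range B) ≤
        Submodule.span F (Set.range fun i => f Q R (A i)) := by
    rintro A B P Q R rfl
    rw [Submodule.span_le]
    rintro _ ⟨i', rfl⟩
    rw [hf]
    exact Submodule.sum_mem _ fun i _ => Submodule.smul_mem _ _ (Submodule.subset_span ⟨i, rfl⟩)
  have hfin : ∀ (A : I → J → K → F) (Q : Matrix J J F) (R : Matrix K K F),
      Module.finrank F (Submodule.span F (Set.range fun i => f Q R (A i))) ≤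
        Module.finrank F (Submodule.span F (Set.range A)) := by
    intro A Q R
    have : Submodule.span F (Set.range fun i => f Q R (A i)) =
        (Submodule.span F (Set.range A)).map (f Q R) := by
      rw [Submodule.map_span, ← Set.range_comp]; rfl
    rw [this]
    exact Submodule.finrank_map_le _ _
  -- the dimensions of the four spans bound each other in a circle, so the inclusion is an equality
  have heq := Submodule.eq_of_le_of_finrank_le (hle h) ((hfin A Q R).trans
    ((Submodule.finrank_mono (hle h')).trans (hfin B Q' R')))
  obtain ⟨g, hg⟩ := exists_gl_of_span_eq (fun i => f Q R (A i)) B heq.symm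
  exact ⟨g, funext fun i' => by rw [hf, hg]⟩

/-- Two arrays that arise from each other by possibly singular substitutions are isomorphic. -/
theorem exists_gl_trans_eq_of_mutual [DecidableEq J] [DecidableEq K] {A B : I → J → K → F}
    (h : ∃ P Q R, trans A P Q R = B) (h' : ∃ P Q R, trans B P Q R = A) :
    ∃ (P : GL I F) (Q : GL J F) (R : GL K F), trans A P.1 Q.1 R.1 = B := by
  obtain ⟨P, Q, R, h⟩ := h
  obtain ⟨P', Q', R', h'⟩ := h'
  obtain ⟨P₁, h₁⟩ := exists_gl_trans_eq h h'
  have h₁' : trans (fun j i k => A i j k) Q P₁.1 R = fun j i k => B i j k := by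
    rw [trans_swap₁₂, h₁]
  obtain ⟨Q₁, h₂⟩ := exists_gl_trans_eq (P' := Q') (Q' := P') (R' := R') h₁'
    (by rw [trans_swap₁₂, h'])
  have h₂' : trans A P₁.1 Q₁.1 R = B := by
    rw [trans_swap₁₂] at h₂
    exact funext₃ fun i j k => congrFun₃ h₂ j i k
  obtain ⟨R₁, h₃⟩ := exists_gl_trans_eq (A := fun k j i => A i j k) (B := fun k j i => B i j k)
    (P := R) (Q := Q₁.1) (R := P₁.1) (P' := R') (Q' := Q') (R' := P')
    (by rw [trans_swap₁₃, h₂']) (by rw [trans_swap₁₃, h'])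
  refine ⟨P₁, Q₁, R₁, ?_⟩
  rw [trans_swap₁₃] at h₃
  exact funext₃ fun i j k => congrFun₃ h₃ k j i
end

end Span

/-! ### The core array -/

section Matrices
variable {F : Type u} [Field F] {I J : Type*} [Fintype I] [Fintype J] [DecidableEq I]
  [DecidableEq J]

open Matrix in
/-- Block diagonal matrices. -/
def glBlock (P : GL I F) (Q : GL J F) : GL (I ⊕ J) F where
  val := fromBlocks P.1 0 0 Q.1
  inv := fromBlocks P⁻¹.1 0 0 Q⁻¹.1
  val_inv := by simp [fromBlocks_multiply]
  inv_val := by simp [fromBlocks_multiply]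

open Matrix in
/-- The contragredient matrix. -/
def glDual (P : GL I F) : GL I F where
  val := P⁻¹.1ᵀ
  inv := P.1ᵀ
  val_inv := by rw [← transpose_mul, ← Units.val_mul]; simp
  inv_val := by rw [← transpose_mul, ← Units.val_mul]; simp

open Matrix Kronecker in
/-- Kronecker products. -/
def glKron (P : GL I F) (Q : GL J F) : GL (I × J) F where
  val := P.1 ⊗ₖ Q.1
  inv := P⁻¹.1 ⊗ₖ Q⁻¹.1
  val_inv := by rw [← mul_kronecker_mul, ← Units.val_mul, ← Units.val_mul]; simp
  inv_val := by rw [← mul_kronecker_mul, ← Units.val_mul, ← Units.val_mul]; simp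

end Matrices

section Bil
variable {F : Type u} [Field F] {ι κ ζ ι' κ' ζ' : Type*} [Fintype ι] [Fintype κ] [Fintype ζ]
  [Fintype ι'] [Fintype κ'] [Fintype ζ']

/-- The bilinear map with coefficients `T`. -/
def bil (T : ι → κ → ζ → F) (x : ι → F) (y : κ → F) : ζ → F :=
  fun k => ∑ i, ∑ j, x i * y j * T i j k

omit [Fintype ζ] in
theorem bil_add_left (T : ι → κ → ζ → F) (x x' : ι → F) (y : κ → F) :
    bil T (x + x') y = bil T x y + bil T x' y := by
  funext k; simp [bil, add_mul, Finset.sum_add_distrib]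

omit [Fintype ζ] in
theorem bil_add_right (T : ι → κ → ζ → F) (x : ι → F) (y y' : κ → F) :
    bil T x (y + y') = bil T x y + bil T x y' := by
  funext k; simp [bil, mul_add, add_mul, Finset.sum_add_distrib]

omit [Fintype ζ] in
theorem bil_smul_left (T : ι → κ → ζ → F) (c : F) (x : ι → F) (y : κ → F) :
    bil T (c • x) y = c • bil T x y := by
  funext k; simp [bil, Finset.mul_sum, mul_assoc]

omit [Fintype ζ] in
theorem bil_smul_right (T : ι → κ → ζ → F) (c : F) (x : ι → F) (y : κ → F) :
    bil T x (c • y) = c • bil T x y := by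
  funext k; simp [bil, Finset.mul_sum, mul_assoc, mul_left_comm]

omit [Fintype ζ] in
@[simp] theorem bil_zero_left (T : ι → κ → ζ → F) (y : κ → F) : bil T 0 y = 0 := by
  funext k; simp [bil]

omit [Fintype ζ] in
@[simp] theorem bil_zero_right (T : ι → κ → ζ → F) (x : ι → F) : bil T x 0 = 0 := by
  funext k; simp [bil]

omit [Fintype ζ] in
theorem bil_single [DecidableEq ι] [DecidableEq κ] (T : ι → κ → ζ → F) (i : ι) (j : κ) :
    bil T (Pi.single i 1) (Pi.single j 1) = T i j := by
  funext k; simp [bil, Pi.single_apply]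

theorem bil_dotProduct (T : ι → κ → ζ → F) (x : ι → F) (y : κ → F) (z : ζ → F) :
    bil T x y ⬝ᵥ z = tri T x y z := by
  simp only [dotProduct, bil, tri, Finset.sum_mul]
  rw [Finset.sum_comm]
  refine Finset.sum_congr rfl fun i _ => ?_
  rw [Finset.sum_comm]
  congr! 2
  ring

open Matrix in
theorem bil_trans [DecidableEq ζ'] (T : ι → κ → ζ → F) (P : Matrix ι ι' F) (Q : Matrix κ κ' F)
    (R : Matrix ζ ζ' F) (x : ι' → F) (y : κ' → F) :
    bil (trans T P Q R) x y = Rᵀ *ᵥ bil T (P *ᵥ x) (Q *ᵥ y) := by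
  apply dotProduct_eq
  intro z
  rw [bil_dotProduct, tri_trans, ← bil_dotProduct, dotProduct_mulVec, ← mulVec_transpose]

/-- The two off-diagonal blocks `T` and `ε * Tᵗ`. -/
def sym (ε : F) (T : ι → κ → ζ → F) : ι ⊕ κ → ι ⊕ κ → ζ → F
  | .inl i, .inr j, k => T i j k
  | .inr j, .inl i, k => ε * T i j k
  | .inl _, .inl _, _ => 0
  | .inr _, .inr _, _ => 0

omit [Fintype ζ] in
theorem bil_sym (ε : F) (T : ι → κ → ζ → F) (x y : ι ⊕ κ → F) :
    bil (sym ε T) x y = bil T (x ∘ Sum.inl) (y ∘ Sum.inr) +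
      ε • bil T (y ∘ Sum.inl) (x ∘ Sum.inr) := by
  funext k
  simp only [bil, sym, Fintype.sum_sum_type, mul_zero, Finset.sum_const_zero, zero_add, add_zero,
    Pi.add_apply, Function.comp_apply, Pi.smul_apply, smul_eq_mul, Finset.mul_sum]
  congr 1
  rw [Finset.sum_comm]
  congr! 2
  ring

theorem trans_sym [DecidableEq ι] [DecidableEq κ] [DecidableEq ζ] (ε : F) {T T' : ι → κ → ζ → F}
    {P : GL ι F} {Q : GL κ F} {R : GL ζ F} (h : trans T P.1 Q.1 R.1 = T') :
    trans (sym ε T) (glBlock P Q).1 (glBlock P Q).1 R.1 = sym ε T' := by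
  subst h
  funext x y k
  rcases x with i | i <;> rcases y with j | j
  · simp [trans, sym, glBlock]
  · simp [trans, sym, glBlock]
  · simp only [trans, sym, glBlock, Fintype.sum_sum_type, Matrix.fromBlocks_apply₁₁,
      Matrix.fromBlocks_apply₁₂, Matrix.fromBlocks_apply₂₁, Matrix.fromBlocks_apply₂₂,
      Matrix.zero_apply, mul_zero, zero_mul, Finset.sum_const_zero, zero_add, add_zero,
      Finset.mul_sum]
    rw [Finset.sum_comm]
    congr! 3
    ring
  · simp [trans, sym, glBlock]

end Bil

section Core
variable {F : Type u} [Field F] {I J K X : Type*} [Fintype I] [Fintype J] [Fintype K] [Fintype X]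
  [DecidableEq I] [DecidableEq J] [DecidableEq K] [DecidableEq X]

/-- The core array of `A`.  With `U = F ^ I`, `V = F ^ J` and `W = F ^ K ⊆ S = F ^ (K ⊕ X)`, it is
the bilinear map `(F ⊕ U) × (V ⊕ S) → (F ⊕ U) ⊗ S` that sends `(t + u, v + s)` to
`1 ⊗ A (u, v) + (t + u) ⊗ s`. -/
def core (A : I → J → K → F) : Unit ⊕ I → J ⊕ (K ⊕ X) → (Unit ⊕ I) × (K ⊕ X) → F
  | .inr i, .inl j, (.inl _, .inl k) => A i j k
  | .inr _, .inl _, (.inl _, .inr _) => 0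
  | .inr _, .inl _, (.inr _, _) => 0
  | .inl _, .inl _, _ => 0
  | a, .inr s, z => if z = (a, s) then 1 else 0

theorem bil_core_inr (A : I → J → K → F) (u : Unit ⊕ I → F) (y : J ⊕ (K ⊕ X) → F) (i : I)
    (c : K ⊕ X) : bil (core A) u y (.inr i, c) = u (.inr i) * y (.inr c) := by
  simp only [bil, Fintype.sum_sum_type (α₁ := J), Finset.sum_add_distrib]
  simp only [Fintype.sum_sum_type (α₁ := Unit), core, mul_zero, Finset.sum_const_zero, zero_add]
  rcases c with c | c <;>
    simp [Prod.ext_iff, ite_and]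

theorem bil_core_inl_inr (A : I → J → K → F) (u : Unit ⊕ I → F) (y : J ⊕ (K ⊕ X) → F) (c : X) :
    bil (core A) u y (.inl (), .inr c) = u (.inl ()) * y (.inr (.inr c)) := by
  simp only [bil, Fintype.sum_sum_type (α₁ := J), Finset.sum_add_distrib]
  simp only [Fintype.sum_sum_type (α₁ := Unit), core, mul_zero, Finset.sum_const_zero, zero_add]
  simp [Prod.ext_iff]

theorem bil_core_inl_inl (A : I → J → K → F) (u : Unit ⊕ I → F) (y : J ⊕ (K ⊕ X) → F) (k : K) :
    bil (core A) u y (.inl (), .inl k) =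
      u (.inl ()) * y (.inr (.inl k)) + bil A (u ∘ Sum.inr) (y ∘ Sum.inl) k := by
  simp only [bil, Fintype.sum_sum_type (α₁ := J), Finset.sum_add_distrib]
  simp only [Fintype.sum_sum_type (α₁ := Unit), core, mul_zero, Finset.sum_const_zero, zero_add]
  simp [Prod.ext_iff, add_comm]

/-- The core construction respects isomorphism. -/
theorem exists_trans_core {A B : I → J → K → F}
    (h : ∃ (P : GL I F) (Q : GL J F) (R : GL K F), trans A P.1 Q.1 R.1 = B) :
    ∃ (P : GL (Unit ⊕ I) F) (Q : GL (J ⊕ (K ⊕ X)) F) (R : GL ((Unit ⊕ I) × (K ⊕ X)) F),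
      trans (core A) P.1 Q.1 R.1 = core B := by
  obtain ⟨P, Q, R, rfl⟩ := h
  let P' : GL (Unit ⊕ I) F := glBlock 1 P
  let R' : GL (K ⊕ X) F := glBlock R 1
  refine ⟨P', glBlock Q (glDual R'), glKron (glDual P') R', ?_⟩
  have hP : ∀ a b, ∑ i, P'.1 i b * P'⁻¹.1 a i = if a = b then 1 else 0 := by
    intro a b
    have : (P'⁻¹.1 * P'.1) a b = (1 : Matrix _ _ F) a b := by
      rw [← Units.val_mul, inv_mul_cancel]; rfl
    rw [Matrix.mul_apply, Matrix.one_apply] at this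
    rw [← this]
    exact Finset.sum_congr rfl fun _ _ => mul_comm _ _
  have hR : ∀ a b, ∑ i, R'⁻¹.1 a i * R'.1 i b = if a = b then 1 else 0 := by
    intro a b
    have : (R'⁻¹.1 * R'.1) a b = (1 : Matrix _ _ F) a b := by
      rw [← Units.val_mul, inv_mul_cancel]; rfl
    rwa [Matrix.mul_apply, Matrix.one_apply] at this
  funext i' j' ⟨a', c'⟩
  rcases j' with j' | s
  · have e : trans (core A) P'.1 (glBlock Q (glDual R')).1 (glKron (glDual P') R').1 i' (.inl j')
        (a', c') = ∑ i, ∑ j, ∑ k, A i j k * P'.1 (.inr i) i' * Q.1 j j' *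
          (P'⁻¹.1 a' (.inl ()) * R'.1 (.inl k) c') := by
      simp [trans, Fintype.sum_sum_type, Fintype.sum_prod_type, core, glBlock, glKron, glDual]
    have hinv : P'⁻¹.1 = Matrix.fromBlocks 1 0 0 P⁻¹.1 := rfl
    rw [e, hinv]
    rcases i' with i' | i' <;> rcases a' with a' | a' <;> rcases c' with c' | c' <;>
      simp [core, P', R', glBlock, trans]
  · have e : trans (core A) P'.1 (glBlock Q (glDual R')).1 (glKron (glDual P') R').1 i' (.inr s)
        (a', c') = ∑ i, ∑ j, P'.1 i i' * R'⁻¹.1 s j * (P'⁻¹.1 a' i * R'.1 j c') := by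
      have h1 : ∀ j, (glBlock Q (glDual R')).1 (.inl j) (.inr s) = 0 := fun j => rfl
      have h2 : ∀ j, (glBlock Q (glDual R')).1 (.inr j) (.inr s) = R'⁻¹.1 s j := fun j => rfl
      have h3 : ∀ i j, (glKron (glDual P') R').1 (i, j) (a', c') = P'⁻¹.1 a' i * R'.1 j c' :=
        fun i j => rfl
      have h4 : ∀ i j z, core A i (.inr j : J ⊕ (K ⊕ X)) z = if z = (i, j) then 1 else 0 := by
        rintro (i | i) j z <;> rfl
      simp only [trans, Fintype.sum_sum_type (α₁ := J), h1, h2, h4, mul_zero, zero_mul,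
        Finset.sum_const_zero, zero_add, ite_mul, one_mul, Finset.sum_ite_eq', Finset.mem_univ,
        if_true, h3]
    have e2 : ∑ i, ∑ j, P'.1 i i' * R'⁻¹.1 s j * (P'⁻¹.1 a' i * R'.1 j c') =
        (∑ i, P'.1 i i' * P'⁻¹.1 a' i) * ∑ j, R'⁻¹.1 s j * R'.1 j c' := by
      rw [Finset.sum_mul_sum]
      congr! 2
      ring
    rw [e, e2, hP, hR]
    have h4 : core (trans A P.1 Q.1 R.1) i' (.inr s : J ⊕ (K ⊕ X)) (a', c') =
        if (a', c') = (i', s) then 1 else 0 := by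
      rcases i' with i | i <;> rfl
    rw [h4]
    simp only [Prod.mk.injEq, ite_and, eq_comm (a := s)]
    split_ifs <;> simp

/-- The subspace `V` of `V ⊕ S` consists of the elements annihilated by some nonzero element of
`F ⊕ U`. -/
theorem core_singular_iff (A : I → J → K → F) (y : J ⊕ (K ⊕ X) → F) :
    (∀ c, y (.inr c) = 0) ↔ ∃ u ≠ 0, bil (core A) u y = 0 := by
  constructor
  · intro h
    refine ⟨Pi.single (.inl ()) 1, by simp, ?_⟩
    funext ⟨a, c⟩
    rcases a with a | a
    · rcases c with c | c
      · rw [bil_core_inl_inl, h]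
        have : (Pi.single (.inl ()) 1 : Unit ⊕ I → F) ∘ Sum.inr = 0 := by funext i; simp
        simp [this]
      · rw [bil_core_inl_inr, h]; simp
    · rw [bil_core_inr, h]; simp
  · rintro ⟨u, hu, h⟩ c
    by_cases hu' : u ∘ Sum.inr = 0
    · have h0 : u (.inl ()) ≠ 0 := by
        intro h0
        apply hu
        funext a
        rcases a with a | a
        · exact h0
        · exact congrFun hu' a
      have : u (.inl ()) * y (.inr c) = 0 := by
        rcases c with c | c
        · have := congrFun h (.inl (), .inl c)
          rw [bil_core_inl_inl, hu'] at this
          simpa using this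
        · have := congrFun h (.inl (), .inr c)
          rwa [bil_core_inl_inr] at this
      exact (mul_eq_zero.1 this).resolve_left h0
    · obtain ⟨i, hi⟩ := Function.ne_iff.1 hu'
      have := congrFun h (.inr i, c)
      rw [bil_core_inr] at this
      exact (mul_eq_zero.1 this).resolve_left hi

section Recover
variable {A B : I → J → K → F} {p : (Unit ⊕ I → F) ≃+ (Unit ⊕ I → F)}
  {q : (J ⊕ (K ⊕ X) → F) ≃+ (J ⊕ (K ⊕ X) → F)}
  {r : ((Unit ⊕ I) × (K ⊕ X) → F) ≃+ ((Unit ⊕ I) × (K ⊕ X) → F)}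

theorem core_equiv_symm (h : ∀ u y, r (bil (core A) u y) = bil (core B) (p u) (q y)) (u y) :
    r.symm (bil (core B) u y) = bil (core A) (p.symm u) (q.symm y) := by
  rw [AddEquiv.symm_apply_eq, h, AddEquiv.apply_symm_apply, AddEquiv.apply_symm_apply]

theorem core_preserves (h : ∀ u y, r (bil (core A) u y) = bil (core B) (p u) (q y))
    {y : J ⊕ (K ⊕ X) → F} (hy : ∀ c, y (.inr c) = 0) : ∀ c, q y (.inr c) = 0 := by
  obtain ⟨u, hu, h0⟩ := (core_singular_iff A y).1 hy
  exact (core_singular_iff B _).2 ⟨p u, by simpa using hu, by rw [← h, h0, map_zero]⟩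

/-- An additive equivalence between core arrays that is linear on the target recovers the array. -/
theorem exists_trans_of_core (h : ∀ u y, r (bil (core A) u y) = bil (core B) (p u) (q y))
    (hr : ∀ (c : F) z, r (c • z) = c • r z) :
    ∃ P R, trans A P (fun j j' => q.symm (Pi.single (.inl j') 1) (.inl j)) R = B := by
  refine ⟨fun i i' => p.symm (Pi.single (.inr i') 1) (.inr i),
    fun k k' => r (Pi.single (.inl (), .inl k) 1) (.inl (), .inl k'), ?_⟩
  funext i' j' k'
  set u := p.symm (Pi.single (.inr i') 1)
  set y := q.symm (Pi.single (.inl j') 1) with hy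
  have hy0 : ∀ c, y (.inr c) = 0 := core_preserves (core_equiv_symm h) (by simp)
  have e1 : bil (core A) u y = ∑ k, bil A (u ∘ Sum.inr) (y ∘ Sum.inl) k •
      Pi.single (.inl (), .inl k) (1 : F) := by
    funext ⟨a, c⟩
    rw [Finset.sum_apply]
    rcases a with a | a
    · rcases c with c | c
      · rw [bil_core_inl_inl, hy0]; simp [Pi.single_apply]
      · rw [bil_core_inl_inr, hy0]; simp
    · rw [bil_core_inr, hy0]; simp
  have e2 := congrFun (h u y) (.inl (), .inl k')
  have e3 : bil (core B) (p u) (q y) (.inl (), .inl k') = B i' j' k' := by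
    simp only [u, y, AddEquiv.apply_symm_apply, bil_single]
    rfl
  rw [e3, e1, map_sum, Finset.sum_apply] at e2
  rw [← e2]
  simp only [hr, Pi.smul_apply, smul_eq_mul, bil, Finset.sum_mul, trans, Function.comp_apply]
  symm
  rw [Finset.sum_comm]
  refine Finset.sum_congr rfl fun i _ => ?_
  rw [Finset.sum_comm]
  congr! 2
  ring
end Recover

/-- An additive equivalence between core arrays, linear on the target, proves the arrays
isomorphic. -/
theorem exists_gl_of_core {A B : I → J → K → F} {p : (Unit ⊕ I → F) ≃+ (Unit ⊕ I → F)}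
    {q : (J ⊕ (K ⊕ X) → F) ≃+ (J ⊕ (K ⊕ X) → F)}
    {r : ((Unit ⊕ I) × (K ⊕ X) → F) ≃+ ((Unit ⊕ I) × (K ⊕ X) → F)}
    (h : ∀ u y, r (bil (core A) u y) = bil (core B) (p u) (q y))
    (hr : ∀ (c : F) z, r (c • z) = c • r z) :
    ∃ (P : GL I F) (Q : GL J F) (R : GL K F), trans A P.1 Q.1 R.1 = B := by
  obtain ⟨P, R, h1⟩ := exists_trans_of_core h hr
  obtain ⟨P', R', h2⟩ := exists_trans_of_core (core_equiv_symm h) fun c z => by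
    rw [AddEquiv.symm_apply_eq, hr, AddEquiv.apply_symm_apply]
  exact exists_gl_trans_eq_of_mutual ⟨P, _, R, h1⟩ ⟨P', _, R', h2⟩

end Core

/-! ### Symmetric and alternating bilinear maps -/

section SymCore
variable {F : Type u} [Field F] {I J K X : Type*} [Fintype I] [Fintype J] [Fintype K] [Fintype X]
  [DecidableEq I] [DecidableEq J] [DecidableEq K] [DecidableEq X]

/-- The inclusion of the second summand. -/
def extendRight (k F ι κ : Type*) [Field k] [Field F] [Algebra k F] :
    (κ → F) →ₗ[k] (ι ⊕ κ → F) where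
  toFun y := Sum.elim 0 y
  map_add' y y' := by funext i; rcases i with i | i <;> simp
  map_smul' c y := by funext i; rcases i with i | i <;> simp

/-- An automorphism that preserves the second summand, together with its inverse, is block
triangular. -/
theorem exists_block {k ι κ : Type*} [Field k] [Algebra k F] (φ : (ι ⊕ κ → F) ≃ₗ[k] (ι ⊕ κ → F))
    (h : ∀ y, φ (Sum.elim 0 y) ∘ Sum.inl = 0) (h' : ∀ y, φ.symm (Sum.elim 0 y) ∘ Sum.inl = 0) :
    ∃ (p : (ι → F) ≃ₗ[k] (ι → F)) (q : (κ → F) ≃ₗ[k] (κ → F)),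
      (∀ x, φ x ∘ Sum.inl = p (x ∘ Sum.inl)) ∧
        ∀ y, φ (Sum.elim 0 y) = Sum.elim (0 : ι → F) (q y) := by
  have hq : ∀ φ : (ι ⊕ κ → F) ≃ₗ[k] (ι ⊕ κ → F), (∀ y, φ (Sum.elim 0 y) ∘ Sum.inl = 0) →
      ∀ y, φ (Sum.elim 0 y) = Sum.elim (0 : ι → F) (φ (Sum.elim 0 y) ∘ Sum.inr) := by
    intro φ h y
    funext i
    rcases i with i | i
    · exact congrFun (h y) i
    · rfl
  have hp : ∀ φ : (ι ⊕ κ → F) ≃ₗ[k] (ι ⊕ κ → F), (∀ y, φ (Sum.elim 0 y) ∘ Sum.inl = 0) →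
      ∀ x, φ x ∘ Sum.inl = φ (Sum.elim (x ∘ Sum.inl) 0) ∘ Sum.inl := by
    intro φ h x
    have e : x = Sum.elim (x ∘ Sum.inl) 0 + Sum.elim (0 : ι → F) (x ∘ Sum.inr) := by
      funext i; rcases i with i | i <;> simp
    have h1 := h (x ∘ Sum.inr)
    conv_lhs => rw [e, map_add]
    funext i
    have := congrFun h1 i
    simp only [Function.comp_apply, Pi.zero_apply] at this
    simp [this]
  refine ⟨{ toFun := fun u => φ (Sum.elim u 0) ∘ Sum.inl
            invFun := fun u => φ.symm (Sum.elim u 0) ∘ Sum.inl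
            left_inv := fun u => by beta_reduce; rw [← hp φ.symm h']; simp
            right_inv := fun u => by beta_reduce; rw [← hp φ h]; simp
            map_add' := fun u u' => ?_
            map_smul' := fun c u => ?_ },
    { toFun := fun y => φ (Sum.elim 0 y) ∘ Sum.inr
      invFun := fun y => φ.symm (Sum.elim 0 y) ∘ Sum.inr
      left_inv := fun y => by beta_reduce; rw [← hq φ h]; simp
      right_inv := fun y => by beta_reduce; rw [← hq φ.symm h']; simp
      map_add' := fun u u' => ?_
      map_smul' := fun c u => ?_ }, fun x => hp φ h x, hq φ h⟩
  · have e : (Sum.elim (u + u') 0 : ι ⊕ κ → F) = Sum.elim u 0 + Sum.elim u' 0 := by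
      funext i; rcases i with i | i <;> simp
    rw [e, map_add]; rfl
  · have e : (Sum.elim (c • u) 0 : ι ⊕ κ → F) = c • Sum.elim u 0 := by
      funext i; rcases i with i | i <;> simp
    rw [e, map_smul]; rfl
  · have e : (Sum.elim 0 (u + u') : ι ⊕ κ → F) =
        Sum.elim (0 : ι → F) u + Sum.elim (0 : ι → F) u' := by
      funext i; rcases i with i | i <;> simp
    rw [e, map_add]; rfl
  · have e : (Sum.elim 0 (c • u) : ι ⊕ κ → F) = c • Sum.elim (0 : ι → F) u := by
      funext i; rcases i with i | i <;> simp
    rw [e, map_smul]; rfl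

variable (k : Type*) [Field k] [Algebra k F] [FiniteDimensional k F]

/-- The subspace `V ⊕ S` is invariant: it is totally isotropic, and `S` is too large to allow
another totally isotropic subspace of this dimension. -/
theorem sym_core_isotropic {ε : F} (hX : Fintype.card I + 1 < Fintype.card X)
    {A B : I → J → K → F}
    (φ : ((Unit ⊕ I) ⊕ (J ⊕ (K ⊕ X)) → F) ≃ₗ[k] ((Unit ⊕ I) ⊕ (J ⊕ (K ⊕ X)) → F))
    (ψ : ((Unit ⊕ I) × (K ⊕ X) → F) ≃+ ((Unit ⊕ I) × (K ⊕ X) → F))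
    (h : ∀ x y, ψ (bil (sym ε (core A)) x y) = bil (sym ε (core B)) (φ x) (φ y))
    (y : J ⊕ (K ⊕ X) → F) : φ (Sum.elim 0 y) ∘ Sum.inl = 0 := by
  by_contra hy
  let g : (J ⊕ (K ⊕ X) → F) →ₗ[k] (Unit ⊕ I → F) :=
    LinearMap.funLeft k F Sum.inl ∘ₗ φ.toLinearMap ∘ₗ extendRight k F _ _
  let g' : (J ⊕ (K ⊕ X) → F) →ₗ[k] (J → F) :=
    LinearMap.funLeft k F (Sum.inr ∘ Sum.inl) ∘ₗ φ.toLinearMap ∘ₗ extendRight k F _ _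
  -- elements of the kernel of `g` are orthogonal to an element outside of `V ⊕ S`
  have key : ∀ z, g z = 0 → ∀ c, φ (Sum.elim 0 z) (.inr (.inr c)) = 0 := by
    intro z hz
    refine (core_singular_iff B (φ (Sum.elim 0 z) ∘ Sum.inr)).2
      ⟨φ (Sum.elim 0 y) ∘ Sum.inl, hy, ?_⟩
    have h1 := h (Sum.elim 0 y) (Sum.elim 0 z)
    have hz' : φ (Sum.elim 0 z) ∘ Sum.inl = 0 := hz
    rw [bil_sym, bil_sym, hz'] at h1
    simpa using h1.symm
  -- hence the kernel of `g` embeds into `V`, while its codimension is at most that of `V ⊕ S`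
  have hinj : LinearMap.ker (g'.domRestrict (LinearMap.ker g)) = ⊥ := by
    rw [LinearMap.ker_eq_bot']
    rintro ⟨z, hz⟩ h0
    have hz' : φ (Sum.elim 0 z) = 0 := by
      funext i
      rcases i with i | j | c
      · exact congrFun (LinearMap.mem_ker.1 hz) i
      · exact congrFun h0 j
      · exact key z hz c
    have h1 : (Sum.elim 0 z : (Unit ⊕ I) ⊕ (J ⊕ (K ⊕ X)) → F) = 0 := by simpa using hz'
    ext i
    exact congrFun h1 (.inr i)
  have hk := LinearMap.finrank_le_finrank_of_injective (LinearMap.ker_eq_bot.1 hinj)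
  have hr := Submodule.finrank_le (LinearMap.range g)
  have hg := g.finrank_range_add_finrank_ker
  have hpos : 0 < Module.finrank k F := Module.finrank_pos
  have h1 : Module.finrank k (J → F) = Fintype.card J * Module.finrank k F := by
    rw [Module.finrank_pi_fintype]; simp
  have h2 : Module.finrank k (Unit ⊕ I → F) = (1 + Fintype.card I) * Module.finrank k F := by
    rw [Module.finrank_pi_fintype]; simp
  have h3 : Module.finrank k (J ⊕ (K ⊕ X) → F) =
      (Fintype.card J + (Fintype.card K + Fintype.card X)) * Module.finrank k F := by
    rw [Module.finrank_pi_fintype]; simp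
  rw [h1] at hk
  rw [h2] at hr
  rw [h3] at hg
  have h4 : (Fintype.card J + (Fintype.card K + Fintype.card X)) * Module.finrank k F ≤
      ((1 + Fintype.card I) + Fintype.card J) * Module.finrank k F := by
    rw [← hg, add_mul]
    exact add_le_add hr hk
  have h5 := Nat.le_of_mul_le_mul_right h4 hpos
  omega

theorem symm_bil_eq {ι ζ : Type*} [Fintype ι] {S T : ι → ι → ζ → F} {φ : (ι → F) ≃ (ι → F)}
    {ψ : (ζ → F) ≃ (ζ → F)} (h : ∀ x y, ψ (bil S x y) = bil T (φ x) (φ y)) (x y) :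
    ψ.symm (bil T x y) = bil S (φ.symm x) (φ.symm y) := by
  rw [Equiv.symm_apply_eq, h, Equiv.apply_symm_apply, Equiv.apply_symm_apply]

/-- An isomorphism of the symmetrized core arrays induces one of the core arrays. -/
theorem core_equiv_of_sym {ε : F} (hX : Fintype.card I + 1 < Fintype.card X)
    {A B : I → J → K → F}
    (φ : ((Unit ⊕ I) ⊕ (J ⊕ (K ⊕ X)) → F) ≃ₗ[k] ((Unit ⊕ I) ⊕ (J ⊕ (K ⊕ X)) → F))
    (ψ : ((Unit ⊕ I) × (K ⊕ X) → F) ≃+ ((Unit ⊕ I) × (K ⊕ X) → F))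
    (h : ∀ x y, ψ (bil (sym ε (core A)) x y) = bil (sym ε (core B)) (φ x) (φ y)) :
    ∃ (p : (Unit ⊕ I → F) ≃+ (Unit ⊕ I → F)) (q : (J ⊕ (K ⊕ X) → F) ≃+ (J ⊕ (K ⊕ X) → F)),
      ∀ u y, ψ (bil (core A) u y) = bil (core B) (p u) (q y) := by
  have h' : ∀ x y, ψ.symm (bil (sym ε (core B)) x y) =
      bil (sym ε (core A)) (φ.symm x) (φ.symm y) :=
    symm_bil_eq (φ := φ.toEquiv) (ψ := ψ.toEquiv) h
  have hN := sym_core_isotropic k hX φ ψ h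
  have hN' := sym_core_isotropic k hX φ.symm ψ.symm h'
  obtain ⟨p, q, hp, hq⟩ := exists_block φ hN hN'
  refine ⟨p.toAddEquiv, q.toAddEquiv, fun u y => ?_⟩
  have h1 := h (Sum.elim u 0) (Sum.elim 0 y)
  rw [bil_sym, bil_sym, hN, hp, hq] at h1
  simpa using h1

end SymCore

/-! ### Isometry of tuples of matrices -/

section Isometry
variable {F : Type u} [Field F] {I J K X : Type*} [Fintype I] [Fintype J] [Fintype K] [Fintype X]
  [DecidableEq I] [DecidableEq J] [DecidableEq K] [DecidableEq X]

theorem gl_mulVec_inv {ι : Type*} [Fintype ι] [DecidableEq ι] (P : GL ι F) (x : ι → F) :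
    P.1.mulVec (P⁻¹.1.mulVec x) = x := by
  rw [Matrix.mulVec_mulVec, ← Units.val_mul, mul_inv_cancel]
  exact Matrix.one_mulVec x

theorem gl_inv_mulVec {ι : Type*} [Fintype ι] [DecidableEq ι] (P : GL ι F) (x : ι → F) :
    P⁻¹.1.mulVec (P.1.mulVec x) = x := by
  rw [Matrix.mulVec_mulVec, ← Units.val_mul, inv_mul_cancel]
  exact Matrix.one_mulVec x

/-- Multiplication by an invertible matrix. -/
def glMulVec {ι : Type*} [Fintype ι] [DecidableEq ι] (P : GL ι F) : (ι → F) ≃ₗ[F] (ι → F) :=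
  { P.1.mulVecLin with
    invFun := P⁻¹.1.mulVec
    left_inv := gl_inv_mulVec P
    right_inv := gl_mulVec_inv P }

/-- Isomorphism of bilinear maps. -/
def BilIso {ι ζ : Type*} [Fintype ι] (S T : ι → ι → ζ → F) : Prop :=
  ∃ (φ : (ι → F) ≃ₗ[F] (ι → F)) (ψ : (ζ → F) ≃ₗ[F] (ζ → F)),
    ∀ x y, ψ (bil S x y) = bil T (φ x) (φ y)

theorem bilIso_of_trans {ι ζ : Type*} [Fintype ι] [Fintype ζ] [DecidableEq ι] [DecidableEq ζ]
    {S T : ι → ι → ζ → F} (h : ∃ (P : GL ι F) (R : GL ζ F), trans S P.1 P.1 R.1 = T) :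
    BilIso S T := by
  obtain ⟨P, R, h⟩ := h
  refine ⟨glMulVec P⁻¹, (glMulVec (glDual R)).symm, fun x y => ?_⟩
  rw [LinearEquiv.symm_apply_eq, ← trans_symm h, bil_trans]
  rfl

theorem exists_gl_of_bilIso {ε : F} (hX : Fintype.card I + 1 < Fintype.card X)
    {A B : I → J → K → F} (h : BilIso (sym ε (core (X := X) A)) (sym ε (core B))) :
    ∃ (P : GL I F) (Q : GL J F) (R : GL K F), trans A P.1 Q.1 R.1 = B := by
  obtain ⟨φ, ψ, h⟩ := h
  obtain ⟨p, q, hpq⟩ := core_equiv_of_sym F hX φ ψ.toAddEquiv h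
  exact exists_gl_of_core hpq fun c z => ψ.map_smul c z

theorem exists_trans_sym_core (ε : F) {A B : I → J → K → F}
    (h : ∃ (P : GL I F) (Q : GL J F) (R : GL K F), trans A P.1 Q.1 R.1 = B) :
    ∃ (P : GL ((Unit ⊕ I) ⊕ (J ⊕ (K ⊕ X))) F) (R : GL ((Unit ⊕ I) × (K ⊕ X)) F),
      trans (sym ε (core A)) P.1 P.1 R.1 = sym ε (core B) := by
  obtain ⟨P, Q, R, h⟩ := exists_trans_core (X := X) h
  exact ⟨glBlock P Q, R, trans_sym ε h⟩

/-- The coordinates of the symmetrized core array are coordinates of its values. -/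
theorem exists_sym_core_eq_single (ε : F) (A : I → J → K → F) (z : (Unit ⊕ I) × (K ⊕ X)) :
    ∃ i j, sym ε (core A) i j = Pi.single z 1 := by
  refine ⟨.inl z.1, .inr (.inr z.2), ?_⟩
  funext w
  rcases z with ⟨z | z, c⟩ <;> simp [sym, core, Pi.single_apply]

end Isometry

/-! ### Algebras -/

section Algebras
variable {F : Type u} [Field F] {ι κ ζ : Type*} [Fintype ι] [Fintype κ] [Fintype ζ]
  [DecidableEq ι] [DecidableEq κ] [DecidableEq ζ]

/-- Isomorphism of algebras given by structure constants. -/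
def AlgIso (M N : κ → κ → κ → F) : Prop :=
  ∃ φ : (κ → F) ≃ₗ[F] (κ → F), ∀ x y, φ (bil M x y) = bil N (φ x) (φ y)

/-- The algebra on the direct sum of the source and the target of a bilinear map `M` in which the
product of two elements is the value of `M` on their first components. -/
def nilAlg (M : ι → ι → ζ → F) : ι ⊕ ζ → ι ⊕ ζ → ι ⊕ ζ → F
  | .inl i, .inl j, .inr k => M i j k
  | .inl _, .inl _, .inl _ => 0
  | .inl _, .inr _, _ => 0
  | .inr _, _, _ => 0

theorem bil_nilAlg (M : ι → ι → ζ → F) (x y : ι ⊕ ζ → F) :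
    bil (nilAlg M) x y = Sum.elim (0 : ι → F) (bil M (x ∘ Sum.inl) (y ∘ Sum.inl)) := by
  funext k
  rcases k with k | k <;> simp [bil, nilAlg]

theorem algIso_nilAlg {M N : ι → ι → ζ → F} (h : BilIso M N) : AlgIso (nilAlg M) (nilAlg N) := by
  obtain ⟨φ, ψ, h⟩ := h
  refine ⟨(LinearEquiv.sumArrowLequivProdArrow ι ζ F F).trans ((φ.prodCongr ψ).trans
    (LinearEquiv.sumArrowLequivProdArrow ι ζ F F).symm), fun x y => ?_⟩
  rw [bil_nilAlg, bil_nilAlg]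
  funext k
  rcases k with k | k
  · change φ 0 k = 0
    rw [map_zero]; rfl
  · change ψ (bil M (x ∘ Sum.inl) (y ∘ Sum.inl)) k = _
    rw [h]; rfl

theorem bilIso_of_algIso_nilAlg {M N : ι → ι → ζ → F}
    (hM : ∀ z, ∃ i j, M i j = Pi.single z 1) (hN : ∀ z, ∃ i j, N i j = Pi.single z 1)
    (h : AlgIso (nilAlg M) (nilAlg N)) : BilIso M N := by
  -- the subspace generated by all products is the second summand
  have key : ∀ {M N : ι → ι → ζ → F}, (∀ z, ∃ i j, M i j = Pi.single z 1) →
      ∀ φ : (ι ⊕ ζ → F) ≃ₗ[F] (ι ⊕ ζ → F),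
      (∀ x y, φ (bil (nilAlg M) x y) = bil (nilAlg N) (φ x) (φ y)) →
      ∀ z, φ (Sum.elim 0 z) ∘ Sum.inl = 0 := by
    intro M N hM φ hφ z
    have h1 : ∀ k, φ (Sum.elim 0 (Pi.single k 1)) ∘ Sum.inl = 0 := by
      intro k
      obtain ⟨i, j, hij⟩ := hM k
      have h2 := hφ (Sum.elim (Pi.single i 1) 0) (Sum.elim (Pi.single j 1) 0)
      rw [bil_nilAlg, bil_nilAlg, Sum.elim_comp_inl, Sum.elim_comp_inl, bil_single, hij] at h2
      rw [h2]; rfl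
    have h3 : (LinearMap.funLeft F F Sum.inl ∘ₗ φ.toLinearMap ∘ₗ extendRight F F ι ζ) = 0 := by
      refine LinearMap.pi_ext' fun k => LinearMap.ext_ring ?_
      exact h1 k
    exact LinearMap.congr_fun h3 z
  obtain ⟨φ, h⟩ := h
  have h' := symm_bil_eq (φ := φ.toEquiv) (ψ := φ.toEquiv) h
  obtain ⟨p, q, hp, hq⟩ := exists_block φ (key hM φ h) (key hN φ.symm h')
  refine ⟨p, q, fun x y => ?_⟩
  have h1 := h (Sum.elim x 0) (Sum.elim y 0)
  rw [bil_nilAlg, bil_nilAlg, hp, hp, hq] at h1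
  simpa using congrArg (· ∘ Sum.inr) h1

/-- Adjoining an identity element. -/
def unitAlg (N : κ → κ → κ → F) : Unit ⊕ κ → Unit ⊕ κ → Unit ⊕ κ → F
  | .inl _, j, k => if j = k then 1 else 0
  | .inr i, .inl _, k => if .inr i = k then 1 else 0
  | .inr _, .inr _, .inl _ => 0
  | .inr i, .inr j, .inr k => N i j k

theorem bil_unitAlg_inl (N : κ → κ → κ → F) (x y : Unit ⊕ κ → F) (k : Unit) :
    bil (unitAlg N) x y (.inl k) = x (.inl ()) * y (.inl ()) := by
  simp [bil, unitAlg]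

theorem bil_unitAlg_inr (N : κ → κ → κ → F) (x y : Unit ⊕ κ → F) (k : κ) :
    bil (unitAlg N) x y (.inr k) = x (.inl ()) * y (.inr k) + x (.inr k) * y (.inl ()) +
      bil N (x ∘ Sum.inr) (y ∘ Sum.inr) k := by
  simp [bil, unitAlg, Finset.sum_add_distrib, add_assoc, add_left_comm]

theorem bil_unitAlg_elim (N : κ → κ → κ → F) (x y : κ → F) :
    bil (unitAlg N) (Sum.elim 0 x) (Sum.elim 0 y) =
      Sum.elim (0 : Unit → F) (bil N x y) := by
  funext k
  rcases k with k | k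
  · rw [bil_unitAlg_inl]; simp
  · rw [bil_unitAlg_inr]; simp

theorem algIso_unitAlg {M N : κ → κ → κ → F} (h : AlgIso M N) :
    AlgIso (unitAlg M) (unitAlg N) := by
  obtain ⟨φ, h⟩ := h
  refine ⟨(LinearEquiv.sumArrowLequivProdArrow Unit κ F F).trans
    (((LinearEquiv.refl F (Unit → F)).prodCongr φ).trans
    (LinearEquiv.sumArrowLequivProdArrow Unit κ F F).symm), fun x y => ?_⟩
  funext k
  rcases k with k | k
  · rw [bil_unitAlg_inl]
    exact bil_unitAlg_inl M x y ()
  · rw [bil_unitAlg_inr]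
    change φ (bil (unitAlg M) x y ∘ Sum.inr) k = _
    have e : bil (unitAlg M) x y ∘ Sum.inr = x (.inl ()) • (y ∘ Sum.inr) +
        y (.inl ()) • (x ∘ Sum.inr) + bil M (x ∘ Sum.inr) (y ∘ Sum.inr) := by
      funext k
      rw [Function.comp_apply, bil_unitAlg_inr]
      simp [mul_comm]
    rw [e, map_add, map_add, map_smul, map_smul, h]
    change x (.inl ()) * φ (y ∘ Sum.inr) k + y (.inl ()) * φ (x ∘ Sum.inr) k + _ =
      x (.inl ()) * φ (y ∘ Sum.inr) k + φ (x ∘ Sum.inr) k * y (.inl ()) + _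
    rw [mul_comm (y _)]
    rfl

/-- Cancelling an adjoined identity: the nilpotent elements form the given algebra. -/
theorem algIso_of_unitAlg {M N : κ → κ → κ → F} (hM : ∀ x, bil M x (bil M x x) = 0)
    (hN : ∀ x, bil N x (bil N x x) = 0) (h : AlgIso (unitAlg M) (unitAlg N)) : AlgIso M N := by
  -- the identity coordinate is multiplicative, so it vanishes on elements whose cube is zero
  have key : ∀ {M N : κ → κ → κ → F}, (∀ x, bil M x (bil M x x) = 0) →
      ∀ φ : (Unit ⊕ κ → F) ≃ₗ[F] (Unit ⊕ κ → F),
      (∀ x y, φ (bil (unitAlg M) x y) = bil (unitAlg N) (φ x) (φ y)) →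
      ∀ y, φ (Sum.elim 0 y) ∘ Sum.inl = 0 := by
    intro M N hM φ hφ y
    have h1 : φ (bil (unitAlg M) (Sum.elim 0 y) (bil (unitAlg M) (Sum.elim 0 y) (Sum.elim 0 y)))
        (.inl ()) = 0 := by
      rw [bil_unitAlg_elim, bil_unitAlg_elim, hM]
      simp
    rw [hφ, hφ, bil_unitAlg_inl, bil_unitAlg_inl] at h1
    funext i
    simpa using h1
  obtain ⟨φ, h⟩ := h
  have h' := symm_bil_eq (φ := φ.toEquiv) (ψ := φ.toEquiv) h
  obtain ⟨p, q, hp, hq⟩ := exists_block φ (key hM φ h) (key hN φ.symm h')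
  refine ⟨q, fun x y => ?_⟩
  have h1 := h (Sum.elim 0 x) (Sum.elim 0 y)
  rw [bil_unitAlg_elim, hq, hq, hq, bil_unitAlg_elim] at h1
  simpa using congrArg (· ∘ Sum.inr) h1

theorem nilAlg_mul_mul (M : ι → ι → ζ → F) (x y z : ι ⊕ ζ → F) :
    bil (nilAlg M) (bil (nilAlg M) x y) z = 0 ∧ bil (nilAlg M) x (bil (nilAlg M) y z) = 0 := by
  simp [bil_nilAlg]

theorem nilAlg_comm {M : ι → ι → ζ → F} (hM : ∀ x y, bil M x y = bil M y x) (x y : ι ⊕ ζ → F) :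
    bil (nilAlg M) x y = bil (nilAlg M) y x := by
  rw [bil_nilAlg, bil_nilAlg, hM]

theorem nilAlg_self {M : ι → ι → ζ → F} (hM : ∀ x, bil M x x = 0) (x : ι ⊕ ζ → F) :
    bil (nilAlg M) x x = 0 := by
  rw [bil_nilAlg, hM, Sum.elim_zero_zero]

theorem unitAlg_comm {N : κ → κ → κ → F} (hN : ∀ x y, bil N x y = bil N y x) (x y : Unit ⊕ κ → F) :
    bil (unitAlg N) x y = bil (unitAlg N) y x := by
  funext k
  rcases k with k | k
  · rw [bil_unitAlg_inl, bil_unitAlg_inl, mul_comm]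
  · rw [bil_unitAlg_inr, bil_unitAlg_inr, hN]; ring

theorem unitAlg_one (N : κ → κ → κ → F) (x : Unit ⊕ κ → F) :
    bil (unitAlg N) (Pi.single (.inl ()) 1) x = x ∧
      bil (unitAlg N) x (Pi.single (.inl ()) 1) = x := by
  have h : (Pi.single (.inl ()) 1 : Unit ⊕ κ → F) ∘ Sum.inr = 0 := by
    funext k; simp
  constructor <;> funext k <;> rcases k with k | k
  · rw [bil_unitAlg_inl]; simp
  · rw [bil_unitAlg_inr, h]; simp
  · rw [bil_unitAlg_inl]; simp
  · rw [bil_unitAlg_inr, h]; simp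

theorem unitAlg_assoc {N : κ → κ → κ → F} (hN : ∀ x y z, bil N (bil N x y) z = bil N x (bil N y z))
    (x y z : Unit ⊕ κ → F) :
    bil (unitAlg N) (bil (unitAlg N) x y) z = bil (unitAlg N) x (bil (unitAlg N) y z) := by
  have e : ∀ x y, bil (unitAlg N) x y ∘ Sum.inr = x (.inl ()) • (y ∘ Sum.inr) +
      y (.inl ()) • (x ∘ Sum.inr) + bil N (x ∘ Sum.inr) (y ∘ Sum.inr) := by
    intro x y
    funext k
    rw [Function.comp_apply, bil_unitAlg_inr]
    simp [mul_comm]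
  funext k
  rcases k with k | k
  · simp only [bil_unitAlg_inl, mul_assoc]
  · simp only [bil_unitAlg_inr, e, bil_unitAlg_inl, bil_add_left, bil_add_right, bil_smul_left,
      bil_smul_right, Pi.add_apply, Pi.smul_apply, smul_eq_mul, hN]
    ring

theorem sym_comm {T : ι → κ → ζ → F} (x y : ι ⊕ κ → F) : bil (sym 1 T) x y = bil (sym 1 T) y x := by
  rw [bil_sym, bil_sym, one_smul, one_smul, add_comm]

theorem sym_self {T : ι → κ → ζ → F} (x : ι ⊕ κ → F) : bil (sym (-1) T) x x = 0 := by
  rw [bil_sym, neg_one_smul, add_neg_cancel]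

end Algebras

/-! ### Numbering index types -/

section Numbering
variable {F : Type u} [Field F]

/-- The numbering of a disjoint union. -/
def sumE {I J : Type*} {a b : ℕ} (e : I ≃ Fin a) (f : J ≃ Fin b) : I ⊕ J ≃ Fin (a + b) :=
  (Equiv.sumCongr e f).trans finSumFinEquiv

/-- The lexicographic numbering of a product. -/
def prodE {I J : Type*} {a b : ℕ} (e : I ≃ Fin a) (f : J ≃ Fin b) : I × J ≃ Fin (a * b) :=
  (Equiv.prodCongr e f).trans finProdFinEquiv

/-- The numbering of a one-element type. -/
def unitE : Unit ≃ Fin 1 := finOneEquiv.symm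

@[simp] theorem sumE_inl {I J : Type*} {a b : ℕ} (e : I ≃ Fin a) (f : J ≃ Fin b) (i : I) :
    (sumE e f (.inl i) : ℕ) = e i := by simp [sumE]

@[simp] theorem sumE_inr {I J : Type*} {a b : ℕ} (e : I ≃ Fin a) (f : J ≃ Fin b) (j : J) :
    (sumE e f (.inr j) : ℕ) = a + f j := by simp [sumE]

@[simp] theorem prodE_apply {I J : Type*} {a b : ℕ} (e : I ≃ Fin a) (f : J ≃ Fin b) (i : I)
    (j : J) :
    (prodE e f (i, j) : ℕ) = e i * b + f j := by simp [prodE, add_comm, mul_comm]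

@[simp] theorem unitE_apply (i : Unit) : (unitE i : ℕ) = 0 := by simp [unitE]

variable {I J K : Type*} {a b c : ℕ}

/-- An array on numbered index types as an array in the usual sense. -/
def ren (e₁ : I ≃ Fin a) (e₂ : J ≃ Fin b) (e₃ : K ≃ Fin c) (T : I → J → K → F) : Arr F a b c :=
  fun i j k => T (e₁.symm i) (e₂.symm j) (e₃.symm k)

theorem ren_injective (e₁ : I ≃ Fin a) (e₂ : J ≃ Fin b) (e₃ : K ≃ Fin c) :
    Function.Injective (ren (F := F) e₁ e₂ e₃) := by
  intro T T' h
  funext i j k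
  simpa [ren] using congrFun₃ h (e₁ i) (e₂ j) (e₃ k)

variable [Fintype I] [Fintype J] [Fintype K] [DecidableEq I] [DecidableEq J] [DecidableEq K]

theorem trans_ren (e₁ : I ≃ Fin a) (e₂ : J ≃ Fin b) (e₃ : K ≃ Fin c) (T : I → J → K → F)
    (P : Matrix (Fin a) (Fin a) F) (Q : Matrix (Fin b) (Fin b) F) (R : Matrix (Fin c) (Fin c) F) :
    trans (ren e₁ e₂ e₃ T) P Q R =
      ren e₁ e₂ e₃ (trans T (P.submatrix e₁ e₁) (Q.submatrix e₂ e₂) (R.submatrix e₃ e₃)) := by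
  funext i' j' k'
  simp only [trans, ren, Matrix.submatrix_apply, Equiv.apply_symm_apply]
  rw [← Equiv.sum_comp e₁]
  refine Finset.sum_congr rfl fun i _ => ?_
  rw [← Equiv.sum_comp e₂]
  refine Finset.sum_congr rfl fun j _ => ?_
  rw [← Equiv.sum_comp e₃]
  simp

/-- Renumbering the rows and columns of an invertible matrix. -/
def glReindex {I J : Type*} [Fintype I] [Fintype J] [DecidableEq I] [DecidableEq J] (e : I ≃ J)
    (P : GL I F) : GL J F where
  val := P.1.submatrix e.symm e.symm
  inv := P⁻¹.1.submatrix e.symm e.symm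
  val_inv := by rw [Matrix.submatrix_mul_equiv, ← Units.val_mul]; simp
  inv_val := by rw [Matrix.submatrix_mul_equiv, ← Units.val_mul]; simp

theorem exists_trans_ren_iff {I K : Type*} [Fintype I] [Fintype K] [DecidableEq I] [DecidableEq K]
    (e₁ : I ≃ Fin a) (e₃ : K ≃ Fin c) (S T : I → I → K → F) :
    (∃ (P : GL (Fin a) F) (R : GL (Fin c) F), trans (ren e₁ e₁ e₃ S) P.1 P.1 R.1 = ren e₁ e₁ e₃ T) ↔
      ∃ (P : GL I F) (R : GL K F), trans S P.1 P.1 R.1 = T := by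
  constructor
  · rintro ⟨P, R, h⟩
    rw [trans_ren] at h
    exact ⟨glReindex e₁.symm P, glReindex e₃.symm R, ren_injective _ _ _ h⟩
  · rintro ⟨P, R, h⟩
    refine ⟨glReindex e₁ P, glReindex e₃ R, ?_⟩
    rw [trans_ren, ← h]
    simp [glReindex, Matrix.submatrix_submatrix]

theorem bil_ren {I J K : Type*} [Fintype I] [Fintype J] (e₁ : I ≃ Fin a) (e₂ : J ≃ Fin b)
    (e₃ : K ≃ Fin c) (T : I → J → K → F) (x : Fin a → F) (y : Fin b → F) :
    bil (ren e₁ e₂ e₃ T) x y = bil T (x ∘ e₁) (y ∘ e₂) ∘ e₃.symm := by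
  funext k
  simp only [bil, ren, Function.comp_apply]
  rw [← Equiv.sum_comp e₁]
  refine Finset.sum_congr rfl fun i _ => ?_
  rw [← Equiv.sum_comp e₂]
  simp

theorem algIso_ren_iff {κ : Type*} [Fintype κ] (e : κ ≃ Fin a) (M N : κ → κ → κ → F) :
    AlgIso (ren e e e M) (ren e e e N) ↔ AlgIso M N := by
  let f : (Fin a → F) ≃ₗ[F] (κ → F) := LinearEquiv.funCongrLeft F F e
  have hf : ∀ x, f x = x ∘ e := fun x => rfl
  have hf' : ∀ x, f.symm x = x ∘ e.symm := fun x => rfl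
  constructor
  · rintro ⟨φ, h⟩
    refine ⟨f.symm.trans (φ.trans f), fun x y => ?_⟩
    have h1 := h (f.symm x) (f.symm y)
    rw [bil_ren, bil_ren, ← hf', ← hf', ← hf, ← hf, ← hf, ← hf, f.apply_symm_apply,
      f.apply_symm_apply, LinearEquiv.eq_symm_apply] at h1
    exact h1
  · rintro ⟨φ, h⟩
    refine ⟨f.trans (φ.trans f.symm), fun x y => ?_⟩
    rw [bil_ren, bil_ren, ← hf', ← hf', ← hf, ← hf, ← hf, ← hf]
    simp only [LinearEquiv.trans_apply, LinearEquiv.apply_symm_apply, h]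

end Numbering

/-! ### Expressions for the arrays -/

section Expressions
variable {F : Type u} [Field F]

/-- The expression `g` in three indices computes the array `T`, in the environment `ρ` and with
input `x`. -/
def Computes {I J K : Type*} {a b c : ℕ} (ρ : ℕ → ℕ) (x : ℕ → F)
    (g : NatExpr → NatExpr → NatExpr → FieldExpr F) (e₁ : I ≃ Fin a) (e₂ : J ≃ Fin b)
    (e₃ : K ≃ Fin c) (T : I → J → K → F) : Prop :=
  ∀ (i j k : NatExpr) (u : I) (v : J) (w : K), i.eval ρ = e₁ u → j.eval ρ = e₂ v →
    k.eval ρ = e₃ w → (g i j k).eval ρ x = T u v w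

theorem Computes.eval_eq {I J K : Type*} {a b c : ℕ} {ρ : ℕ → ℕ} {x : ℕ → F}
    {g : NatExpr → NatExpr → NatExpr → FieldExpr F} {e₁ : I ≃ Fin a} {e₂ : J ≃ Fin b}
    {e₃ : K ≃ Fin c} {T : I → J → K → F} (h : Computes ρ x g e₁ e₂ e₃ T) (i : Fin a) (j : Fin b)
    (k : Fin c) (hi : ρ 3 = i) (hj : ρ 4 = j) (hk : ρ 5 = k) :
    (g (.var 3) (.var 4) (.var 5)).eval ρ x = ren e₁ e₂ e₃ T i j k :=
  h _ _ _ _ _ _ (by simpa using hi) (by simpa using hj) (by simpa using hk)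

/-- The entries of the input. -/
def inputExpr (i j k : NatExpr) : FieldExpr F := .inp 1 ((i * .var 1 + j) * .var 2 + k)

theorem computes_input {ℓ n m : ℕ} (A : Arr F ℓ n m) {ρ : ℕ → ℕ} (hρ : IsEnv ℓ n m ρ) :
    Computes ρ (fun t => A.toList.getD t 0) inputExpr (Equiv.refl (Fin ℓ)) (Equiv.refl (Fin n))
      (Equiv.refl (Fin m)) A := by
  intro i j k u v w hi hj hk
  have e1 : ρ ((1 : Fin 20) : ℕ) = n := hρ.h1
  have e2 : ρ ((2 : Fin 20) : ℕ) = m := hρ.h2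
  simp only [inputExpr, FieldExpr.eval_inp, NatExpr.eval_add, NatExpr.eval_mul, NatExpr.eval_var,
    hi, hj, hk, e1, e2, Equiv.refl_apply, one_mul]
  exact Arr.getD_toList A u v w 0

variable {I J K X ι κ ζ : Type*} [Fintype I] [Fintype J] [Fintype K] [Fintype X]
  [DecidableEq I] [DecidableEq J] [DecidableEq K] [DecidableEq X] {a b c d : ℕ}
  {ρ : ℕ → ℕ} {x : ℕ → F} {g : NatExpr → NatExpr → NatExpr → FieldExpr F}

/-- The entries of the core array. -/
def coreExpr (dJ dK dX : NatExpr) (g : NatExpr → NatExpr → NatExpr → FieldExpr F)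
    (i j k : NatExpr) : FieldExpr F :=
  .ifLt j dJ (.ifLt i 1 (.const 0) (.ifLt k dK (g (i - 1) j k) (.const 0)))
    (.ifEq k (i * (dK + dX) + (j - dJ)) (.const 1) (.const 0))

theorem computes_core {A : I → J → K → F} {eI : I ≃ Fin a} {eJ : J ≃ Fin b} {eK : K ≃ Fin c}
    {eX : X ≃ Fin d} (hg : Computes ρ x g eI eJ eK A) {dJ dK dX : NatExpr} (hJ : dJ.eval ρ = b)
    (hK : dK.eval ρ = c) (hX : dX.eval ρ = d) :
    Computes ρ x (coreExpr dJ dK dX g) (sumE unitE eI) (sumE eJ (sumE eK eX))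
      (prodE (sumE unitE eI) (sumE eK eX)) (core A) := by
  intro i j k u v w hi hj hk
  simp only [coreExpr, FieldExpr.eval_ifLt, FieldExpr.eval_ifEq, NatExpr.eval_add, NatExpr.eval_mul,
    NatExpr.eval_sub, hJ, hK, hX, NatExpr.eval_one, FieldExpr.eval_const]
  rcases v with v | s
  · rw [sumE_inl] at hj
    rw [if_pos (by rw [hj]; exact (eJ v).2)]
    rcases u with u | u
    · rw [sumE_inl, unitE_apply] at hi
      rw [if_pos (by omega)]
      rfl
    · rw [sumE_inr] at hi
      rw [if_neg (by omega)]
      rcases w with ⟨w | w, s | s⟩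
      · simp only [prodE_apply, sumE_inl, unitE_apply, zero_mul, zero_add] at hk
        rw [if_pos (by rw [hk]; exact (eK s).2)]
        exact hg _ _ _ _ _ _ (by simp [hi]) hj hk
      · simp only [prodE_apply, sumE_inl, unitE_apply, zero_mul, zero_add, sumE_inr] at hk
        rw [if_neg (by omega)]
        rfl
      · simp only [prodE_apply, sumE_inr, add_mul, one_mul] at hk
        rw [if_neg (by omega)]
        rfl
      · simp only [prodE_apply, sumE_inr, add_mul, one_mul] at hk
        rw [if_neg (by omega)]
        rfl
  · rw [sumE_inr] at hj
    rw [if_neg (by omega), hi, hj, Nat.add_sub_cancel_left]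
    have e : core A u (.inr s : J ⊕ (K ⊕ X)) w = if w = (u, s) then 1 else 0 := by
      rcases u with u | u <;> rfl
    rw [e]
    refine if_congr ?_ rfl rfl
    rw [hk, ← prodE_apply (sumE unitE eI) (sumE eK eX) u s, Fin.val_inj, Equiv.apply_eq_iff_eq]

/-- The entries of a symmetrized array. -/
def symExpr (ε : F) (d : NatExpr) (g : NatExpr → NatExpr → NatExpr → FieldExpr F)
    (i j k : NatExpr) : FieldExpr F :=
  .ifLt i d (.ifLt j d (.const 0) (g i (j - d) k))
    (.ifLt j d ((g j (i - d) k).scale ε) (.const 0))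

theorem computes_sym (ε : F) {T : ι → κ → ζ → F} {e₁ : ι ≃ Fin a} {e₂ : κ ≃ Fin b} {e₃ : ζ ≃ Fin c}
    (hg : Computes ρ x g e₁ e₂ e₃ T) {d : NatExpr} (hd : d.eval ρ = a) :
    Computes ρ x (symExpr ε d g) (sumE e₁ e₂) (sumE e₁ e₂) e₃ (sym ε T) := by
  intro i j k u v w hi hj hk
  simp only [symExpr, FieldExpr.eval_ifLt, hd, FieldExpr.eval_const, FieldExpr.eval_scale]
  rcases u with u | u <;> rcases v with v | v <;>
    simp only [sumE_inl, sumE_inr] at hi hj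
  · rw [if_pos (by rw [hi]; exact (e₁ u).2), if_pos (by rw [hj]; exact (e₁ v).2)]; rfl
  · rw [if_pos (by rw [hi]; exact (e₁ u).2), if_neg (by omega)]
    exact hg _ _ _ _ _ _ hi (by simp [hd, hj]) hk
  · rw [if_neg (by omega), if_pos (by rw [hj]; exact (e₁ v).2)]
    exact congrArg (ε * ·) (hg _ _ _ _ _ _ hj (by simp [hd, hi]) hk)
  · rw [if_neg (by omega), if_neg (by omega)]; rfl

/-- The structure constants of the algebra of a bilinear map. -/
def nilExpr (d : NatExpr) (g : NatExpr → NatExpr → NatExpr → FieldExpr F) (i j k : NatExpr) :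
    FieldExpr F :=
  .ifLt i d (.ifLt j d (.ifLt k d (.const 0) (g i j (k - d))) (.const 0)) (.const 0)

theorem computes_nil {M : ι → ι → ζ → F} {e₁ : ι ≃ Fin a} {e₃ : ζ ≃ Fin c}
    (hg : Computes ρ x g e₁ e₁ e₃ M) {d : NatExpr} (hd : d.eval ρ = a) :
    Computes ρ x (nilExpr d g) (sumE e₁ e₃) (sumE e₁ e₃) (sumE e₁ e₃) (nilAlg M) := by
  intro i j k u v w hi hj hk
  simp only [nilExpr, FieldExpr.eval_ifLt, hd, FieldExpr.eval_const]
  rcases u with u | u <;> simp only [sumE_inl, sumE_inr] at hi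
  · rw [if_pos (by rw [hi]; exact (e₁ u).2)]
    rcases v with v | v <;> simp only [sumE_inl, sumE_inr] at hj
    · rw [if_pos (by rw [hj]; exact (e₁ v).2)]
      rcases w with w | w <;> simp only [sumE_inl, sumE_inr] at hk
      · rw [if_pos (by rw [hk]; exact (e₁ w).2)]; rfl
      · rw [if_neg (by omega)]
        exact hg _ _ _ _ _ _ hi hj (by simp [hd, hk])
    · rw [if_neg (by omega)]; rfl
  · rw [if_neg (by omega)]; rfl

/-- The structure constants of an algebra with adjoined identity. -/
def unitExpr (g : NatExpr → NatExpr → NatExpr → FieldExpr F) (i j k : NatExpr) : FieldExpr F :=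
  .ifLt i 1 (.ifEq j k (.const 1) (.const 0)) (.ifLt j 1 (.ifEq i k (.const 1) (.const 0))
    (.ifLt k 1 (.const 0) (g (i - 1) (j - 1) (k - 1))))

theorem computes_unit [DecidableEq κ] {N : κ → κ → κ → F} {e : κ ≃ Fin a}
    (hg : Computes ρ x g e e e N) :
    Computes ρ x (unitExpr g) (sumE unitE e) (sumE unitE e) (sumE unitE e) (unitAlg N) := by
  intro i j k u v w hi hj hk
  simp only [unitExpr, FieldExpr.eval_ifLt, FieldExpr.eval_const, FieldExpr.eval_ifEq,
    NatExpr.eval_one]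
  rcases u with u | u
  · rw [if_pos (by rw [hi]; simp)]
    refine if_congr ?_ rfl rfl
    rw [hj, hk, Fin.val_inj, Equiv.apply_eq_iff_eq]
  · rw [if_neg (by rw [hi]; simp)]
    rcases v with v | v
    · rw [if_pos (by rw [hj]; simp)]
      refine if_congr ?_ rfl rfl
      rw [hi, hk, Fin.val_inj, Equiv.apply_eq_iff_eq]
    · rw [if_neg (by rw [hj]; simp)]
      rcases w with w | w
      · rw [if_pos (by rw [hk]; simp)]; rfl
      · rw [if_neg (by rw [hk]; simp)]
        exact hg _ _ _ _ _ _ (by simp [hi]) (by simp [hj]) (by simp [hk])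

end Expressions

/-! ### Isometry of matrix spaces -/

section MatrixSpaces
variable {F : Type u} [Field F]

/-- The same program reduces to a problem and to its restrictions. -/
theorem PolyTimeReduces.of_restrict {sz : F → ℕ} {P Q : IsoProblem F}
    {V : {f : Q.Format} → Q.Obj f → Prop} (h : PolyTimeReduces sz P (Q.restrict V)) :
    PolyTimeReduces sz P Q := by
  obtain ⟨M, p, h⟩ := h
  refine ⟨M, p, fun f A B => ?_⟩
  obtain ⟨t, σ, h1, h2, g, A', B', h3, h4⟩ := h f A B
  exact ⟨t, σ, h1, h2, g, A'.1, B'.1, h3, h4⟩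

theorem tensorIso_iff {ℓ n m : ℕ} (A B : Arr F ℓ n m) :
    (∃ (P : GL (Fin ℓ) F) (Q : GL (Fin n) F) (R : GL (Fin m) F), ∀ i' j' k',
        (∑ i, ∑ j, ∑ k, A i j k * P.1 i i' * Q.1 j j' * R.1 k k') = B i' j' k') ↔
      ∃ (P : GL (Fin ℓ) F) (Q : GL (Fin n) F) (R : GL (Fin m) F), trans A P.1 Q.1 R.1 = B := by
  simp only [funext_iff]
  rfl

/-- The image of the span of a tuple under a linear map. -/
theorem image_span_eq_iff {ζ M M' : Type*} [Fintype ζ] [DecidableEq ζ] [AddCommGroup M]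
    [Module F M] [AddCommGroup M'] [Module F M'] (f : M →ₗ[F] M') (x : ζ → M) (y : ζ → M') :
    (f '' (Submodule.span F (Set.range x) : Set M) = (Submodule.span F (Set.range y) : Set M')) ↔
      ∃ R : GL ζ F, ∀ k', ∑ k, R.1 k k' • f (x k) = y k' := by
  rw [← Submodule.map_coe, SetLike.coe_set_eq, Submodule.map_span, ← Set.range_comp]
  constructor
  · intro h
    obtain ⟨R, hR⟩ := exists_gl_of_span_eq _ _ h
    exact ⟨R, fun k' => (hR k').symm⟩
  · have key : ∀ {x y : ζ → M'} {R : GL ζ F}, (∀ k', ∑ k, R.1 k k' • x k = y k') →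
        Submodule.span F (Set.range y) ≤ Submodule.span F (Set.range x) := by
      intro x y R h
      rw [Submodule.span_le]
      rintro _ ⟨k', rfl⟩
      rw [← h]
      exact Submodule.sum_mem _ fun k _ => Submodule.smul_mem _ _ (Submodule.subset_span ⟨k, rfl⟩)
    rintro ⟨R, hR⟩
    refine le_antisymm (key (R := R⁻¹) fun k' => ?_) (key (R := R) hR)
    have e : ∀ k, ∑ j, R⁻¹.1 j k' * R.1 k j = if k = k' then 1 else 0 := by
      intro k
      have : (R.1 * R⁻¹.1) k k' = (1 : Matrix _ _ F) k k' := by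
        rw [← Units.val_mul, mul_inv_cancel]; rfl
      rw [Matrix.mul_apply, Matrix.one_apply] at this
      rw [← this]
      exact Finset.sum_congr rfl fun _ _ => mul_comm _ _
    simp only [← hR, Finset.smul_sum, smul_smul]
    rw [Finset.sum_comm]
    simp only [← Finset.sum_smul, e, Function.comp_apply]
    simp

variable {ι κ ζ : Type*} [Fintype ι] [Fintype κ] [Fintype ζ] [DecidableEq ι] [DecidableEq κ]
  [DecidableEq ζ]

/-- The slices of an array in the third direction. -/
def slice (T : ι → κ → ζ → F) (k : ζ) : Matrix ι κ F := Matrix.of fun i j => T i j k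

theorem linearIndependent_slice {T : ι → κ → ζ → F} (h : ∀ z, ∃ i j, T i j = Pi.single z 1) :
    LinearIndependent F (slice T) := by
  rw [Fintype.linearIndependent_iff]
  intro g hg z
  obtain ⟨i, j, hij⟩ := h z
  have := congrFun₂ hg i j
  simpa [Matrix.sum_apply, slice, hij, Pi.single_apply] using this

theorem mul_slice_mul {ι' κ' : Type*} (T : ι → κ → ζ → F) (P : Matrix ι' ι F) (Q : Matrix κ κ' F)
    (R : Matrix ζ ζ F) (k' : ζ) :
    ∑ k, R k k' • (P * slice T k * Q) = slice (trans T P.transpose Q R) k' := by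
  ext i' j'
  simp only [Matrix.sum_apply, Matrix.smul_apply, smul_eq_mul, Matrix.mul_apply, slice,
    Matrix.of_apply, trans, Matrix.transpose_apply, Finset.mul_sum, Finset.sum_mul]
  rw [Finset.sum_comm]
  refine (Finset.sum_congr rfl fun j _ => Finset.sum_comm).trans ?_
  rw [Finset.sum_comm]
  congr! 3
  ring

theorem exists_isometry_iff (S T : ι → ι → ζ → F) :
    (∃ P : GL ι F, (fun M => P.1 * M * P.1.transpose) ''
        (Submodule.span F (Set.range (slice S)) : Set (Matrix ι ι F)) =
          (Submodule.span F (Set.range (slice T)) : Set (Matrix ι ι F))) ↔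
      ∃ (P : GL ι F) (R : GL ζ F), trans S P.1 P.1 R.1 = T := by
  have key : ∀ P : GL ι F, ((fun M => P.1 * M * P.1.transpose) ''
        (Submodule.span F (Set.range (slice S)) : Set (Matrix ι ι F)) =
          (Submodule.span F (Set.range (slice T)) : Set (Matrix ι ι F))) ↔
      ∃ R : GL ζ F, trans S P.1.transpose P.1.transpose R.1 = T := by
    intro P
    refine (image_span_eq_iff ((LinearMap.mulRight F P.1.transpose) ∘ₗ (LinearMap.mulLeft F P.1))
      (slice S) (slice T)).trans (exists_congr fun R => ?_)
    simp only [LinearMap.comp_apply, LinearMap.mulRight_apply, LinearMap.mulLeft_apply,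
      mul_slice_mul]
    constructor
    · intro h
      funext i j k
      exact congrFun₂ (h k) i j
    · rintro h k
      rw [h]
  simp only [key]
  constructor
  · rintro ⟨P, R, h⟩
    refine ⟨glDual P⁻¹, R, ?_⟩
    have : (glDual P⁻¹).1 = P.1.transpose := by simp [glDual]
    rwa [this]
  · rintro ⟨P, R, h⟩
    refine ⟨glDual P⁻¹, R, ?_⟩
    have : (glDual P⁻¹).1.transpose = P.1 := by simp [glDual]
    rwa [this]

theorem slice_alternating {T : ι → ι → ζ → F} (h : ∀ x, bil T x x = 0) {M : Matrix ι ι F}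
    (hM : M ∈ Submodule.span F (Set.range (slice T))) (v : ι → F) : v ⬝ᵥ M.mulVec v = 0 := by
  induction hM using Submodule.span_induction with
  | mem M hM =>
    obtain ⟨k, rfl⟩ := hM
    have := congrFun (h v) k
    simp only [bil, Pi.zero_apply] at this
    simp only [dotProduct, Matrix.mulVec, slice, Matrix.of_apply, Finset.mul_sum]
    rw [← this]
    congr! 2
    ring
  | zero => simp
  | add M N _ _ hM hN => rw [Matrix.add_mulVec, dotProduct_add, hM, hN, add_zero]
  | smul c M _ hM => rw [Matrix.smul_mulVec, dotProduct_smul, hM, smul_zero]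

theorem slice_symmetric {T : ι → ι → ζ → F} (h : ∀ x y, bil T x y = bil T y x) {M : Matrix ι ι F}
    (hM : M ∈ Submodule.span F (Set.range (slice T))) : M.IsSymm := by
  induction hM using Submodule.span_induction with
  | mem M hM =>
    obtain ⟨k, rfl⟩ := hM
    ext i j
    have := congrFun (h (Pi.single j 1) (Pi.single i 1)) k
    rw [bil_single, bil_single] at this
    exact this
  | zero => exact Matrix.isSymm_zero
  | add M N _ _ hM hN => exact hM.add hN
  | smul c M _ hM => exact hM.smul c

end MatrixSpaces

/-! ### Reductions to isometry of matrix spaces and to isomorphism of algebras -/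

section Reductions
variable {F : Type u} [Field F]

/-- The numbering of the first index set of the core array. -/
abbrev numU (ℓ : ℕ) : Unit ⊕ Fin ℓ ≃ Fin (1 + ℓ) := sumE unitE (Equiv.refl _)

/-- The numbering of the index set of the space `S`. -/
abbrev numS (ℓ m : ℕ) : Fin m ⊕ Fin (ℓ + 2) ≃ Fin (m + (ℓ + 2)) :=
  sumE (Equiv.refl _) (Equiv.refl _)

/-- The numbering of the second index set of the core array. -/
abbrev numY (ℓ n m : ℕ) : Fin n ⊕ (Fin m ⊕ Fin (ℓ + 2)) ≃ Fin (n + (m + (ℓ + 2))) :=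
  sumE (Equiv.refl _) (numS ℓ m)

/-- The numbering of the third index set of the core array. -/
abbrev numZ (ℓ m : ℕ) : (Unit ⊕ Fin ℓ) × (Fin m ⊕ Fin (ℓ + 2)) ≃ Fin ((1 + ℓ) * (m + (ℓ + 2))) :=
  prodE (numU ℓ) (numS ℓ m)

/-- The numbering of the index set of the symmetrized core array. -/
abbrev numE (ℓ n m : ℕ) : (Unit ⊕ Fin ℓ) ⊕ (Fin n ⊕ (Fin m ⊕ Fin (ℓ + 2))) ≃
    Fin ((1 + ℓ) + (n + (m + (ℓ + 2)))) :=
  sumE (numU ℓ) (numY ℓ n m)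

/-- The symmetrized core array, with numbered index sets. -/
def symCore (ε : F) {ℓ n m : ℕ} (A : Arr F ℓ n m) :
    Arr F ((1 + ℓ) + (n + (m + (ℓ + 2)))) ((1 + ℓ) + (n + (m + (ℓ + 2))))
      ((1 + ℓ) * (m + (ℓ + 2))) :=
  ren (numE ℓ n m) (numE ℓ n m) (numZ ℓ m) (sym ε (core A))

/-- The entries of the core array of the input. -/
def coreInputExpr : NatExpr → NatExpr → NatExpr → FieldExpr F :=
  coreExpr (.var 1) (.var 2) (.var 0 + 2) inputExpr

theorem computes_coreInput {ℓ n m : ℕ} (A : Arr F ℓ n m) {ρ : ℕ → ℕ} (hρ : IsEnv ℓ n m ρ) :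
    Computes ρ (fun t => A.toList.getD t 0) coreInputExpr (numU ℓ) (numY ℓ n m) (numZ ℓ m)
      (core A) :=
  computes_core (computes_input A hρ) hρ.h1 hρ.h2 (by
    rw [NatExpr.eval_add, NatExpr.eval_two]
    exact congrArg (· + 2) hρ.h0)

/-- The entries of the symmetrized core array of the input. -/
def symCoreExpr (ε : F) : NatExpr → NatExpr → NatExpr → FieldExpr F :=
  symExpr ε (1 + .var 0) coreInputExpr

theorem computes_symCore (ε : F) {ℓ n m : ℕ} (A : Arr F ℓ n m) {ρ : ℕ → ℕ} (hρ : IsEnv ℓ n m ρ) :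
    Computes ρ (fun t => A.toList.getD t 0) (symCoreExpr ε) (numE ℓ n m) (numE ℓ n m) (numZ ℓ m)
      (sym ε (core A)) :=
  computes_sym ε (computes_coreInput A hρ) (by
    rw [NatExpr.eval_add, NatExpr.eval_one]
    exact congrArg (1 + ·) hρ.h0)

/-- The dimension of the source of the symmetrized core array. -/
def dimE : NatExpr := (1 + .var 0) + (.var 1 + (.var 2 + (.var 0 + 2)))

/-- The dimension of the target of the core array. -/
def dimZ : NatExpr := (1 + .var 0) * (.var 2 + (.var 0 + 2))

theorem eval_dimE {ℓ n m : ℕ} {ρ : ℕ → ℕ} (hρ : IsEnv ℓ n m ρ) :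
    dimE.eval ρ = (1 + ℓ) + (n + (m + (ℓ + 2))) := by
  have h0 : ρ ((0 : Fin 20) : ℕ) = ℓ := hρ.h0
  have h1 : ρ ((1 : Fin 20) : ℕ) = n := hρ.h1
  have h2 : ρ ((2 : Fin 20) : ℕ) = m := hρ.h2
  simp only [dimE, NatExpr.eval_add, NatExpr.eval_var, NatExpr.eval_one, NatExpr.eval_two, h0, h1,
    h2]

theorem eval_dimZ {ℓ n m : ℕ} {ρ : ℕ → ℕ} (hρ : IsEnv ℓ n m ρ) :
    dimZ.eval ρ = (1 + ℓ) * (m + (ℓ + 2)) := by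
  have h0 : ρ ((0 : Fin 20) : ℕ) = ℓ := hρ.h0
  have h2 : ρ ((2 : Fin 20) : ℕ) = m := hρ.h2
  simp only [dimZ, NatExpr.eval_add, NatExpr.eval_mul, NatExpr.eval_var, NatExpr.eval_one,
    NatExpr.eval_two, h0, h2]

theorem exists_trans_symCore_iff (ε : F) {ℓ n m : ℕ} (A B : Arr F ℓ n m) :
    (∃ (P : GL (Fin ℓ) F) (Q : GL (Fin n) F) (R : GL (Fin m) F), trans A P.1 Q.1 R.1 = B) ↔
      ∃ (P : GL _ F) (R : GL _ F), trans (symCore ε A) P.1 P.1 R.1 = symCore ε B := by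
  rw [symCore, symCore, exists_trans_ren_iff]
  exact ⟨exists_trans_sym_core ε, fun h => exists_gl_of_bilIso (by simp) (bilIso_of_trans h)⟩

theorem symCore_eq_single (ε : F) {ℓ n m : ℕ} (A : Arr F ℓ n m) (z) :
    ∃ i j, symCore ε A i j = Pi.single z 1 := by
  obtain ⟨i, j, h⟩ := exists_sym_core_eq_single ε A ((numZ ℓ m).symm z)
  refine ⟨numE ℓ n m i, numE ℓ n m j, funext fun k => ?_⟩
  simp only [symCore, ren, Equiv.symm_apply_apply, h, Pi.single_apply, Equiv.apply_eq_iff_eq]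

theorem reduces_isometry {sz : F → ℕ} (hsz : IsSizeMeasure sz) (ε : F)
    (V : ∀ {f : ℕ × ℕ}, MatrixBasis F f.1 f.2 → Prop)
    (hV : ∀ {ℓ n m : ℕ} (A : Arr F ℓ n m),
      V (f := (_, _)) ⟨slice (symCore ε A), linearIndependent_slice (symCore_eq_single ε A)⟩) :
    PolyTimeReduces sz (tensorIso F) ((matrixSpaceIsometry F).restrict V) := by
  refine reduces_of_expr hsz dimZ dimE dimE (symCoreExpr ε (.var 4) (.var 5) (.var 3)) _ _ _
    (fun ℓ n m ρ hρ => ⟨eval_dimZ hρ, eval_dimE hρ, eval_dimE hρ⟩)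
    (fun A k i j => symCore ε A i j k) ?_ ?_
  · intro ℓ n m A ρ hρ k i j hk hi hj
    exact computes_symCore ε A hρ _ _ _ _ _ _ (by simpa using hi) (by simpa using hj)
      (by simpa using hk)
  · intro ℓ n m A B
    refine ⟨(_, _), ⟨_, hV A⟩, ⟨_, hV B⟩, .inr rfl, rfl, rfl, ?_⟩
    rw [tensorIso_iff, exists_trans_symCore_iff ε]
    exact (exists_isometry_iff (symCore ε A) (symCore ε B)).symm

theorem reduces_alternatingIsometry {sz : F → ℕ} (hsz : IsSizeMeasure sz) :
    PolyTimeReduces sz (tensorIso F) (alternatingIsometry F) := by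
  refine reduces_isometry hsz (-1) _ fun A M hM v => ?_
  refine slice_alternating (fun x => ?_) hM v
  rw [symCore, bil_ren, sym_self]
  rfl

theorem reduces_symmetricIsometry {sz : F → ℕ} (hsz : IsSizeMeasure sz) :
    PolyTimeReduces sz (tensorIso F) (symmetricIsometry F) := by
  refine reduces_isometry hsz 1 _ fun A M hM => ?_
  refine slice_symmetric (fun x y => ?_) hM
  rw [symCore, bil_ren, bil_ren, sym_comm]

/-- The nilpotent algebra of the symmetrized core array. -/
abbrev coreAlg (ε : F) {ℓ n m : ℕ} (A : Arr F ℓ n m) := nilAlg (sym ε (core (X := Fin (ℓ + 2)) A))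

/-- The numbering of the basis of the nilpotent algebra. -/
abbrev numEZ (ℓ n m : ℕ) := sumE (numE ℓ n m) (numZ ℓ m)

theorem computes_coreAlg (ε : F) {ℓ n m : ℕ} (A : Arr F ℓ n m) {ρ : ℕ → ℕ} (hρ : IsEnv ℓ n m ρ) :
    Computes ρ (fun t => A.toList.getD t 0) (nilExpr dimE (symCoreExpr ε)) (numEZ ℓ n m)
      (numEZ ℓ n m) (numEZ ℓ n m) (coreAlg ε A) :=
  computes_nil (computes_symCore ε A hρ) (eval_dimE hρ)

theorem exists_trans_iff_algIso_coreAlg (ε : F) {ℓ n m : ℕ} (A B : Arr F ℓ n m) :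
    (∃ (P : GL (Fin ℓ) F) (Q : GL (Fin n) F) (R : GL (Fin m) F), trans A P.1 Q.1 R.1 = B) ↔
      AlgIso (coreAlg ε A) (coreAlg ε B) :=
  ⟨fun h => algIso_nilAlg (bilIso_of_trans (exists_trans_sym_core ε h)),
    fun h => exists_gl_of_bilIso (by simp) (bilIso_of_algIso_nilAlg
      (exists_sym_core_eq_single ε A) (exists_sym_core_eq_single ε B) h)⟩

theorem reduces_nilpotent {sz : F → ℕ} (hsz : IsSizeMeasure sz) (ε : F)
    (V : ∀ {n : ℕ}, Arr F n n n → Prop)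
    (hV : ∀ {ℓ n m : ℕ} (A : Arr F ℓ n m),
      V (ren (numEZ ℓ n m) (numEZ ℓ n m) (numEZ ℓ n m) (coreAlg ε A))) :
    PolyTimeReduces sz (tensorIso F) ((algebraIso F).restrict V) := by
  refine reduces_of_expr hsz (dimE + dimZ) (dimE + dimZ) (dimE + dimZ)
    (nilExpr dimE (symCoreExpr ε) (.var 3) (.var 4) (.var 5)) _ _ _
    (fun ℓ n m ρ hρ => ?_)
    (fun {ℓ n m} A => ren (numEZ ℓ n m) (numEZ ℓ n m) (numEZ ℓ n m) (coreAlg ε A)) ?_ ?_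
  · rw [NatExpr.eval_add, eval_dimE hρ, eval_dimZ hρ]
    exact ⟨rfl, rfl, rfl⟩
  · intro ℓ n m A ρ hρ i j k hi hj hk
    exact (computes_coreAlg ε A hρ).eval_eq i j k hi hj hk
  · intro ℓ n m A B
    refine ⟨_, ⟨_, hV A⟩, ⟨_, hV B⟩, .inl rfl, rfl, rfl, ?_⟩
    rw [tensorIso_iff, exists_trans_iff_algIso_coreAlg ε]
    exact (algIso_ren_iff (numEZ ℓ n m) _ _).symm

theorem ren_mul_eq {κ : Type*} [Fintype κ] {a : ℕ} (e : κ ≃ Fin a) (N : κ → κ → κ → F)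
    (x y : Fin a → F) : algMul (ren e e e N) x y = bil N (x ∘ e) (y ∘ e) ∘ e.symm :=
  bil_ren e e e N x y

theorem ren_mul_comp {κ : Type*} [Fintype κ] {a : ℕ} (e : κ ≃ Fin a) (N : κ → κ → κ → F)
    (x y : Fin a → F) : algMul (ren e e e N) x y ∘ e = bil N (x ∘ e) (y ∘ e) := by
  rw [ren_mul_eq]
  funext k
  simp

theorem reduces_nilpotentLie {sz : F → ℕ} (hsz : IsSizeMeasure sz) :
    PolyTimeReduces sz (tensorIso F) (nilpotentLieAlgebraIso F) := by
  refine reduces_nilpotent hsz (-1) (fun A => IsLieAlg A ∧ IsTwoStepNilpotent A) fun {ℓ n m} A => ?_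
  have h : ∀ x y z, algMul (ren (numEZ ℓ n m) (numEZ ℓ n m) (numEZ ℓ n m) (coreAlg (-1) A)) x
      (algMul (ren (numEZ ℓ n m) (numEZ ℓ n m) (numEZ ℓ n m) (coreAlg (-1) A)) y z) = 0 := by
    intro x y z
    rw [ren_mul_eq, ren_mul_comp, (nilAlg_mul_mul _ _ _ _).2]
    rfl
  refine ⟨⟨fun x => ?_, fun x y z => ?_⟩, h⟩
  · rw [ren_mul_eq, nilAlg_self sym_self]
    rfl
  · rw [h, h, h, add_zero, add_zero]

theorem reduces_commNilpotent {sz : F → ℕ} (hsz : IsSizeMeasure sz) :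
    PolyTimeReduces sz (tensorIso F) (commNilpotentAlgebraIso F) := by
  refine reduces_nilpotent hsz 1
    (fun A => IsAssocAlg A ∧ IsCommAlg A ∧ IsThreeNilpotentAlg A) fun {ℓ n m} A => ?_
  have h : IsThreeNilpotentAlg (ren (numEZ ℓ n m) (numEZ ℓ n m) (numEZ ℓ n m) (coreAlg 1 A)) := by
    intro x y z
    constructor
    · rw [ren_mul_eq, ren_mul_comp, (nilAlg_mul_mul _ _ _ _).1]
      rfl
    · rw [ren_mul_eq, ren_mul_comp, (nilAlg_mul_mul _ _ _ _).2]
      rfl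
  refine ⟨fun x y z => by rw [(h x y z).1, (h x y z).2], fun x y => ?_, h⟩
  rw [ren_mul_eq, ren_mul_eq, nilAlg_comm sym_comm]

theorem reduces_commUnital {sz : F → ℕ} (hsz : IsSizeMeasure sz) :
    PolyTimeReduces sz (tensorIso F) (commUnitalAlgebraIso F) := by
  have hV : ∀ {ℓ n m a : ℕ} (A : Arr F ℓ n m) (e : Unit ⊕ _ ≃ Fin a),
      IsAssocAlg (ren e e e (unitAlg (coreAlg 1 A))) ∧
      IsCommAlg (ren e e e (unitAlg (coreAlg 1 A))) ∧
      IsUnitalAlg (ren e e e (unitAlg (coreAlg 1 A))) := by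
    intro ℓ n m a A e
    refine ⟨fun x y z => ?_, fun x y => ?_, Pi.single (.inl ()) 1 ∘ e.symm, fun x => ?_⟩
    · rw [ren_mul_eq, ren_mul_comp, ren_mul_eq, ren_mul_comp, unitAlg_assoc]
      intro x y z
      rw [(nilAlg_mul_mul _ _ _ _).1, (nilAlg_mul_mul _ _ _ _).2]
    · rw [ren_mul_eq, ren_mul_eq, unitAlg_comm (nilAlg_comm sym_comm)]
    · rw [ren_mul_eq, ren_mul_eq, Function.comp_assoc, Equiv.symm_comp_self, Function.comp_id,
        (unitAlg_one _ _).1, (unitAlg_one _ _).2, Function.comp_assoc, Equiv.self_comp_symm,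
        Function.comp_id]
      exact ⟨rfl, rfl⟩
  refine reduces_of_expr hsz (1 + (dimE + dimZ)) (1 + (dimE + dimZ)) (1 + (dimE + dimZ))
    (unitExpr (nilExpr dimE (symCoreExpr 1)) (.var 3) (.var 4) (.var 5)) _ _ _
    (fun ℓ n m ρ hρ => ?_)
    (fun {ℓ n m} A => ren (sumE unitE (numEZ ℓ n m)) (sumE unitE (numEZ ℓ n m))
      (sumE unitE (numEZ ℓ n m)) (unitAlg (coreAlg 1 A))) ?_ ?_
  · rw [NatExpr.eval_add, NatExpr.eval_add, eval_dimE hρ, eval_dimZ hρ, NatExpr.eval_one]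
    exact ⟨rfl, rfl, rfl⟩
  · intro ℓ n m A ρ hρ i j k hi hj hk
    exact (computes_unit (computes_coreAlg 1 A hρ)).eval_eq i j k hi hj hk
  · intro ℓ n m A B
    refine ⟨_, ⟨_, hV A _⟩, ⟨_, hV B _⟩, .inl rfl, rfl, rfl, ?_⟩
    rw [tensorIso_iff, exists_trans_iff_algIso_coreAlg 1]
    have h3 : ∀ {A : Arr F ℓ n m} (x), bil (coreAlg 1 A) x (bil (coreAlg 1 A) x x) = 0 :=
      fun x => (nilAlg_mul_mul _ x x x).2
    refine Iff.trans ⟨algIso_unitAlg, algIso_of_unitAlg h3 h3⟩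
      (algIso_ren_iff (sumE unitE (numEZ ℓ n m)) _ _).symm

end Reductions

/-! ### Algebras generated by an idempotent and a square-zero space -/

section Peirce
variable {F : Type u} [Field F] {R : Type u} [Ring R] [Algebra F R]

/-- An idempotent `e` and a nonzero space `J` of elements `x` with `e * x = x` and `x * e = 0`, such
that the product of any two elements of `J` is zero.  The sum of `F * e` and `J` is then closed
under multiplication. -/
structure IsPeirce (e : R) (J : Submodule F R) : Prop where
  idem : e * e = e
  left : ∀ x ∈ J, e * x = x
  right : ∀ x ∈ J, x * e = 0
  square : ∀ x ∈ J, ∀ y ∈ J, x * y = 0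
  ne_bot : J ≠ ⊥

variable {e : R} {J : Submodule F R}

theorem IsPeirce.notMem (h : IsPeirce e J) : e ∉ J := by
  intro he
  have h0 : e = 0 := by rw [← h.idem]; exact h.right e he
  refine h.ne_bot ((Submodule.eq_bot_iff _).2 fun x hx => ?_)
  rw [← h.left x hx, h0, zero_mul]

/-- The coordinate with respect to the idempotent. -/
theorem IsPeirce.exists_coord (h : IsPeirce e J) :
    ∃ f : R →ₗ[F] F, f e = 1 ∧ ∀ x ∈ J, f x = 0 := by
  obtain ⟨f, hf, hJ⟩ := Submodule.exists_le_ker_of_notMem h.notMem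
  refine ⟨(f e)⁻¹ • f, ?_, fun x hx => ?_⟩
  · simp [hf]
  · have : f x = 0 := hJ hx
    simp [this]

theorem mem_span_sup_iff {a : R} :
    a ∈ Submodule.span F {e} ⊔ J ↔ ∃ t : F, ∃ x ∈ J, a = t • e + x := by
  rw [Submodule.mem_sup]
  constructor
  · rintro ⟨y, hy, x, hx, rfl⟩
    obtain ⟨t, rfl⟩ := Submodule.mem_span_singleton.1 hy
    exact ⟨t, x, hx, rfl⟩
  · rintro ⟨t, x, hx, rfl⟩
    exact ⟨t • e, Submodule.mem_span_singleton.2 ⟨t, rfl⟩, x, hx, rfl⟩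

theorem IsPeirce.mul (h : IsPeirce e J) (t s : F) {x y : R} (hx : x ∈ J) (hy : y ∈ J) :
    (t • e + x) * (s • e + y) = (t * s) • e + t • y := by
  simp only [add_mul, mul_add, smul_mul_assoc, mul_smul_comm, h.idem, h.left y hy, h.right x hx,
    h.square x hx y hy, add_zero, smul_smul, mul_comm t s]

theorem IsPeirce.mul_mem (h : IsPeirce e J) {a b : R} (ha : a ∈ Submodule.span F {e} ⊔ J)
    (hb : b ∈ Submodule.span F {e} ⊔ J) : a * b ∈ Submodule.span F {e} ⊔ J := by
  obtain ⟨t, x, hx, rfl⟩ := mem_span_sup_iff.1 ha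
  obtain ⟨s, y, hy, rfl⟩ := mem_span_sup_iff.1 hb
  exact mem_span_sup_iff.2 ⟨t * s, t • y, J.smul_mem t hy, h.mul t s hx hy⟩

theorem IsPeirce.eq_coord {f : R →ₗ[F] F} (he : f e = 1) (hf : ∀ x ∈ J, f x = 0) {a : R}
    (ha : a ∈ Submodule.span F {e} ⊔ J) : ∃ x ∈ J, a = f a • e + x := by
  obtain ⟨t, x, hx, rfl⟩ := mem_span_sup_iff.1 ha
  refine ⟨x, hx, ?_⟩
  simp [he, hf x hx]

theorem IsPeirce.coord_mul (h : IsPeirce e J) {f : R →ₗ[F] F} (he : f e = 1)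
    (hf : ∀ x ∈ J, f x = 0) {a b : R} (ha : a ∈ Submodule.span F {e} ⊔ J)
    (hb : b ∈ Submodule.span F {e} ⊔ J) : f (a * b) = f a * f b := by
  obtain ⟨t, x, hx, rfl⟩ := mem_span_sup_iff.1 ha
  obtain ⟨s, y, hy, rfl⟩ := mem_span_sup_iff.1 hb
  rw [h.mul t s hx hy]
  simp [he, hf x hx, hf y hy]

/-- As an associative algebra, the sum of `F * e` and `J` has the Jacobson radical `J`: this is the
kernel of the coordinate with respect to the idempotent, which is multiplicative. -/
theorem IsPeirce.assoc (h : IsPeirce e J) :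
    ∃ S : NonUnitalSubalgebra F R, S.toSubmodule = Submodule.span F {e} ⊔ J ∧
      (∀ a ∈ jacobsonRadical S, ∀ b ∈ jacobsonRadical S, a * b = 0) ∧
      ∃ φ : S →ₙₐ[F] F, Function.Surjective φ ∧ ∀ a : S, φ a = 0 ↔ a ∈ jacobsonRadical S := by
  obtain ⟨f, he, hf⟩ := h.exists_coord
  let S : NonUnitalSubalgebra F R :=
    { (Submodule.span F {e} ⊔ J) with mul_mem' := fun ha hb => h.mul_mem ha hb }
  have hmem : ∀ {a : R}, a ∈ S ↔ a ∈ Submodule.span F {e} ⊔ J := Iff.rfl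
  have heS : e ∈ S := hmem.2 (mem_span_sup_iff.2 ⟨1, 0, J.zero_mem, by simp⟩)
  have hsm : ∀ t : F, t • e ∈ S := fun t => mem_span_sup_iff.2 ⟨t, 0, J.zero_mem, by simp⟩
  have hrad : ∀ a : S, f a = 0 ↔ a ∈ jacobsonRadical S := by
    rintro ⟨a, ha⟩
    constructor
    · intro h0 b
      have hba : f (b.1 * a) = 0 := by
        rw [h.coord_mul he hf b.2 ha, show f a = 0 from h0, mul_zero]
      obtain ⟨x, hx, hx'⟩ := IsPeirce.eq_coord he hf (h.mul_mem b.2 ha)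
      rw [hba, zero_smul, zero_add] at hx'
      refine ⟨-(b * ⟨a, ha⟩), ?_⟩
      rw [neg_add_cancel]
      ext
      change (0 : R) = -(b.1 * a) * (b.1 * a)
      rw [hx', neg_mul, h.square x hx x hx, neg_zero]
    · intro hr
      by_contra h0
      -- a multiple of `e` times `a` has coordinate `1`
      obtain ⟨c, hc⟩ := hr ⟨(f a)⁻¹ • e, hsm _⟩
      have h1 : f (((f a)⁻¹ • e) * a) = 1 := by
        rw [h.coord_mul he hf (hsm _) ha, map_smul, he, smul_eq_mul, mul_one]
        exact inv_mul_cancel₀ h0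
      have h2 := congrArg (fun z : S => f z) hc
      have h3 : f (c.1 + ((f a)⁻¹ • e) * a) = f (c.1 * (((f a)⁻¹ • e) * a)) := h2
      rw [map_add, h.coord_mul he hf c.2 (h.mul_mem (hsm _) ha), h1, mul_one] at h3
      simp at h3
  refine ⟨S, rfl, fun a ha b hb => ?_, ?_⟩
  · obtain ⟨x, hx, hx'⟩ := IsPeirce.eq_coord he hf a.2
    obtain ⟨y, hy, hy'⟩ := IsPeirce.eq_coord he hf b.2
    rw [(hrad a).2 ha, zero_smul, zero_add] at hx'
    rw [(hrad b).2 hb, zero_smul, zero_add] at hy'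
    ext
    change a.1 * b.1 = 0
    rw [hx', hy', h.square x hx y hy]
  · refine ⟨{ toFun := fun a => f a
              map_smul' := fun c a => f.map_smul c a
              map_zero' := f.map_zero
              map_add' := fun a b => f.map_add a b
              map_mul' := fun a b => h.coord_mul he hf a.2 b.2 }, fun t => ?_, hrad⟩
    refine ⟨⟨t • e, hsm t⟩, ?_⟩
    change f (t • e) = t
    rw [map_smul, he, smul_eq_mul, mul_one]

attribute [local instance 100] LieRing.ofAssociativeRing

/-- As a Lie algebra, the sum of `F * e` and `J` has the derived algebra `J`, which is abelian and
nonzero and has the quotient `F`. -/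
theorem IsPeirce.lie (h : IsPeirce e J) :
    ∃ L : LieSubalgebra F R, L.toSubmodule = Submodule.span F {e} ⊔ J ∧
      LieAlgebra.IsSolvable L ∧ LieAlgebra.derivedLength F L = 2 ∧
      Nonempty ((L ⧸ LieAlgebra.derivedSeries F L 1) ≃ₗ⁅F⁆ F) := by
  obtain ⟨f, he, hf⟩ := h.exists_coord
  let L : LieSubalgebra F R :=
    { (Submodule.span F {e} ⊔ J) with
      lie_mem' := fun {a b} ha hb => by
        rw [LieRing.of_associative_ring_bracket]
        exact Submodule.sub_mem _ (h.mul_mem ha hb) (h.mul_mem hb ha) }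
  have heL : e ∈ L := mem_span_sup_iff.2 ⟨1, 0, J.zero_mem, by simp⟩
  have hJL : ∀ x ∈ J, x ∈ L := fun x hx => mem_span_sup_iff.2 ⟨0, x, hx, by simp⟩
  let φ : L →ₗ⁅F⁆ F :=
    { toFun := fun a => f a
      map_add' := fun a b => f.map_add a b
      map_smul' := fun c a => f.map_smul c a
      map_lie' := fun {a b} => by
        rw [LieSubalgebra.coe_bracket, LieRing.of_associative_ring_bracket,
          LieRing.of_associative_ring_bracket, map_sub, h.coord_mul he hf a.2 b.2,
          h.coord_mul he hf b.2 a.2] }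
  have hφ : Function.Surjective φ := fun t => ⟨⟨t • e, L.smul_mem t heL⟩, by
    change f (t • e) = t
    rw [map_smul, he, smul_eq_mul, mul_one]⟩
  have hmem : ∀ a : L, a ∈ φ.ker ↔ a.1 ∈ J := by
    intro a
    rw [LieHom.mem_ker]
    change f a = 0 ↔ _
    refine ⟨fun h0 => ?_, hf _⟩
    obtain ⟨x, hx, hx'⟩ := IsPeirce.eq_coord he hf a.2
    rw [h0, zero_smul, zero_add] at hx'
    rwa [hx']
  have hD : LieAlgebra.derivedSeries F L 1 = φ.ker := by
    rw [LieAlgebra.derivedSeries_def, LieAlgebra.derivedSeriesOfIdeal_succ,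
      LieAlgebra.derivedSeriesOfIdeal_zero]
    apply le_antisymm
    · rw [LieSubmodule.lie_le_iff]
      intro a _ b _
      rw [LieHom.mem_ker, LieHom.map_lie, LieRing.of_associative_ring_bracket, mul_comm, sub_self]
    · intro a ha
      have ha' := (hmem a).1 ha
      -- an element `x` of `J` is the commutator of `e` and `x`
      have : a = ⁅(⟨e, heL⟩ : L), a⁆ := by
        ext
        rw [LieSubalgebra.coe_bracket, LieRing.of_associative_ring_bracket, h.left _ ha',
          h.right _ ha', sub_zero]
      rw [this]
      exact LieSubmodule.lie_mem_lie (LieSubmodule.mem_top _) (LieSubmodule.mem_top _)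
  have hlen : LieAlgebra.derivedLength F L = 2 := by
    rw [LieAlgebra.derivedSeries_of_derivedLength_succ, ← LieAlgebra.derivedSeries_def, hD]
    constructor
    · refine ⟨fun a b => ?_⟩
      ext
      change ⁅a.1.1, b.1.1⁆ = 0
      rw [LieRing.of_associative_ring_bracket,
        h.square _ ((hmem _).1 a.2) _ ((hmem _).1 b.2),
        h.square _ ((hmem _).1 b.2) _ ((hmem _).1 a.2), sub_zero]
    · intro h0
      refine h.ne_bot ((Submodule.eq_bot_iff _).2 fun x hx => ?_)
      have : (⟨x, hJL x hx⟩ : L) ∈ φ.ker := (hmem _).2 hx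
      rw [h0, LieSubmodule.mem_bot] at this
      exact congrArg Subtype.val this
  have hsol : LieAlgebra.IsSolvable L := by
    refine LieAlgebra.IsSolvable.mk (R := F) (k := 2) ?_
    have := (LieAlgebra.derivedSeries_of_derivedLength_succ F L ⊤ 1).1 hlen
    exact (LieAlgebra.abelian_iff_derived_succ_eq_bot ⊤ 1).1 this.1
  refine ⟨L, rfl, hsol, hlen, ?_⟩
  rw [hD]
  refine ⟨φ.quotKerEquivRange.trans ?_⟩
  have hr : φ.range = ⊤ := (LieHom.range_eq_top φ).2 hφ
  rw [hr]
  exact LieSubalgebra.topEquiv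

end Peirce

/-! ### Conjugacy of matrix spaces -/

section Conjugacy
variable {F : Type u} [Field F] {ι κ ζ : Type*} [Fintype ι] [Fintype κ] [Fintype ζ]
  [DecidableEq ι] [DecidableEq κ] [DecidableEq ζ]

/-- The array whose slices are the block matrices with upper left block the identity, or with upper
right block a slice of `T`, all other blocks being zero. -/
def conjArr (T : ι → κ → ζ → F) : ι ⊕ κ → ι ⊕ κ → Unit ⊕ ζ → F
  | .inl i, .inl j, .inl _ => if i = j then 1 else 0
  | .inl _, .inl _, .inr _ => 0
  | .inl _, .inr _, .inl _ => 0
  | .inl i, .inr j, .inr z => T i j z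
  | .inr _, _, _ => 0

theorem slice_conjArr_inl (T : ι → κ → ζ → F) (u : Unit) :
    slice (conjArr T) (.inl u) = Matrix.fromBlocks 1 0 0 0 := by
  ext i j
  rcases i with i | i <;> rcases j with j | j <;> simp [slice, conjArr, Matrix.one_apply]

theorem slice_conjArr_inr (T : ι → κ → ζ → F) (z : ζ) :
    slice (conjArr T) (.inr z) = Matrix.fromBlocks 0 (slice T z) 0 0 := by
  ext i j
  rcases i with i | i <;> rcases j with j | j <;> simp [slice, conjArr]

/-- Isomorphism of arrays under conjugation of their slices. -/
def ConjIso (S T : ι → ι → ζ → F) : Prop :=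
  ∃ (P : GL ι F) (R : GL ζ F), trans S P.1.transpose P⁻¹.1 R.1 = T

theorem exists_conj_iff (S T : ι → ι → ζ → F) :
    (∃ P : GL ι F, (fun M => P.1 * M * P⁻¹.1) ''
        (Submodule.span F (Set.range (slice S)) : Set (Matrix ι ι F)) =
          (Submodule.span F (Set.range (slice T)) : Set (Matrix ι ι F))) ↔ ConjIso S T := by
  refine exists_congr fun P => ?_
  refine (image_span_eq_iff ((LinearMap.mulRight F P⁻¹.1) ∘ₗ (LinearMap.mulLeft F P.1))
    (slice S) (slice T)).trans (exists_congr fun R => ?_)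
  simp only [LinearMap.comp_apply, LinearMap.mulRight_apply, LinearMap.mulLeft_apply,
    mul_slice_mul]
  constructor
  · intro h
    funext i j k
    exact congrFun₂ (h k) i j
  · rintro h k
    rw [h]

theorem conjIso_ren_iff {a c : ℕ} (e : ι ≃ Fin a) (e' : ζ ≃ Fin c) (S T : ι → ι → ζ → F) :
    ConjIso (ren e e e' S) (ren e e e' T) ↔ ConjIso S T := by
  constructor
  · rintro ⟨P, R, h⟩
    rw [trans_ren] at h
    exact ⟨glReindex e.symm P, glReindex e'.symm R, ren_injective _ _ _ h⟩
  · rintro ⟨P, R, h⟩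
    refine ⟨glReindex e P, glReindex e' R, ?_⟩
    rw [trans_ren, ← h]
    have h1 : (glReindex e P)⁻¹.1 = P⁻¹.1.submatrix e.symm e.symm := rfl
    rw [h1]
    simp [glReindex, Matrix.submatrix_submatrix]

theorem mem_span_conjArr {T : ι → κ → ζ → F} {M : Matrix (ι ⊕ κ) (ι ⊕ κ) F} :
    M ∈ Submodule.span F (Set.range (slice (conjArr T))) ↔
      ∃ t : F, ∃ X ∈ Submodule.span F (Set.range (slice T)),
        M = Matrix.fromBlocks (t • 1) X 0 0 := by
  rw [Submodule.mem_span_range_iff_exists_fun]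
  simp only [Submodule.mem_span_range_iff_exists_fun]
  have e : ∀ c : Unit ⊕ ζ → F, ∑ i, c i • slice (conjArr T) i =
      Matrix.fromBlocks (c (.inl ()) • 1) (∑ z, c (.inr z) • slice T z) 0 0 := by
    intro c
    rw [Fintype.sum_sum_type]
    simp only [slice_conjArr_inl, slice_conjArr_inr, Finset.univ_unique, Finset.sum_singleton,
      Matrix.fromBlocks_smul, smul_zero]
    ext i j
    rcases i with i | i <;> rcases j with j | j <;>
      simp [Matrix.sum_apply]
  constructor
  · rintro ⟨c, rfl⟩
    exact ⟨c (.inl ()), _, ⟨fun z => c (.inr z), rfl⟩, e c⟩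
  · rintro ⟨t, _, ⟨c, rfl⟩, rfl⟩
    exact ⟨Sum.elim (fun _ => t) c, e _⟩

open Matrix in
theorem conjIso_conjArr {S T : ι → κ → ζ → F}
    (h : ∃ (P : GL ι F) (Q : GL κ F) (R : GL ζ F), trans S P.1 Q.1 R.1 = T) :
    ConjIso (conjArr S) (conjArr T) := by
  obtain ⟨P, Q, R, rfl⟩ := h
  refine ⟨glBlock (glDual P⁻¹) Q⁻¹, glBlock 1 R, ?_⟩
  have h1 : (glBlock (glDual P⁻¹) Q⁻¹).1.transpose = fromBlocks P.1 0 0 Q⁻¹.1.transpose := by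
    simp [glBlock, glDual, fromBlocks_transpose]
  have h2 : (glBlock (glDual P⁻¹) Q⁻¹)⁻¹.1 = fromBlocks (P⁻¹.1ᵀ) 0 0 Q.1 := by
    change fromBlocks _ 0 0 _ = _
    rw [inv_inv]
    rfl
  have h3 : ∀ i j, ∑ x, P.1 x i * P⁻¹.1 j x = if i = j then 1 else 0 := by
    intro i j
    have : (P⁻¹.1 * P.1) j i = (1 : Matrix _ _ F) j i := by
      rw [← Units.val_mul, inv_mul_cancel]; rfl
    rw [Matrix.mul_apply, Matrix.one_apply] at this
    simp only [eq_comm (a := i)]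
    rw [← this]
    exact Finset.sum_congr rfl fun _ _ => mul_comm _ _
  rw [h1, h2]
  funext i j k
  rcases i with i | i <;> rcases j with j | j <;> rcases k with k | k <;>
    simp [trans, conjArr, glBlock, Fintype.sum_sum_type, ite_mul]
  simpa using h3 i j

/-- A conjugation of the algebras generated by two arrays is block triangular, and restricts to an
equivalence of the spaces of their square-zero elements.  The hypothesis on `S` says that every unit
vector is a column of some slice. -/
theorem exists_trans_of_conjIso [Nonempty ι] {S T : ι → κ → ζ → F}
    (hS : ∀ i, ∃ z j, ∀ i', S i' j z = if i' = i then 1 else 0)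
    (h : ConjIso (conjArr S) (conjArr T)) :
    ∃ (P : GL ι F) (Q : GL κ F) (R : GL ζ F), trans S P.1 Q.1 R.1 = T := by
  rw [← exists_conj_iff] at h
  obtain ⟨P, h⟩ := h
  obtain ⟨a, b, c, d, hP⟩ : ∃ a b c d, P.1 = Matrix.fromBlocks a b c d :=
    ⟨_, _, _, _, (Matrix.fromBlocks_toBlocks P.1).symm⟩
  have hPinv : P⁻¹.1 * P.1 = 1 := by rw [← Units.val_mul, inv_mul_cancel]; rfl
  -- an element with vanishing square has vanishing upper left block
  have hsq : ∀ (t : F) (X : Matrix ι κ F),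
      (Matrix.fromBlocks (t • 1) X 0 0 : Matrix (ι ⊕ κ) (ι ⊕ κ) F) *
        Matrix.fromBlocks (t • 1) X 0 0 = 0 ↔ t = 0 := by
    intro t X
    rw [Matrix.fromBlocks_multiply]
    constructor
    · intro h0
      obtain ⟨i⟩ := ‹Nonempty ι›
      have := congrFun₂ h0 (.inl i) (.inl i)
      simpa using this
    · rintro rfl
      simp
  have hconj : ∀ M : Matrix (ι ⊕ κ) (ι ⊕ κ) F,
      (P.1 * M * P⁻¹.1) * (P.1 * M * P⁻¹.1) = 0 ↔ M * M = 0 := by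
    intro M
    have e : (P.1 * M * P⁻¹.1) * (P.1 * M * P⁻¹.1) = P.1 * (M * M) * P⁻¹.1 := by
      calc _ = P.1 * M * (P⁻¹.1 * P.1) * M * P⁻¹.1 := by simp only [Matrix.mul_assoc]
        _ = _ := by rw [hPinv, Matrix.mul_one]; simp only [Matrix.mul_assoc]
    rw [e]
    constructor
    · intro h0
      have h1 := congrArg (fun N => P⁻¹.1 * N * P.1) h0
      simp only [Matrix.mul_zero, Matrix.zero_mul] at h1
      calc M * M = (P⁻¹.1 * P.1) * (M * M) * (P⁻¹.1 * P.1) := by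
            rw [hPinv, Matrix.one_mul, Matrix.mul_one]
        _ = P⁻¹.1 * (P.1 * (M * M) * P⁻¹.1) * P.1 := by simp only [Matrix.mul_assoc]
        _ = 0 := h1
    · intro h0
      rw [h0, Matrix.mul_zero, Matrix.zero_mul]
  have hmul : ∀ M N : Matrix (ι ⊕ κ) (ι ⊕ κ) F, P.1 * M * P⁻¹.1 = N ↔ P.1 * M = N * P.1 := by
    intro M N
    constructor
    · rintro rfl
      rw [Matrix.mul_assoc, hPinv, Matrix.mul_one]
    · intro h0
      rw [h0, Matrix.mul_assoc, ← Units.val_mul, mul_inv_cancel]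
      exact Matrix.mul_one N
  have hblock : ∀ X Y : Matrix ι κ F, P.1 * Matrix.fromBlocks 0 X 0 0 =
      Matrix.fromBlocks 0 Y 0 0 * P.1 ↔
        (Y * c = 0 ∧ a * X = Y * d) ∧ c * X = 0 := by
    intro X Y
    rw [hP, Matrix.fromBlocks_multiply, Matrix.fromBlocks_multiply, Matrix.fromBlocks_inj]
    simp [eq_comm, and_assoc]
  have hfwd : ∀ X ∈ Submodule.span F (Set.range (slice S)),
      ∃ Y ∈ Submodule.span F (Set.range (slice T)), (Y * c = 0 ∧ a * X = Y * d) ∧ c * X = 0 := by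
    intro X hX
    have h1 : P.1 * Matrix.fromBlocks 0 X 0 0 * P⁻¹.1 ∈
        (Submodule.span F (Set.range (slice (conjArr T))) : Set _) := by
      rw [← h]
      exact ⟨_, mem_span_conjArr.2 ⟨0, X, hX, by rw [zero_smul]⟩, rfl⟩
    obtain ⟨t, Y, hY, hY'⟩ := mem_span_conjArr.1 h1
    have ht : t = 0 := by
      rw [← hsq t Y, ← hY', hconj]
      simp [Matrix.fromBlocks_multiply]
    refine ⟨Y, hY, (hblock X Y).1 ((hmul _ _).1 ?_)⟩
    rw [hY', ht, zero_smul]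
  have hbwd : ∀ Y ∈ Submodule.span F (Set.range (slice T)),
      ∃ X ∈ Submodule.span F (Set.range (slice S)), a * X = Y * d := by
    intro Y hY
    have h1 : Matrix.fromBlocks 0 Y 0 0 ∈
        (Submodule.span F (Set.range (slice (conjArr T))) : Set (Matrix (ι ⊕ κ) (ι ⊕ κ) F)) :=
      mem_span_conjArr.2 ⟨0, Y, hY, by rw [zero_smul]⟩
    rw [← h] at h1
    obtain ⟨M, hM, hM'⟩ := h1
    obtain ⟨t, X, hX, rfl⟩ := mem_span_conjArr.1 hM
    have ht : t = 0 := by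
      rw [← hsq t X, ← hconj]
      simp only at hM'
      rw [hM']
      simp [Matrix.fromBlocks_multiply]
    rw [ht, zero_smul] at hM'
    exact ⟨X, hX, ((hblock X Y).1 ((hmul _ _).1 hM')).1.2⟩
  -- `c` annihilates all slices of `S`, and the columns of these include the unit vectors
  have hc : c = 0 := by
    ext k i
    obtain ⟨z, j, hz⟩ := hS i
    obtain ⟨_, _, _, h0⟩ := hfwd (slice S z) (Submodule.subset_span ⟨z, rfl⟩)
    have := congrFun₂ h0 k j
    simpa [Matrix.mul_apply, slice, hz] using this
  have hdet : IsUnit (a.det * d.det) := by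
    have : IsUnit P.1.det := (Matrix.isUnit_iff_isUnit_det _).1 P.isUnit
    rwa [hP, hc, Matrix.det_fromBlocks_zero₂₁] at this
  let a' : GL ι F := Matrix.GeneralLinearGroup.mk'' a (isUnit_of_mul_isUnit_left hdet)
  let d' : GL κ F := Matrix.GeneralLinearGroup.mk'' d (isUnit_of_mul_isUnit_right hdet)
  have hd : d * d'⁻¹.1 = 1 := by
    change d'.1 * d'⁻¹.1 = 1
    rw [← Units.val_mul, mul_inv_cancel]; rfl
  let f : Matrix ι κ F →ₗ[F] Matrix ι κ F :=
    { toFun := fun X => a * X * d'⁻¹.1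
      map_add' := fun X Y => by rw [Matrix.mul_add, Matrix.add_mul]
      map_smul' := fun t X => by rw [Matrix.mul_smul, Matrix.smul_mul]; rfl }
  have himg : f '' (Submodule.span F (Set.range (slice S)) : Set (Matrix ι κ F)) =
      (Submodule.span F (Set.range (slice T)) : Set (Matrix ι κ F)) := by
    apply Set.Subset.antisymm
    · rintro _ ⟨X, hX, rfl⟩
      obtain ⟨Y, hY, ⟨_, h0⟩, _⟩ := hfwd X hX
      change a * X * d'⁻¹.1 ∈ _
      rw [h0, Matrix.mul_assoc, hd, Matrix.mul_one]
      exact hY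
    · intro Y hY
      obtain ⟨X, hX, h0⟩ := hbwd Y hY
      refine ⟨X, hX, ?_⟩
      change a * X * d'⁻¹.1 = Y
      rw [h0, Matrix.mul_assoc, hd, Matrix.mul_one]
  obtain ⟨R, hR⟩ := (image_span_eq_iff f _ _).1 himg
  refine ⟨glDual a'⁻¹, d'⁻¹, R, ?_⟩
  have ha : (glDual a'⁻¹).1 = a.transpose := by
    simp only [glDual, inv_inv]
    rfl
  rw [ha]
  funext i j k
  have h1 := hR k
  have h2 := mul_slice_mul S a d'⁻¹.1 R.1 k
  exact congrFun₂ (h2.symm.trans h1) i j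

end Conjugacy

/-! ### Reductions to conjugacy of matrix spaces -/

section ConjugacyReductions
variable {F : Type u} [Field F]

theorem exists_gl_of_trans_core {I J K X : Type*} [Fintype I] [Fintype J] [Fintype K] [Fintype X]
    [DecidableEq I] [DecidableEq J] [DecidableEq K] [DecidableEq X] {A B : I → J → K → F}
    (h : ∃ (P : GL (Unit ⊕ I) F) (Q : GL (J ⊕ (K ⊕ X)) F) (R : GL ((Unit ⊕ I) × (K ⊕ X)) F),
      trans (core A) P.1 Q.1 R.1 = core B) :
    ∃ (P : GL I F) (Q : GL J F) (R : GL K F), trans A P.1 Q.1 R.1 = B := by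
  obtain ⟨P, Q, R, h⟩ := h
  refine exists_gl_of_core (X := X) (p := (glMulVec P⁻¹).toAddEquiv)
    (q := (glMulVec Q⁻¹).toAddEquiv) (r := (glMulVec (glDual R)).symm.toAddEquiv) (fun u y => ?_)
    fun c z => (glMulVec (glDual R)).symm.map_smul c z
  change (glMulVec (glDual R)).symm _ = _
  rw [LinearEquiv.symm_apply_eq, ← trans_symm h, bil_trans]
  rfl

section
variable {ι κ ζ : Type*} {a b c : ℕ} {ρ : ℕ → ℕ} {x : ℕ → F}
  {g : NatExpr → NatExpr → NatExpr → FieldExpr F} [DecidableEq ι]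

/-- The entries of the array of block matrices. -/
def conjExpr (d : NatExpr) (g : NatExpr → NatExpr → NatExpr → FieldExpr F) (i j k : NatExpr) :
    FieldExpr F :=
  .ifLt i d (.ifLt k 1 (.ifEq i j (.const 1) (.const 0))
    (.ifLt j d (.const 0) (g i (j - d) (k - 1))))
    (.const 0)

theorem computes_conj {T : ι → κ → ζ → F} {e₁ : ι ≃ Fin a} {e₂ : κ ≃ Fin b} {e₃ : ζ ≃ Fin c}
    (hg : Computes ρ x g e₁ e₂ e₃ T) {d : NatExpr} (hd : d.eval ρ = a) :
    Computes ρ x (conjExpr d g) (sumE e₁ e₂) (sumE e₁ e₂) (sumE unitE e₃) (conjArr T) := by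
  intro i j k u v w hi hj hk
  simp only [conjExpr, FieldExpr.eval_ifLt, FieldExpr.eval_ifEq, FieldExpr.eval_const,
    NatExpr.eval_one, hd]
  rcases u with u | u
  · rw [sumE_inl] at hi
    rw [if_pos (by rw [hi]; exact (e₁ u).2)]
    rcases w with w | w
    · rw [if_pos (by rw [hk]; simp)]
      rcases v with v | v
      · rw [sumE_inl] at hj
        refine if_congr ?_ rfl rfl
        rw [hi, hj, Fin.val_inj, Equiv.apply_eq_iff_eq]
      · rw [sumE_inr] at hj
        have := (e₁ u).2
        rw [if_neg (by omega)]
        rfl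
    · rw [if_neg (by rw [hk]; simp)]
      rcases v with v | v
      · rw [sumE_inl] at hj
        rw [if_pos (by rw [hj]; exact (e₁ v).2)]
        rfl
      · rw [sumE_inr] at hj
        rw [if_neg (by omega)]
        exact hg _ _ _ _ _ _ hi (by simp [hd, hj]) (by simp [hk])
  · rw [sumE_inr] at hi
    rw [if_neg (by omega)]
    rfl

end

section
variable {ι κ ζ : Type*} [Fintype ι] [Fintype κ] [Fintype ζ] [DecidableEq ι] [DecidableEq κ]
  [DecidableEq ζ] {a c : ℕ}

theorem conjArr_linearIndependent [Nonempty ι] {T : ι → κ → ζ → F}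
    (hT : ∀ z, ∃ i j, T i j = Pi.single z 1) (e : ι ⊕ κ ≃ Fin a) (e' : Unit ⊕ ζ ≃ Fin c) :
    LinearIndependent F (slice (ren e e e' (conjArr T))) := by
  refine linearIndependent_slice fun z => ?_
  have : ∀ w : Unit ⊕ ζ, ∃ i j, conjArr T i j = Pi.single w 1 := by
    rintro (w | w)
    · obtain ⟨i⟩ := ‹Nonempty ι›
      refine ⟨.inl i, .inl i, ?_⟩
      funext k
      rcases k with k | k <;> simp [conjArr]
    · obtain ⟨i, j, h⟩ := hT w
      refine ⟨.inl i, .inr j, ?_⟩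
      funext k
      rcases k with k | k
      · simp [conjArr]
      · simp [conjArr, h, Pi.single_apply]
  obtain ⟨i, j, h⟩ := this (e'.symm z)
  refine ⟨e i, e j, ?_⟩
  funext k
  simp only [ren, Equiv.symm_apply_apply, h, Pi.single_apply, Equiv.apply_eq_iff_eq]

/-- The embedding of the upper right block. -/
def upperBlock (e : ι ⊕ κ ≃ Fin a) : Matrix ι κ F →ₗ[F] Matrix (Fin a) (Fin a) F where
  toFun X := (Matrix.fromBlocks 0 X 0 0).submatrix e.symm e.symm
  map_add' X Y := by
    ext i j
    rcases h : e.symm i with u | u <;> rcases h' : e.symm j with v | v <;> simp [h, h']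
  map_smul' t X := by
    ext i j
    rcases h : e.symm i with u | u <;> rcases h' : e.symm j with v | v <;> simp [h, h']

/-- The projection to the first block. -/
def firstBlock (F : Type u) [Field F] (e : ι ⊕ κ ≃ Fin a) : Matrix (Fin a) (Fin a) F :=
  (Matrix.fromBlocks 1 0 0 0).submatrix e.symm e.symm

theorem isPeirce_conjArr {T : ι → κ → ζ → F} (hT : ∃ z, slice T z ≠ 0) (e : ι ⊕ κ ≃ Fin a) :
    IsPeirce (firstBlock F e)
      ((Submodule.span F (Set.range (slice T))).map (upperBlock e)) where
  idem := by
    rw [firstBlock, Matrix.submatrix_mul_equiv, Matrix.fromBlocks_multiply]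
    simp
  left := by
    rintro _ ⟨X, _, rfl⟩
    change firstBlock F e * (Matrix.fromBlocks 0 X 0 0).submatrix e.symm e.symm =
      (Matrix.fromBlocks 0 X 0 0).submatrix e.symm e.symm
    rw [firstBlock, Matrix.submatrix_mul_equiv, Matrix.fromBlocks_multiply]
    simp
  right := by
    rintro _ ⟨X, _, rfl⟩
    change (Matrix.fromBlocks 0 X 0 0).submatrix e.symm e.symm * firstBlock F e = 0
    rw [firstBlock, Matrix.submatrix_mul_equiv, Matrix.fromBlocks_multiply]
    simp
  square := by
    rintro _ ⟨X, _, rfl⟩ _ ⟨Y, _, rfl⟩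
    change (Matrix.fromBlocks 0 X 0 0).submatrix e.symm e.symm *
      (Matrix.fromBlocks 0 Y 0 0).submatrix e.symm e.symm = 0
    rw [Matrix.submatrix_mul_equiv, Matrix.fromBlocks_multiply]
    simp
  ne_bot := by
    obtain ⟨z, hz⟩ := hT
    intro h
    apply hz
    have h1 : upperBlock e (slice T z) ∈
        (Submodule.span F (Set.range (slice T))).map (upperBlock e) :=
      ⟨_, Submodule.subset_span ⟨z, rfl⟩, rfl⟩
    rw [h, Submodule.mem_bot] at h1
    ext i j
    have := congrFun₂ h1 (e (.inl i)) (e (.inr j))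
    simpa [upperBlock] using this

theorem span_slice_conjArr (T : ι → κ → ζ → F) (e : ι ⊕ κ ≃ Fin a) (e' : Unit ⊕ ζ ≃ Fin c) :
    Submodule.span F (Set.range (slice (ren e e e' (conjArr T)))) =
      Submodule.span F {firstBlock F e} ⊔
        (Submodule.span F (Set.range (slice T))).map (upperBlock e) := by
  have h : slice (ren e e e' (conjArr T)) ∘ e' =
      Sum.elim (fun _ => firstBlock F e) (upperBlock e ∘ slice T) := by
    funext k
    have h1 : slice (ren e e e' (conjArr T)) (e' k) =
        (slice (conjArr T) k).submatrix e.symm e.symm := by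
      ext i j
      simp [slice, ren]
    rw [Function.comp_apply, h1]
    rcases k with k | k
    · rw [slice_conjArr_inl]; rfl
    · rw [slice_conjArr_inr]; rfl
  rw [← e'.surjective.range_comp, h, Set.Sum.elim_range, Submodule.span_union, Submodule.map_span,
    Set.range_comp, Set.range_const]

end

/-- The array of block matrices of the core array, with numbered index sets. -/
def conjCore {ℓ n m : ℕ} (A : Arr F ℓ n m) :
    Arr F ((1 + ℓ) + (n + (m + (ℓ + 2)))) ((1 + ℓ) + (n + (m + (ℓ + 2))))
      (1 + (1 + ℓ) * (m + (ℓ + 2))) :=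
  ren (numE ℓ n m) (numE ℓ n m) (sumE unitE (numZ ℓ m)) (conjArr (core A))

theorem exists_core_eq_single {I J K X : Type*} [DecidableEq I] [DecidableEq K] [DecidableEq X]
    (A : I → J → K → F) (z : (Unit ⊕ I) × (K ⊕ X)) :
    ∃ i j, core A i j = Pi.single z 1 := by
  refine ⟨z.1, .inr z.2, ?_⟩
  funext w
  rcases z with ⟨z | z, c⟩ <;> simp [core, Pi.single_apply]

theorem exists_trans_conjCore_iff {ℓ n m : ℕ} (A B : Arr F ℓ n m) :
    (∃ (P : GL (Fin ℓ) F) (Q : GL (Fin n) F) (R : GL (Fin m) F), trans A P.1 Q.1 R.1 = B) ↔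
      ConjIso (conjCore A) (conjCore B) := by
  rw [conjCore, conjCore, conjIso_ren_iff]
  refine ⟨fun h => conjIso_conjArr (exists_trans_core h),
    fun h => exists_gl_of_trans_core (exists_trans_of_conjIso (fun i => ?_) h)⟩
  refine ⟨(i, .inr 0), .inr (.inr 0), fun i' => ?_⟩
  rcases i' with i' | i' <;> simp [core, eq_comm]

theorem reduces_conjugacy {sz : F → ℕ} (hsz : IsSizeMeasure sz)
    (V : ∀ {f : ℕ × ℕ}, MatrixBasis F f.1 f.2 → Prop)
    (hV : ∀ {n d : ℕ} (A : MatrixBasis F n d) (e : Matrix (Fin n) (Fin n) F)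
      (J : Submodule F (Matrix (Fin n) (Fin n) F)), IsPeirce e J →
      A.space = Submodule.span F {e} ⊔ J → V (f := (n, d)) A) :
    PolyTimeReduces sz (tensorIso F) ((matrixSpaceConjugacy F).restrict V) := by
  have hV' : ∀ {ℓ n m : ℕ} (A : Arr F ℓ n m),
      V (f := (_, _)) ⟨slice (conjCore A), conjArr_linearIndependent (exists_core_eq_single A)
        (numE ℓ n m) (sumE unitE (numZ ℓ m))⟩ := by
    intro ℓ n m A
    refine hV _ _ _ (isPeirce_conjArr (T := core A) ⟨(.inl (), .inr 0), fun h => ?_⟩ (numE ℓ n m))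
      (span_slice_conjArr _ _ _)
    have := congrFun₂ h (.inl ()) (.inr (.inr 0))
    simp [slice, core] at this
  refine reduces_of_expr hsz (1 + dimZ) dimE dimE
    (conjExpr (1 + .var 0) coreInputExpr (.var 4) (.var 5) (.var 3)) _ _ _
    (fun ℓ n m ρ hρ => ⟨?_, eval_dimE hρ, eval_dimE hρ⟩)
    (fun A k i j => conjCore A i j k) ?_ ?_
  · rw [NatExpr.eval_add, NatExpr.eval_one, eval_dimZ hρ]
  · intro ℓ n m A ρ hρ k i j hk hi hj
    refine computes_conj (computes_coreInput A hρ) ?_ _ _ _ _ _ _ (by simpa using hi)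
      (by simpa using hj) (by simpa using hk)
    rw [NatExpr.eval_add, NatExpr.eval_one]
    exact congrArg (1 + ·) hρ.h0
  · intro ℓ n m A B
    refine ⟨(_, _), ⟨_, hV' A⟩, ⟨_, hV' B⟩, .inr rfl, rfl, rfl, ?_⟩
    rw [tensorIso_iff, exists_trans_conjCore_iff]
    exact (exists_conj_iff (conjCore A) (conjCore B)).symm

theorem reduces_matrixLieConjugacy {sz : F → ℕ} (hsz : IsSizeMeasure sz) :
    PolyTimeReduces sz (tensorIso F) (matrixLieConjugacy F) := by
  refine reduces_conjugacy hsz _ fun A e J h hA => ?_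
  obtain ⟨L, h1, h2⟩ := h.lie
  exact ⟨L, h1.trans hA.symm, h2⟩

theorem reduces_matrixAssocConjugacy {sz : F → ℕ} (hsz : IsSizeMeasure sz) :
    PolyTimeReduces sz (tensorIso F) (matrixAssocConjugacy F) := by
  refine reduces_conjugacy hsz _ fun A e J h hA => ?_
  obtain ⟨S, h1, h2⟩ := h.assoc
  exact ⟨S, h1.trans hA.symm, h2⟩

end ConjugacyReductions

/-! ### Polarization of cubic forms -/

section Polarization
variable {F : Type u} [Field F] {κ : Type*} [Fintype κ] [DecidableEq κ]

/-- The symmetrization of an array. -/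
def polar (T : κ → κ → κ → F) : κ → κ → κ → F := fun i j k =>
  T i j k + T i k j + T j i k + T j k i + T k i j + T k j i

theorem tri_add (S T : κ → κ → κ → F) (x y z : κ → F) :
    tri (fun i j k => S i j k + T i j k) x y z = tri S x y z + tri T x y z := by
  simp only [tri, add_mul, Finset.sum_add_distrib]

theorem tri_swap₂₃ (T : κ → κ → κ → F) (x y z : κ → F) :
    tri (fun i j k => T i k j) x y z = tri T x z y := by
  simp only [tri]
  refine Finset.sum_congr rfl fun i _ => ?_
  rw [Finset.sum_comm]
  congr! 2
  ring

theorem tri_swap₁₂ (T : κ → κ → κ → F) (x y z : κ → F) :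
    tri (fun i j k => T j i k) x y z = tri T y x z := by
  simp only [tri]
  rw [Finset.sum_comm]
  congr! 3
  ring

theorem tri_polar (T : κ → κ → κ → F) (x y z : κ → F) :
    tri (polar T) x y z = tri T x y z + tri T x z y + tri T y x z + tri T y z x + tri T z x y +
      tri T z y x := by
  have h1 : tri (fun i j k => T j k i) x y z = tri T y z x := by
    rw [tri_swap₁₂ (fun i j k => T i k j), tri_swap₂₃]
  have h2 : tri (fun i j k => T k i j) x y z = tri T z x y := by
    rw [tri_swap₂₃ (fun i j k => T j i k), tri_swap₁₂]
  have h3 : tri (fun i j k => T k j i) x y z = tri T z y x := by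
    rw [tri_swap₁₂ (fun i j k => T k i j), tri_swap₂₃ (fun i j k => T j i k), tri_swap₁₂]
  rw [← tri_swap₂₃ T x y z, ← tri_swap₁₂ T x y z, ← h1, ← h2, ← h3]
  simp only [← tri_add]
  rfl

theorem tri_polar_trans (T : κ → κ → κ → F) (P : Matrix κ κ F) (x y z : κ → F) :
    tri (polar (trans T P P P)) x y z =
      tri (polar T) (P.mulVec x) (P.mulVec y) (P.mulVec z) := by
  simp only [tri_polar, tri_trans]

variable {n : ℕ}

theorem bind₁_cubicForm (A : Arr F n n n) (P : Matrix (Fin n) (Fin n) F) :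
    MvPolynomial.bind₁ (fun i => ∑ i', MvPolynomial.C (P i i') * MvPolynomial.X i')
      (cubicForm A) = cubicForm (trans A P P P) := by
  have h : ∀ (t : MvPolynomial (Fin n) F) (a b c : Fin n → MvPolynomial (Fin n) F),
      t * ((∑ i, a i) * (∑ j, b j) * (∑ k, c k)) = ∑ i, ∑ j, ∑ k, t * (a i * b j * c k) := by
    intro t a b c
    simp only [Finset.mul_sum, Finset.sum_mul]
    rw [Finset.sum_comm]
    refine (Finset.sum_congr rfl fun j _ => Finset.sum_comm).trans ?_
    rw [Finset.sum_comm]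
  calc _ = ∑ p : Fin n × Fin n × Fin n, ∑ q : Fin n × Fin n × Fin n,
        MvPolynomial.C (A p.1 p.2.1 p.2.2) *
          ((MvPolynomial.C (P p.1 q.1) * MvPolynomial.X q.1) *
          (MvPolynomial.C (P p.2.1 q.2.1) * MvPolynomial.X q.2.1) *
          (MvPolynomial.C (P p.2.2 q.2.2) * MvPolynomial.X q.2.2)) := by
        simp only [cubicForm, map_sum, map_mul, MvPolynomial.bind₁_C_right,
          MvPolynomial.bind₁_X_right, h, Fintype.sum_prod_type]
    _ = ∑ q : Fin n × Fin n × Fin n, ∑ p : Fin n × Fin n × Fin n,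
        MvPolynomial.C (A p.1 p.2.1 p.2.2) *
          ((MvPolynomial.C (P p.1 q.1) * MvPolynomial.X q.1) *
          (MvPolynomial.C (P p.2.1 q.2.1) * MvPolynomial.X q.2.1) *
          (MvPolynomial.C (P p.2.2 q.2.2) * MvPolynomial.X q.2.2)) := Finset.sum_comm
    _ = _ := by
        simp only [cubicForm, trans, map_sum, map_mul, Fintype.sum_prod_type, Finset.sum_mul]
        congr! 6
        ring

theorem constantCoeff_pderiv (a b c i j k : Fin n) (t : F) :
    MvPolynomial.constantCoeff (MvPolynomial.pderiv a (MvPolynomial.pderiv b (MvPolynomial.pderiv c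
      (MvPolynomial.C t * (MvPolynomial.X i * MvPolynomial.X j * MvPolynomial.X k))))) =
      t * polar (fun a b c => (1 : Matrix (Fin n) (Fin n) F) a i *
        (1 : Matrix (Fin n) (Fin n) F) b j * (1 : Matrix (Fin n) (Fin n) F) c k) a b c := by
  have h : ∀ a i : Fin n, MvPolynomial.pderiv a (MvPolynomial.X i) =
      (MvPolynomial.C ((1 : Matrix (Fin n) (Fin n) F) a i) : MvPolynomial (Fin n) F) := by
    intro a i
    rw [MvPolynomial.pderiv_X, Pi.single_apply, Matrix.one_apply]
    by_cases h : a = i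
    · simp [h]
    · simp [h, Ne.symm h]
  simp only [Derivation.leibniz, h, MvPolynomial.pderiv_C, smul_eq_mul, mul_zero, add_zero,
    map_add, map_mul, MvPolynomial.constantCoeff_C, zero_add, polar]
  ring

/-- In all characteristics, the third derivatives of a cubic form are the entries of the
symmetrized array. -/
theorem polar_eq_of_cubicForm_eq {A B : Arr F n n n} (h : cubicForm A = cubicForm B) :
    polar A = polar B := by
  have key : ∀ (A : Arr F n n n) (a b c : Fin n), polar A a b c =
      MvPolynomial.constantCoeff (MvPolynomial.pderiv a (MvPolynomial.pderiv b
        (MvPolynomial.pderiv c (cubicForm A)))) := by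
    intro A a b c
    simp only [cubicForm, map_sum, constantCoeff_pderiv, polar, mul_add, Finset.sum_add_distrib]
    simp [Matrix.one_apply]
  funext a b c
  rw [key, key, h]

end Polarization

/-! ### The cubic form of an array -/

section CubicGadget
variable {F : Type u} [Field F] {I J K H H' : Type*} [Fintype I] [Fintype J] [Fintype K]
  [Fintype H] [Fintype H'] [DecidableEq I] [DecidableEq J] [DecidableEq K] [DecidableEq H]
  [DecidableEq H']

set_option synthInstance.maxSize 1000

/-- The variables of the cubic form of an array: variables `u` and `v` and `w` for the three
directions of the array, variables `h`, and a variable `g` for every pair of a variable `u` or `v`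
and a variable `h`. -/
abbrev CubicIndex (I J K H H' : Type*) : Type _ :=
  (I ⊕ J) ⊕ (K ⊕ ((H ⊕ H') ⊕ ((I ⊕ J) × (H ⊕ H'))))

/-- The trilinear form `∑ A i j k * u i * v j * w k + ∑ u i * h s * g (i, s) +
∑ v j * h s * g (j, s)`, where the second sum is over all `s` and the third sum is over those in
`H'`. -/
def cubicArr (A : I → J → K → F) :
    CubicIndex I J K H H' → CubicIndex I J K H H' → CubicIndex I J K H H' → F
  | .inl (.inl i), .inl (.inr j), .inr (.inl k) => A i j k
  | .inl (.inl i), .inr (.inr (.inl s)), .inr (.inr (.inr g)) => if g = (.inl i, s) then 1 else 0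
  | .inl (.inr j), .inr (.inr (.inl (.inr s))), .inr (.inr (.inr g)) =>
      if g = (.inr j, .inr s) then 1 else 0
  | _, _, _ => 0

theorem tri_cubicArr (A : I → J → K → F) (x y z : CubicIndex I J K H H' → F) :
    tri (cubicArr A) x y z =
      tri A (fun i => x (.inl (.inl i))) (fun j => y (.inl (.inr j))) (fun k => z (.inr (.inl k))) +
      ∑ i, ∑ s, x (.inl (.inl i)) * y (.inr (.inr (.inl s))) *
        z (.inr (.inr (.inr (.inl i, s)))) +
      ∑ j, ∑ s, x (.inl (.inr j)) * y (.inr (.inr (.inl (.inr s)))) *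
        z (.inr (.inr (.inr (.inr j, .inr s)))) := by
  have h1 : ∀ i j, ∑ k, cubicArr A (.inl (.inl i)) j k * x (.inl (.inl i)) * y j * z k =
      match j with
      | .inl (.inr j) => ∑ k, A i j k * x (.inl (.inl i)) * y (.inl (.inr j)) * z (.inr (.inl k))
      | .inr (.inr (.inl s)) => x (.inl (.inl i)) * y (.inr (.inr (.inl s))) *
          z (.inr (.inr (.inr (.inl i, s))))
      | _ => 0 := by
    intro i j
    rcases j with (j | j) | (j | (j | j)) <;>
      simp [Fintype.sum_sum_type, cubicArr]
  have h2 : ∀ i j, ∑ k, cubicArr A (.inl (.inr i)) j k * x (.inl (.inr i)) * y j * z k =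
      match j with
      | .inr (.inr (.inl (.inr s))) => x (.inl (.inr i)) * y (.inr (.inr (.inl (.inr s)))) *
          z (.inr (.inr (.inr (.inr i, .inr s))))
      | _ => 0 := by
    intro i j
    rcases j with (j | j) | (j | ((j | j) | j)) <;>
      simp [Fintype.sum_sum_type, cubicArr]
  have h3 : ∀ i j k, cubicArr A (.inr i : CubicIndex I J K H H') j k = 0 := fun i j k => rfl
  rw [tri, Fintype.sum_sum_type, Fintype.sum_sum_type]
  simp only [h1, h2, h3, zero_mul, Finset.sum_const_zero, add_zero]
  simp only [Fintype.sum_sum_type, Finset.sum_const_zero, add_zero, zero_add,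
    Finset.sum_add_distrib]
  simp only [tri, add_assoc]

theorem tri_cubicArr_eq_zero (A : I → J → K → F) {x : CubicIndex I J K H H' → F}
    (hx : x ∘ Sum.inl = 0) (y z : CubicIndex I J K H H' → F) : tri (cubicArr A) x y z = 0 := by
  have h : ∀ i, x (.inl i) = 0 := congrFun hx
  rw [tri_cubicArr]
  simp [h, tri]

theorem sum_mulVec_dual {ι σ : Type*} [Fintype ι] [DecidableEq ι] [Fintype σ] (P : GL ι F)
    (x : ι → F) (y : σ → F) (z : ι → σ → F) :
    ∑ i, ∑ s, P.1.mulVec x i * y s * P⁻¹.1.transpose.mulVec (fun i => z i s) i =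
      ∑ i, ∑ s, x i * y s * z i s := by
  refine Finset.sum_comm.trans ((Finset.sum_congr rfl fun s _ => ?_).trans Finset.sum_comm)
  have h : P.1.mulVec x ⬝ᵥ P⁻¹.1.transpose.mulVec (fun i => z i s) = x ⬝ᵥ (fun i => z i s) := by
    rw [Matrix.mulVec_transpose, dotProduct_comm, ← Matrix.dotProduct_mulVec, gl_inv_mulVec,
      dotProduct_comm]
  simp only [dotProduct] at h
  simp only [mul_right_comm _ (y s), ← Finset.sum_mul, h]

/-- Isomorphic arrays have equivalent cubic forms. -/
theorem exists_trans_cubicArr {A B : I → J → K → F}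
    (h : ∃ (P : GL I F) (Q : GL J F) (R : GL K F), trans A P.1 Q.1 R.1 = B) :
    ∃ M : GL (CubicIndex I J K H H') F, trans (cubicArr A) M.1 M.1 M.1 = cubicArr B := by
  obtain ⟨P, Q, R, rfl⟩ := h
  -- the variables `g` are transformed contragrediently to `u` and `v`, which preserves the sums of
  -- products `u * h * g` and `v * h * g`
  refine ⟨glBlock (glBlock P Q) (glBlock R (glBlock 1 (glKron (glDual (glBlock P Q)) 1))),
    eq_of_tri_eq fun x y z => ?_⟩
  set M := glBlock (glBlock P Q) (glBlock R (glBlock (1 : GL (H ⊕ H') F)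
    (glKron (glDual (glBlock P Q)) (1 : GL (H ⊕ H') F))))
  have hI : ∀ (x : CubicIndex I J K H H' → F) i, M.1.mulVec x (.inl (.inl i)) =
      P.1.mulVec (fun i => x (.inl (.inl i))) i := by
    intro x i
    simp [M, glBlock, Matrix.mulVec, dotProduct, Fintype.sum_sum_type]
  have hJ : ∀ (x : CubicIndex I J K H H' → F) j, M.1.mulVec x (.inl (.inr j)) =
      Q.1.mulVec (fun i => x (.inl (.inr i))) j := by
    intro x i
    simp [M, glBlock, Matrix.mulVec, dotProduct, Fintype.sum_sum_type]
  have hK : ∀ (x : CubicIndex I J K H H' → F) k, M.1.mulVec x (.inr (.inl k)) =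
      R.1.mulVec (fun i => x (.inr (.inl i))) k := by
    intro x i
    simp [M, glBlock, Matrix.mulVec, dotProduct, Fintype.sum_sum_type]
  have hH : ∀ (x : CubicIndex I J K H H' → F) s, M.1.mulVec x (.inr (.inr (.inl s))) =
      x (.inr (.inr (.inl s))) := by
    intro x s
    rcases s with s | s <;>
      simp [M, glBlock, Matrix.mulVec, dotProduct, Fintype.sum_sum_type, Matrix.one_apply]
  have hG₀ : ∀ (x : CubicIndex I J K H H' → F) q s, M.1.mulVec x (.inr (.inr (.inr (q, s)))) =
      ∑ q', (glDual (glBlock P Q)).1 q q' * x (.inr (.inr (.inr (q', s)))) := by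
    intro x q s
    have h1 : ∀ q' s', M.1 (.inr (.inr (.inr (q, s)))) (.inr (.inr (.inr (q', s')))) =
        (glDual (glBlock P Q)).1 q q' * (1 : Matrix (H ⊕ H') (H ⊕ H') F) s s' := fun _ _ => rfl
    have h2 : ∀ i, M.1 (.inr (.inr (.inr (q, s)))) (.inl i) = 0 := fun _ => rfl
    have h3 : ∀ i, M.1 (.inr (.inr (.inr (q, s)))) (.inr (.inl i)) = 0 := fun _ => rfl
    have h4 : ∀ i, M.1 (.inr (.inr (.inr (q, s)))) (.inr (.inr (.inl i))) = 0 := fun _ => rfl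
    rw [Matrix.mulVec, dotProduct, Fintype.sum_sum_type, Fintype.sum_sum_type (α₁ := K),
      Fintype.sum_sum_type (α₁ := H ⊕ H'), Fintype.sum_prod_type]
    simp only [h1, h2, h3, h4, zero_mul, Finset.sum_const_zero, zero_add, Matrix.one_apply, mul_ite,
      mul_one, mul_zero, ite_mul, Finset.sum_ite_eq, Finset.mem_univ, if_true]
  have hG : ∀ (x : CubicIndex I J K H H' → F) i s, M.1.mulVec x (.inr (.inr (.inr (.inl i, s)))) =
      P⁻¹.1.transpose.mulVec (fun i => x (.inr (.inr (.inr (.inl i, s))))) i := by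
    intro x i s
    have h1 : ∀ i', (glDual (glBlock P Q)).1 (.inl i) (.inl i') = P⁻¹.1.transpose i i' :=
      fun _ => rfl
    have h2 : ∀ j, (glDual (glBlock P Q)).1 (.inl i) (.inr j) = 0 := fun _ => rfl
    rw [hG₀, Fintype.sum_sum_type]
    simp only [h1, h2, zero_mul, Finset.sum_const_zero, add_zero]
    rfl
  have hG' : ∀ (x : CubicIndex I J K H H' → F) j s, M.1.mulVec x (.inr (.inr (.inr (.inr j, s)))) =
      Q⁻¹.1.transpose.mulVec (fun j => x (.inr (.inr (.inr (.inr j, s))))) j := by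
    intro x j s
    have h1 : ∀ j', (glDual (glBlock P Q)).1 (.inr j) (.inr j') = Q⁻¹.1.transpose j j' :=
      fun _ => rfl
    have h2 : ∀ i, (glDual (glBlock P Q)).1 (.inr j) (.inl i) = 0 := fun _ => rfl
    rw [hG₀, Fintype.sum_sum_type]
    simp only [h1, h2, zero_mul, Finset.sum_const_zero, zero_add]
    rfl
  rw [tri_trans, tri_cubicArr, tri_cubicArr, tri_trans]
  simp only [hI, hJ, hK, hH, hG, hG']
  rw [sum_mulVec_dual P _ (fun s => y (.inr (.inr (.inl s)))) fun i s =>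
      z (.inr (.inr (.inr (.inl i, s)))),
    sum_mulVec_dual Q _ (fun s => y (.inr (.inr (.inl (.inr s))))) fun j s =>
      z (.inr (.inr (.inr (.inr j, .inr s))))]

/-! ### Recovering the array from its cubic form -/

/-- If `x` pairs trivially the vectors that vanish at the coordinates `a`, then its rank is at
most twice the number of these coordinates; hence it cannot correspond to an element of larger
rank. -/
theorem card_le_of_rank {κ σ τ : Type*} [Fintype κ] [DecidableEq κ] [Fintype σ] [Fintype τ]
    {S T : κ → κ → κ → F} (a : τ → κ) {φ : (κ → F) ≃ₗ[F] (κ → F)}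
    (hφ : ∀ x y z, tri T (φ x) (φ y) (φ z) = tri S x y z) {x : κ → F}
    (hx : ∀ y z : κ → F, y ∘ a = 0 → z ∘ a = 0 → tri S x y z = 0)
    (e : (σ → F) →ₗ[F] (κ → F)) (he : ∀ c, (∀ z, tri T (φ x) (e c) z = 0) → c = 0) :
    Fintype.card σ ≤ 2 * Fintype.card τ := by
  let s : (κ → F) →ₗ[F] (τ → F) × (τ → F) :=
    { toFun := fun y => (fun i => y (a i), fun i => tri S x y (Pi.single (a i) 1))
      map_add' := fun y y' => by
        ext i
        · rfl
        · simp [tri, mul_add, add_mul, Finset.sum_add_distrib]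
      map_smul' := fun c y => by
        ext i
        · rfl
        · simp [tri, Finset.mul_sum, mul_left_comm, mul_assoc] }
  have hs : ∀ y, s y = 0 → ∀ z, tri S x y z = 0 := by
    intro y hy z
    have h1 : ∀ k, tri S x y (Pi.single k 1) = 0 := by
      intro k
      by_cases hk : ∃ i, a i = k
      · obtain ⟨i, rfl⟩ := hk
        exact congrFun (congrArg Prod.snd hy) i
      · refine hx _ _ (congrArg Prod.fst hy) (funext fun i => ?_)
        rw [Function.comp_apply, Pi.single_apply, if_neg fun h => hk ⟨i, h⟩]
        rfl
    have h2 : tri S x y z = ∑ k, z k * tri S x y (Pi.single k 1) := by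
      simp only [← bil_dotProduct, dotProduct_single, mul_one]
      simp only [dotProduct, mul_comm]
    simp [h2, h1]
  have hinj : Function.Injective (s ∘ₗ φ.symm.toLinearMap ∘ₗ e) := by
    rw [← LinearMap.ker_eq_bot, LinearMap.ker_eq_bot']
    intro c hc
    refine he c fun z => ?_
    have := hs (φ.symm (e c)) hc (φ.symm z)
    rwa [← hφ, LinearEquiv.apply_symm_apply, LinearEquiv.apply_symm_apply] at this
  have := LinearMap.finrank_le_finrank_of_injective hinj
  simp only [Module.finrank_prod, Module.finrank_fintype_fun_eq_card] at this
  omega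

/-- The entries of the array are values of the polarization. -/
theorem tri_polar_cubicArr (A : I → J → K → F) {y z r : CubicIndex I J K H H' → F}
    (hy : ∀ q, y (.inr q) = 0) (hy' : ∀ j, y (.inl (.inr j)) = 0)
    (hz : ∀ q, z (.inr q) = 0) (hz' : ∀ i, z (.inl (.inl i)) = 0) (hr : r ∘ Sum.inl = 0) :
    tri (polar (cubicArr A)) y z r = tri A (fun i => y (.inl (.inl i)))
      (fun j => z (.inl (.inr j))) (fun k => r (.inr (.inl k))) := by
  have hr' : ∀ q, r (.inl q) = 0 := congrFun hr
  rw [tri_polar, tri_cubicArr_eq_zero A hr, tri_cubicArr_eq_zero A hr]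
  simp only [tri_cubicArr, hy, hy', hz, hz', hr', mul_zero, zero_mul, Finset.sum_const_zero,
    add_zero]
  simp [tri]

/-- Vectors without components in the first direction annihilate the third direction. -/
theorem tri_polar_cubicArr_third (A : I → J → K → F) {y z r : CubicIndex I J K H H' → F}
    (hy : ∀ i, y (.inl (.inl i)) = 0) (hz : ∀ i, z (.inl (.inl i)) = 0)
    (hr : ∀ q, r (.inl q) = 0) (hr' : ∀ q, r (.inr (.inr q)) = 0) :
    tri (polar (cubicArr A)) y z r = 0 := by
  rw [tri_polar, tri_cubicArr_eq_zero A (funext hr), tri_cubicArr_eq_zero A (funext hr)]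
  simp only [tri_cubicArr]
  simp [tri, hy, hz, hr, hr']

theorem tri_polar_cubicArr_third' (A : I → J → K → F) {y z r : CubicIndex I J K H H' → F}
    (hz : ∀ q, z (.inl q) = 0) (hr : ∀ q, r (.inl q) = 0) (hr' : ∀ q, r (.inr (.inr q)) = 0) :
    tri (polar (cubicArr A)) y z r = 0 := by
  rw [tri_polar, tri_cubicArr_eq_zero A (funext hr), tri_cubicArr_eq_zero A (funext hr),
    tri_cubicArr_eq_zero A (funext hz), tri_cubicArr_eq_zero A (funext hz)]
  simp only [tri_cubicArr]
  simp [tri, hz, hr, hr']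

theorem tri_add_left {κ : Type*} [Fintype κ] (T : κ → κ → κ → F) (x x' y z : κ → F) :
    tri T (x + x') y z = tri T x y z + tri T x' y z := by
  simp [tri, mul_add, add_mul, Finset.sum_add_distrib]

theorem tri_add_mid {κ : Type*} [Fintype κ] (T : κ → κ → κ → F) (x y y' z : κ → F) :
    tri T x (y + y') z = tri T x y z + tri T x y' z := by
  simp [tri, mul_add, add_mul, Finset.sum_add_distrib]

/-- The rank of a vector with a nonzero component in the first direction is at least the number of
variables `h`, because the polarization restricts to a pairing of these with the variables `g`. -/
theorem tri_polar_single (A : I → J → K → F) (x : CubicIndex I J K H H' → F) (c : H ⊕ H' → F)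
    (i : I)
    (s : H ⊕ H') : tri (polar (cubicArr A)) x (Sum.elim 0 (Sum.elim 0 (Sum.elim c 0)))
      (Pi.single (.inr (.inr (.inr (.inl i, s)))) 1) = x (.inl (.inl i)) * c s := by
  rw [tri_polar, tri_cubicArr_eq_zero A (x := Sum.elim _ _) rfl,
    tri_cubicArr_eq_zero A (x := Sum.elim _ _) rfl,
    tri_cubicArr_eq_zero A (x := Pi.single _ _) (by funext; simp),
    tri_cubicArr_eq_zero A (x := Pi.single _ _) (by funext; simp)]
  simp only [tri_cubicArr]
  simp [tri, Pi.single_apply, ite_and]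

/-- The rank of a vector with a nonzero component in the second direction is at least the number of
variables `h` with index in `H'`. -/
theorem tri_polar_single' (A : I → J → K → F) (x : CubicIndex I J K H H' → F) (c : H' → F) (j : J)
    (s : H') : tri (polar (cubicArr A)) x
      (Sum.elim 0 (Sum.elim 0 (Sum.elim (Sum.elim (0 : H → F) c) 0)))
      (Pi.single (.inr (.inr (.inr (.inr j, .inr s)))) 1) = x (.inl (.inr j)) * c s := by
  rw [tri_polar, tri_cubicArr_eq_zero A (x := Sum.elim _ _) rfl,
    tri_cubicArr_eq_zero A (x := Sum.elim _ _) rfl,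
    tri_cubicArr_eq_zero A (x := Pi.single _ _) (by funext; simp),
    tri_cubicArr_eq_zero A (x := Pi.single _ _) (by funext; simp)]
  simp only [tri_cubicArr]
  simp [tri, Pi.single_apply, ite_and]

section Recover
variable {A B : I → J → K → F}
  {φ : (CubicIndex I J K H H' → F) ≃ₗ[F] (CubicIndex I J K H H' → F)}

/-- Vectors without component in the first direction have rank at most
`2 * (|I| + |J| + |H'|)`, since they pair nontrivially only through the variables `u`, `v` and those
`h` with index in `H'`; all others have rank at least `|H| + |H'|`. -/
theorem cubicArr_preserves_first
    (hH : 2 * (Fintype.card I + Fintype.card J + Fintype.card H') <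
      Fintype.card H + Fintype.card H')
    (hφ : ∀ x y z, tri (polar (cubicArr B)) (φ x) (φ y) (φ z) = tri (polar (cubicArr A)) x y z)
    {x : CubicIndex I J K H H' → F} (hx : ∀ i, x (.inl (.inl i)) = 0) (i : I) :
    φ x (.inl (.inl i)) = 0 := by
  by_contra hi
  refine absurd (card_le_of_rank (σ := H ⊕ H') (τ := (I ⊕ J) ⊕ H')
    (Sum.elim .inl fun s => .inr (.inr (.inl (.inr s)))) hφ (x := x) ?_
    { toFun := fun c => Sum.elim 0 (Sum.elim 0 (Sum.elim c 0))
      map_add' := fun c c' => by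
        funext k; rcases k with k | k | k | k <;> simp
      map_smul' := fun t c => by
        funext k; rcases k with k | k | k | k <;> simp } ?_) ?_
  · intro y z hy hz
    have hy1 : ∀ q, y (.inl q) = 0 := fun q => congrFun hy (.inl q)
    have hy2 : ∀ s, y (.inr (.inr (.inl (.inr s)))) = 0 := fun s => congrFun hy (.inr s)
    have hz1 : ∀ q, z (.inl q) = 0 := fun q => congrFun hz (.inl q)
    have hz2 : ∀ s, z (.inr (.inr (.inl (.inr s)))) = 0 := fun s => congrFun hz (.inr s)
    rw [tri_polar, tri_cubicArr_eq_zero A (funext hy1), tri_cubicArr_eq_zero A (funext hy1),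
      tri_cubicArr_eq_zero A (funext hz1), tri_cubicArr_eq_zero A (funext hz1)]
    simp only [tri_cubicArr]
    simp [tri, hx, hy1, hy2, hz1, hz2]
  · intro c hc
    funext s
    have := hc (Pi.single (.inr (.inr (.inr (.inl i, s)))) 1)
    rw [LinearMap.coe_mk, AddHom.coe_mk, tri_polar_single] at this
    exact (mul_eq_zero.1 this).resolve_left hi
  · simp only [Fintype.card_sum]
    omega

/-- Vectors without components in the first two directions have rank at most `2 * (|I| + |J|)`;
those with a component in the second direction have rank at least `|H'|`. -/
theorem cubicArr_preserves_second
    (hH' : 2 * (Fintype.card I + Fintype.card J) < Fintype.card H')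
    (hφ : ∀ x y z, tri (polar (cubicArr B)) (φ x) (φ y) (φ z) = tri (polar (cubicArr A)) x y z)
    {x : CubicIndex I J K H H' → F} (hx : ∀ q, x (.inl q) = 0) (j : J) :
    φ x (.inl (.inr j)) = 0 := by
  by_contra hj
  refine absurd (card_le_of_rank (σ := H') (τ := I ⊕ J) Sum.inl hφ (x := x) ?_
    { toFun := fun c => Sum.elim 0 (Sum.elim 0 (Sum.elim (Sum.elim (0 : H → F) c) 0))
      map_add' := fun c c' => by
        funext k; rcases k with k | k | (k | k) | k <;> simp
      map_smul' := fun t c => by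
        funext k; rcases k with k | k | (k | k) | k <;> simp } ?_) ?_
  · intro y z hy hz
    rw [tri_polar, tri_cubicArr_eq_zero A hy, tri_cubicArr_eq_zero A hy,
      tri_cubicArr_eq_zero A hz, tri_cubicArr_eq_zero A hz, tri_cubicArr_eq_zero A (funext hx),
      tri_cubicArr_eq_zero A (funext hx)]
    simp
  · intro c hc
    funext s
    have := hc (Pi.single (.inr (.inr (.inr (.inr j, .inr s)))) 1)
    rw [LinearMap.coe_mk, AddHom.coe_mk, tri_polar_single'] at this
    exact (mul_eq_zero.1 this).resolve_left hj
  · simp only [Fintype.card_sum]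
    omega

/-- An equivalence of polarizations recovers the array. -/
theorem exists_trans_of_polar (hH' : 2 * (Fintype.card I + Fintype.card J) < Fintype.card H')
    (hH : 2 * (Fintype.card I + Fintype.card J + Fintype.card H') <
      Fintype.card H + Fintype.card H')
    (hφ : ∀ x y z, tri (polar (cubicArr B)) (φ x) (φ y) (φ z) = tri (polar (cubicArr A)) x y z) :
    ∃ P Q R, trans B P Q R = A := by
  have hφ' : ∀ x y z, tri (polar (cubicArr A)) (φ.symm x) (φ.symm y) (φ.symm z) =
      tri (polar (cubicArr B)) x y z := by
    intro x y z
    rw [← hφ, LinearEquiv.apply_symm_apply, LinearEquiv.apply_symm_apply,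
      LinearEquiv.apply_symm_apply]
  refine ⟨fun i i' => φ (Pi.single (.inl (.inl i')) 1) (.inl (.inl i)),
    fun j j' => φ (Pi.single (.inl (.inr j')) 1) (.inl (.inr j)),
    fun k k' => φ (Pi.single (.inr (.inl k')) 1) (.inr (.inl k)), ?_⟩
  funext i j k
  set y := φ (Pi.single (.inl (.inl i)) 1) with hy
  set z := φ (Pi.single (.inl (.inr j)) 1) with hz
  set r := φ (Pi.single (.inr (.inl k)) 1) with hr
  have hz0 : ∀ i, z (.inl (.inl i)) = 0 := cubicArr_preserves_first hH hφ (by simp)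
  have hr0 : ∀ q, r (.inl q) = 0 := by
    rintro (q | q)
    · exact cubicArr_preserves_first hH hφ (by simp) q
    · exact cubicArr_preserves_second hH' hφ (by simp) q
  have e1 : A i j k = tri (polar (cubicArr B)) y z r := by
    rw [hφ, tri_polar_cubicArr A (by simp) (by simp) (by simp) (by simp) (by funext; simp),
      ← tri_single A i j k]
    congr 1 <;> funext a <;> simp [Pi.single_apply]
  -- remove the components of `y` and `z` that do not contribute
  let y₁ : CubicIndex I J K H H' → F := Sum.elim (Sum.elim (fun i => y (.inl (.inl i))) 0) 0
  let z₁ : CubicIndex I J K H H' → F := Sum.elim (Sum.elim 0 (fun j => z (.inl (.inr j)))) 0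
  have e2 : tri (polar (cubicArr B)) (y - y₁) z r = 0 := by
    rw [← hφ', hz, hr, LinearEquiv.symm_apply_apply, LinearEquiv.symm_apply_apply]
    exact tri_polar_cubicArr_third A (cubicArr_preserves_first hH hφ' (by simp [y₁])) (by simp)
      (by simp) (by simp)
  have e3 : tri (polar (cubicArr B)) y₁ (z - z₁) r = 0 := by
    have h1 : ∀ q, (z - z₁) (.inl q) = 0 := by
      rintro (q | q)
      · simp [z₁, hz0]
      · simp [z₁]
    rw [← hφ', hr, LinearEquiv.symm_apply_apply]
    refine tri_polar_cubicArr_third' A ?_ (by simp) (by simp)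
    rintro (q | q)
    · exact cubicArr_preserves_first hH hφ' (fun i => h1 (.inl i)) q
    · exact cubicArr_preserves_second hH' hφ' h1 q
  have e4 : tri (polar (cubicArr B)) y z r = tri (polar (cubicArr B)) y₁ z₁ r := by
    have h1 := tri_add_left (polar (cubicArr B)) y₁ (y - y₁) z r
    have h2 := tri_add_mid (polar (cubicArr B)) y₁ z₁ (z - z₁) r
    rw [add_sub_cancel, e2, add_zero] at h1
    rw [add_sub_cancel, e3, add_zero] at h2
    rw [h1, h2]
  rw [e1, e4, tri_polar_cubicArr B (fun _ => rfl) (fun _ => rfl) (fun _ => rfl) (fun _ => rfl)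
    (funext hr0)]
  rfl

end Recover

/-- Arrays are isomorphic if the polarizations of their cubic forms are equivalent. -/
theorem exists_gl_of_polar (hH' : 2 * (Fintype.card I + Fintype.card J) < Fintype.card H')
    (hH : 2 * (Fintype.card I + Fintype.card J + Fintype.card H') <
      Fintype.card H + Fintype.card H') {A B : I → J → K → F}
    (h : ∃ P : GL (CubicIndex I J K H H') F,
      polar (trans (cubicArr A) P.1 P.1 P.1) = polar (cubicArr B)) :
    ∃ (P : GL I F) (Q : GL J F) (R : GL K F), trans A P.1 Q.1 R.1 = B := by
  obtain ⟨P, h⟩ := h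
  have h1 : ∀ x y z, tri (polar (cubicArr A)) (glMulVec P x) (glMulVec P y) (glMulVec P z) =
      tri (polar (cubicArr B)) x y z := by
    intro x y z
    rw [← h, tri_polar_trans]
    rfl
  refine exists_gl_trans_eq_of_mutual (exists_trans_of_polar hH' hH h1)
    (exists_trans_of_polar (φ := (glMulVec P).symm) hH' hH fun x y z => ?_)
  rw [← h1, LinearEquiv.apply_symm_apply, LinearEquiv.apply_symm_apply,
    LinearEquiv.apply_symm_apply]

end CubicGadget

/-! ### Reductions to equivalence of cubic and trilinear forms -/

section CubicReductions
variable {F : Type u} [Field F]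

set_option synthInstance.maxSize 1000

/-- The numbering of the variables of the cubic form of an array. -/
abbrev cubicE {I J K H H' : Type*} {a b c d d' : ℕ} (eI : I ≃ Fin a) (eJ : J ≃ Fin b)
    (eK : K ≃ Fin c) (eH : H ≃ Fin d) (eH' : H' ≃ Fin d') :
    CubicIndex I J K H H' ≃ Fin ((a + b) + (c + ((d + d') + (a + b) * (d + d')))) :=
  sumE (sumE eI eJ) (sumE eK (sumE (sumE eH eH') (prodE (sumE eI eJ) (sumE eH eH'))))

/-- The coefficients of `∑ u i * h s * g (i, s)`. -/
def cubicPairExpr (dIJ dK dH : NatExpr) (i j k : NatExpr) : FieldExpr F :=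
  .ifLt j (dIJ + dK) (.const 0) (.ifLt j (dIJ + (dK + dH))
    (.ifEq k (dIJ + (dK + (dH + (i * dH + (j - (dIJ + dK)))))) (.const 1) (.const 0)) (.const 0))

/-- The coefficients of the trilinear form of an array. -/
def cubicExpr (dI dIJ dK dH₁ dH : NatExpr) (g : NatExpr → NatExpr → NatExpr → FieldExpr F)
    (i j k : NatExpr) : FieldExpr F :=
  .ifLt i dI
    (.ifLt j dIJ
      (.ifLt j dI (.const 0) (.ifLt k dIJ (.const 0)
        (.ifLt k (dIJ + dK) (g i (j - dI) (k - dIJ)) (.const 0))))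
      (cubicPairExpr dIJ dK dH i j k))
    (.ifLt i dIJ (.ifLt j (dIJ + (dK + dH₁)) (.const 0) (cubicPairExpr dIJ dK dH i j k))
      (.const 0))

variable {I J K H H' : Type*} [DecidableEq I] [DecidableEq J] [DecidableEq K] [DecidableEq H]
  [DecidableEq H'] {a b c d d' : ℕ} {ρ : ℕ → ℕ} {x : ℕ → F}
  {g : NatExpr → NatExpr → NatExpr → FieldExpr F}

/-- The coefficients of `∑ h s * g (q, s)`. -/
def cubicPair (q : I ⊕ J) : CubicIndex I J K H H' → CubicIndex I J K H H' → F
  | .inr (.inr (.inl s)), .inr (.inr (.inr g)) => if g = (q, s) then 1 else 0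
  | _, _ => 0

theorem eval_cubicPairExpr {eI : I ≃ Fin a} {eJ : J ≃ Fin b} {eK : K ≃ Fin c} {eH : H ≃ Fin d}
    {eH' : H' ≃ Fin d'} {dIJ dK dH : NatExpr} (hIJ : dIJ.eval ρ = a + b) (hK : dK.eval ρ = c)
    (hH : dH.eval ρ = d + d') {i j k : NatExpr} {q : I ⊕ J} {v w : CubicIndex I J K H H'}
    (hi : i.eval ρ = sumE eI eJ q) (hj : j.eval ρ = cubicE eI eJ eK eH eH' v)
    (hk : k.eval ρ = cubicE eI eJ eK eH eH' w) :
    (cubicPairExpr dIJ dK dH i j k : FieldExpr F).eval ρ x =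
      cubicPair q v w := by
  simp only [cubicPairExpr, FieldExpr.eval_ifLt, FieldExpr.eval_ifEq, NatExpr.eval_add,
    NatExpr.eval_mul, NatExpr.eval_sub, hIJ, hK, hH, FieldExpr.eval_const]
  rcases v with v | v | s | v
  · rw [if_pos]
    · rfl
    rw [hj, sumE_inl]
    have := (sumE eI eJ v).2
    omega
  · rw [if_pos]
    · rfl
    rw [hj, sumE_inr, sumE_inl]
    have := (eK v).2
    omega
  · rw [sumE_inr, sumE_inr, sumE_inl] at hj
    have hs := (sumE eH eH' s).2
    have hj' : j.eval ρ - (a + b + c) = sumE eH eH' s := by omega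
    rw [if_neg (by omega), if_pos (by omega), hj', hi, ← prodE_apply, hk]
    rcases w with w | w | w | w
    · rw [sumE_inl, if_neg]
      · rfl
      have := (sumE eI eJ w).2
      omega
    · rw [sumE_inr, sumE_inl, if_neg]
      · rfl
      have := (eK w).2
      omega
    · rw [sumE_inr, sumE_inr, sumE_inl, if_neg]
      · rfl
      have := (sumE eH eH' w).2
      omega
    · rw [sumE_inr, sumE_inr, sumE_inr]
      refine if_congr ?_ rfl rfl
      rw [Nat.add_left_cancel_iff, Nat.add_left_cancel_iff, Nat.add_left_cancel_iff, Fin.val_inj,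
        Equiv.apply_eq_iff_eq]
  · rw [sumE_inr, sumE_inr, sumE_inr] at hj
    rw [if_neg (by omega), if_neg (by omega)]
    rfl

theorem computes_cubic {A : I → J → K → F} {eI : I ≃ Fin a} {eJ : J ≃ Fin b} {eK : K ≃ Fin c}
    (eH : H ≃ Fin d) (eH' : H' ≃ Fin d') (hg : Computes ρ x g eI eJ eK A)
    {dI dIJ dK dH₁ dH : NatExpr} (hI : dI.eval ρ = a) (hIJ : dIJ.eval ρ = a + b)
    (hK : dK.eval ρ = c) (hH₁ : dH₁.eval ρ = d) (hH : dH.eval ρ = d + d') :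
    Computes ρ x (cubicExpr dI dIJ dK dH₁ dH g) (cubicE eI eJ eK eH eH')
      (cubicE eI eJ eK eH eH') (cubicE eI eJ eK eH eH') (cubicArr A) := by
  intro i j k u v w hi hj hk
  simp only [cubicExpr, FieldExpr.eval_ifLt, NatExpr.eval_add, hI, hIJ, hK, hH₁,
    FieldExpr.eval_const]
  rcases u with (u | u) | u
  · have hi' := hi
    rw [sumE_inl] at hi'
    rw [eval_cubicPairExpr hIJ hK hH hi' hj hk]
    rw [sumE_inl] at hi'
    have hu := (eI u).2
    rw [if_pos (by omega)]
    rcases v with (v | v) | v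
    · have hv := (eI v).2
      rw [sumE_inl, sumE_inl] at hj
      rw [if_pos (by omega), if_pos (by omega)]
      rfl
    · have hv := (eJ v).2
      rw [sumE_inl, sumE_inr] at hj
      rw [if_pos (by omega), if_neg (by omega)]
      rcases w with w | w | w
      · rw [sumE_inl] at hk
        have hw := (sumE eI eJ w).2
        rw [if_pos (by omega)]
        rfl
      · rw [sumE_inr, sumE_inl] at hk
        have hw := (eK w).2
        rw [if_neg (by omega), if_pos (by omega)]
        exact hg _ _ _ _ _ _ hi' (by simp [hI, hj]) (by simp [hIJ, hk])
      · rw [sumE_inr, sumE_inr] at hk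
        rw [if_neg (by omega), if_neg (by omega)]
        rfl
    · rw [sumE_inr] at hj
      rw [if_neg (by omega)]
      rcases v with v | v | v
      · rfl
      · rcases w with w | w | w | w <;> rfl
      · rfl
  · have hi' := hi
    rw [sumE_inl] at hi'
    rw [eval_cubicPairExpr hIJ hK hH hi' hj hk]
    rw [sumE_inl, sumE_inr] at hi
    have hu := (eJ u).2
    rw [if_neg (by omega), if_pos (by omega)]
    rcases v with v | v | (v | v) | v
    · rw [sumE_inl] at hj
      have hv := (sumE eI eJ v).2
      rw [if_pos (by omega)]
      rcases v with v | v <;> rfl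
    · rw [sumE_inr, sumE_inl] at hj
      have hv := (eK v).2
      rw [if_pos (by omega)]
      rfl
    · rw [sumE_inr, sumE_inr, sumE_inl, sumE_inl] at hj
      have hv := (eH v).2
      rw [if_pos (by omega)]
      rfl
    · rw [sumE_inr, sumE_inr, sumE_inl, sumE_inr] at hj
      rw [if_neg (by omega)]
      rcases w with w | w | w | w <;> rfl
    · rw [sumE_inr, sumE_inr, sumE_inr] at hj
      have hv := (sumE eI eJ v.1).2
      split_ifs <;> rfl
  · rw [sumE_inr] at hi
    rw [if_neg (by omega), if_neg (by omega)]
    rfl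

/-- The numbering of the variables of the cubic form of an array of the given format.  The
numbers of variables `h` are such that the ranks in the directions `u`, `v` and the other ones
differ. -/
abbrev numC (ℓ n m : ℕ) : CubicIndex (Fin ℓ) (Fin n) (Fin m) (Fin (4 * (ℓ + n) + 2))
    (Fin (2 * (ℓ + n) + 1)) ≃ Fin ((ℓ + n) + (m + ((4 * (ℓ + n) + 2 + (2 * (ℓ + n) + 1)) +
      (ℓ + n) * (4 * (ℓ + n) + 2 + (2 * (ℓ + n) + 1))))) :=
  cubicE (Equiv.refl _) (Equiv.refl _) (Equiv.refl _) (Equiv.refl _) (Equiv.refl _)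

/-- The trilinear form of an array, with numbered variables. -/
def cubicGadget {ℓ n m : ℕ} (A : Arr F ℓ n m) :=
  ren (numC ℓ n m) (numC ℓ n m) (numC ℓ n m) (cubicArr A)

theorem exists_trans_cubicGadget {ℓ n m : ℕ} {A B : Arr F ℓ n m}
    (h : ∃ (P : GL (Fin ℓ) F) (Q : GL (Fin n) F) (R : GL (Fin m) F), trans A P.1 Q.1 R.1 = B) :
    ∃ P : GL _ F, trans (cubicGadget A) P.1 P.1 P.1 = cubicGadget B := by
  obtain ⟨P, h⟩ := exists_trans_cubicArr (H := Fin (4 * (ℓ + n) + 2))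
    (H' := Fin (2 * (ℓ + n) + 1)) h
  refine ⟨glReindex (numC ℓ n m) P, ?_⟩
  rw [cubicGadget, cubicGadget, trans_ren, ← h]
  simp only [glReindex, Matrix.submatrix_submatrix, Equiv.symm_comp_self, Matrix.submatrix_id_id]

theorem exists_gl_of_polar_cubicGadget {ℓ n m : ℕ} {A B : Arr F ℓ n m}
    (h : ∃ P : GL _ F, polar (trans (cubicGadget A) P.1 P.1 P.1) = polar (cubicGadget B)) :
    ∃ (P : GL (Fin ℓ) F) (Q : GL (Fin n) F) (R : GL (Fin m) F), trans A P.1 Q.1 R.1 = B := by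
  obtain ⟨P, h⟩ := h
  rw [cubicGadget, trans_ren] at h
  refine exists_gl_of_polar (H := Fin (4 * (ℓ + n) + 2)) (H' := Fin (2 * (ℓ + n) + 1)) (by simp)
    (by simp only [Fintype.card_fin]; omega) ⟨glReindex (numC ℓ n m).symm P, ?_⟩
  exact ren_injective (numC ℓ n m) (numC ℓ n m) (numC ℓ n m) h

theorem exists_cubicForm_of_trans {n : ℕ} {S T : Arr F n n n}
    (h : ∃ P : GL (Fin n) F, trans S P.1 P.1 P.1 = T) : ∃ P : GL (Fin n) F,
      MvPolynomial.bind₁ (fun i => ∑ i', MvPolynomial.C (P.1 i i') * MvPolynomial.X i')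
        (cubicForm S) = cubicForm T := by
  obtain ⟨P, rfl⟩ := h
  exact ⟨P, bind₁_cubicForm S P.1⟩

theorem exists_polar_of_cubicForm {n : ℕ} {S T : Arr F n n n}
    (h : ∃ P : GL (Fin n) F,
      MvPolynomial.bind₁ (fun i => ∑ i', MvPolynomial.C (P.1 i i') * MvPolynomial.X i')
        (cubicForm S) = cubicForm T) :
    ∃ P : GL (Fin n) F, polar (trans S P.1 P.1 P.1) = polar T := by
  obtain ⟨P, h⟩ := h
  exact ⟨P, polar_eq_of_cubicForm_eq ((bind₁_cubicForm S P.1).symm.trans h)⟩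

/-- The reduction to any problem on cubical arrays that lies between equivalence of trilinear forms
and equivalence of their symmetrizations. -/
theorem reduces_cubicGadget {sz : F → ℕ} (hsz : IsSizeMeasure sz)
    (Iso : ∀ {n : ℕ}, Arr F n n n → Arr F n n n → Prop)
    (h₁ : ∀ {n : ℕ} (S T : Arr F n n n), (∃ P : GL (Fin n) F, trans S P.1 P.1 P.1 = T) → Iso S T)
    (h₂ : ∀ {n : ℕ} (S T : Arr F n n n), Iso S T →
      ∃ P : GL (Fin n) F, polar (trans S P.1 P.1 P.1) = polar T) :
    PolyTimeReduces sz (tensorIso F)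
      ⟨ℕ, fun n => Arr F n n n, fun n => [n], fun A => Arr.toList A, Iso⟩ := by
  let dH : NatExpr := .const 4 * (.var 0 + .var 1) + 2 + (2 * (.var 0 + .var 1) + 1)
  let D : NatExpr := (.var 0 + .var 1) + (.var 2 + (dH + (.var 0 + .var 1) * dH))
  refine reduces_of_expr hsz D D D
    (cubicExpr (.var 0) (.var 0 + .var 1) (.var 2) (.const 4 * (.var 0 + .var 1) + 2) dH inputExpr
      (.var 3) (.var 4) (.var 5)) _ _ _ (fun ℓ n m ρ hρ => ?_) (fun A => cubicGadget A) ?_ ?_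
  · have h0 : ρ ((0 : Fin 20) : ℕ) = ℓ := hρ.h0
    have h1 : ρ ((1 : Fin 20) : ℕ) = n := hρ.h1
    have h2 : ρ ((2 : Fin 20) : ℕ) = m := hρ.h2
    simp only [D, dH, NatExpr.eval_add, NatExpr.eval_mul, NatExpr.eval_var, NatExpr.eval_const,
      NatExpr.eval_one, NatExpr.eval_two, h0, h1, h2]
    exact ⟨trivial, trivial, trivial⟩
  · intro ℓ n m A ρ hρ i j k hi hj hk
    have h0 : ρ ((0 : Fin 20) : ℕ) = ℓ := hρ.h0
    have h1 : ρ ((1 : Fin 20) : ℕ) = n := hρ.h1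
    have h2 : ρ ((2 : Fin 20) : ℕ) = m := hρ.h2
    refine (computes_cubic (Equiv.refl _) (Equiv.refl _) (computes_input A hρ) ?_ ?_ ?_ ?_
      ?_).eval_eq i j k hi hj hk <;>
    simp only [dH, NatExpr.eval_add, NatExpr.eval_mul, NatExpr.eval_var, NatExpr.eval_const,
      NatExpr.eval_one, NatExpr.eval_two, h0, h1, h2]
  · intro ℓ n m A B
    refine ⟨_, cubicGadget A, cubicGadget B, .inl rfl, rfl, rfl, ?_⟩
    rw [tensorIso_iff]
    exact ⟨fun h => h₁ _ _ (exists_trans_cubicGadget h),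
      fun h => exists_gl_of_polar_cubicGadget (h₂ _ _ h)⟩

theorem reduces_trilinearFormEquiv {sz : F → ℕ} (hsz : IsSizeMeasure sz) :
    PolyTimeReduces sz (tensorIso F) (trilinearFormEquiv F) := by
  refine reduces_cubicGadget hsz (fun {n} S T => ∃ P : GL (Fin n) F,
    ∀ i' j' k', (∑ i, ∑ j, ∑ k, S i j k * P.1 i i' * P.1 j j' * P.1 k k') = T i' j' k') ?_ ?_
  · rintro n S _ ⟨P, rfl⟩
    exact ⟨P, fun _ _ _ => rfl⟩
  · rintro n S T ⟨P, h⟩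
    refine ⟨P, congrArg polar ?_⟩
    funext i j k
    exact h i j k

theorem reduces_cubicFormEquiv {sz : F → ℕ} (hsz : IsSizeMeasure sz) :
    PolyTimeReduces sz (tensorIso F) (cubicFormEquiv F) :=
  reduces_cubicGadget hsz _ (fun _ _ => exists_cubicForm_of_trans)
    fun _ _ => exists_polar_of_cubicForm

end CubicReductions

/-! ### Additive equivalences of core arrays -/

section Semilinear
variable {F : Type u} [Field F] {I J K X : Type*} [Fintype I] [Fintype J] [Fintype K] [Fintype X]
  [DecidableEq I] [DecidableEq J] [DecidableEq K] [DecidableEq X]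
variable {A B : I → J → K → F} {p : (Unit ⊕ I → F) ≃+ (Unit ⊕ I → F)}
  {q : (J ⊕ (K ⊕ X) → F) ≃+ (J ⊕ (K ⊕ X) → F)}
  {r : ((Unit ⊕ I) × (K ⊕ X) → F) ≃+ ((Unit ⊕ I) × (K ⊕ X) → F)}

/-- Additive equivalences of core arrays are semilinear: since `(c • u) ⊗ s = u ⊗ (c • s)`, the
scalar by which `p (c • u)` differs from `p u` can be read off from the map on `S`. -/
theorem core_semilinear [Nonempty X]
    (h : ∀ u y, r (bil (core A) u y) = bil (core B) (p u) (q y)) :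
    ∃ γ : F → F, (∀ (c : F) u, p (c • u) = γ c • p u) ∧ ∀ (c : F) z, r (c • z) = γ c • r z := by
  obtain ⟨x⟩ := ‹Nonempty X›
  let s := q.symm (Pi.single (.inr (.inr x)) 1)
  have hs : q s = Pi.single (.inr (.inr x)) 1 := q.apply_symm_apply _
  have hp : ∀ (c : F) u, p (c • u) = q (c • s) (.inr (.inr x)) • p u := by
    intro c u
    have h1 : bil (core B) (p (c • u)) (q s) = bil (core B) (p u) (q (c • s)) := by
      rw [← h, ← h, bil_smul_left, bil_smul_right]
    funext a
    rcases a with a | a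
    · have := congrFun h1 (.inl (), .inr x)
      rw [bil_core_inl_inr, bil_core_inl_inr, hs, Pi.single_eq_same, mul_one, mul_comm] at this
      exact this
    · have := congrFun h1 (.inr a, .inr x)
      rw [bil_core_inr, bil_core_inr, hs, Pi.single_eq_same, mul_one, mul_comm] at this
      exact this
  refine ⟨fun c => q (c • s) (.inr (.inr x)), hp, fun c z => ?_⟩
  have hz : ∀ c : F, c • z = ∑ w : (Unit ⊕ I) × (K ⊕ X), bil (core A)
      (c • z w • (Pi.single w.1 1 : Unit ⊕ I → F)) (Pi.single (.inr w.2) 1) := by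
    intro c
    have h2 : ∀ w : (Unit ⊕ I) × (K ⊕ X), core A w.1 (.inr w.2 : J ⊕ (K ⊕ X)) = Pi.single w 1 := by
      rintro ⟨a | a, b⟩ <;> funext w <;> simp [core, Pi.single_apply]
    simp only [bil_smul_left, bil_single, h2, ← Finset.smul_sum]
    congr 1
    funext w
    simp [Finset.sum_apply, Pi.single_apply]
  have hz1 := congrArg r (hz 1)
  rw [one_smul, map_sum] at hz1
  rw [hz c, map_sum, hz1, Finset.smul_sum]
  refine Finset.sum_congr rfl fun w _ => ?_
  rw [h, h, hp, bil_smul_left, one_smul]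

end Semilinear

/-! ### Marking an array by lines in the plane -/

section Mark
variable {F : Type u} [Field F] {I J K N C T : Type*} [Fintype I] [Fintype J] [Fintype K]
  [Fintype N] [Fintype C] [Fintype T] [DecidableEq I] [DecidableEq J] [DecidableEq K]
  [DecidableEq N] [DecidableEq C] [DecidableEq T]

/-- The direct sum of the array `A` and of the bilinear maps `(x, t) ↦ μ a t * x`, each of them
repeated `C` times, where `a` ranges over `N` and the linear forms `μ a` have the common
domain `F ^ T`. -/
def mark (μ : N → T → F) (A : I → J → K → F) : I ⊕ (N × C) → J ⊕ T → K ⊕ (N × C) → F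
  | .inl i, .inl j, .inl k => A i j k
  | .inr a, .inr t, .inr b => if b = a then μ a.1 t else 0
  | _, _, _ => 0

theorem bil_mark_inl (μ : N → T → F) (A : I → J → K → F) (x : I ⊕ (N × C) → F) (y : J ⊕ T → F)
    (k : K) : bil (mark μ A) x y (.inl k) = bil A (x ∘ Sum.inl) (y ∘ Sum.inl) k := by
  simp [bil, Fintype.sum_sum_type, mark]

theorem bil_mark_inr (μ : N → T → F) (A : I → J → K → F) (x : I ⊕ (N × C) → F) (y : J ⊕ T → F)
    (a : N × C) : bil (mark μ A) x y (.inr a) = x (.inr a) * (μ a.1 ⬝ᵥ (y ∘ Sum.inr)) := by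
  simp only [bil, Fintype.sum_sum_type (α₁ := I), Fintype.sum_sum_type (α₁ := J), mark, mul_zero,
    Finset.sum_const_zero, zero_add]
  rw [Finset.sum_comm]
  simp only [mul_ite, mul_zero, Finset.sum_ite_eq, Finset.mem_univ, if_true, dotProduct,
    Finset.mul_sum, Function.comp_apply]
  congr! 1
  ring

theorem exists_trans_mark (μ : N → T → F) {A B : I → J → K → F}
    (h : ∃ (P : GL I F) (Q : GL J F) (R : GL K F), trans A P.1 Q.1 R.1 = B) :
    ∃ (P : GL (I ⊕ (N × C)) F) (Q : GL (J ⊕ T) F) (R : GL (K ⊕ (N × C)) F),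
      trans (mark μ A) P.1 Q.1 R.1 = mark μ B := by
  obtain ⟨P, Q, R, rfl⟩ := h
  refine ⟨glBlock P 1, glBlock Q 1, glBlock R 1, ?_⟩
  funext i j k
  rcases i with i | i <;> rcases j with j | j <;> rcases k with k | k <;>
    simp [trans, mark, glBlock, Fintype.sum_sum_type, Matrix.one_apply]

/-- The number of forms `μ a` that vanish at `t`. -/
noncomputable def vanishCount (μ : N → T → F) (t : T → F) : ℕ :=
  Nat.card {a // μ a ⬝ᵥ t = 0}

variable {X : Type*} [Fintype X] [DecidableEq X] {A B : I → J → K → F} {μ : N → T → F}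
  {p : (Unit ⊕ (I ⊕ (N × C)) → F) ≃+ (Unit ⊕ (I ⊕ (N × C)) → F)}
  {q : ((J ⊕ T) ⊕ ((K ⊕ (N × C)) ⊕ X) → F) ≃+ ((J ⊕ T) ⊕ ((K ⊕ (N × C)) ⊕ X) → F)}
  {r : ((Unit ⊕ (I ⊕ (N × C))) × ((K ⊕ (N × C)) ⊕ X) → F) ≃+
    ((Unit ⊕ (I ⊕ (N × C))) × ((K ⊕ (N × C)) ⊕ X) → F)}

/-- The annihilator of an element of `V` in the marked core array. -/
theorem bil_core_mark_eq_zero_iff {y : (J ⊕ T) ⊕ ((K ⊕ (N × C)) ⊕ X) → F}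
    (hy : ∀ c, y (.inr c) = 0) (u : Unit ⊕ (I ⊕ (N × C)) → F) :
    bil (core (mark μ A)) u y = 0 ↔
      bil A (fun i => u (.inr (.inl i))) (fun j => y (.inl (.inl j))) = 0 ∧
        ∀ a, u (.inr (.inr a)) = 0 ∨ μ a.1 ⬝ᵥ (fun t => y (.inl (.inr t))) = 0 := by
  constructor
  · intro h
    refine ⟨funext fun k => ?_, fun a => ?_⟩
    · have := congrFun h (.inl (), .inl (.inl k))
      rw [bil_core_inl_inl, hy, mul_zero, zero_add, bil_mark_inl] at this
      exact this
    · have := congrFun h (.inl (), .inl (.inr a))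
      rw [bil_core_inl_inl, hy, mul_zero, zero_add, bil_mark_inr] at this
      exact mul_eq_zero.1 this
  · rintro ⟨h1, h2⟩
    funext ⟨a, c⟩
    rcases a with a | a
    · rcases c with (k | b) | c
      · rw [bil_core_inl_inl, hy, mul_zero, zero_add, bil_mark_inl]
        exact congrFun h1 k
      · rw [bil_core_inl_inl, hy, mul_zero, zero_add, bil_mark_inr]
        exact mul_eq_zero.2 (h2 b)
      · rw [bil_core_inl_inr, hy, mul_zero]
        rfl
    · rw [bil_core_inr, hy, mul_zero]
      rfl

/-- The multiplicity `C` is so large that the number of forms vanishing at an element of `V` is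
determined by the size of its annihilator. -/
theorem vanishCount_le [Finite F] (hC : Fintype.card I + 1 < Fintype.card C)
    (h : ∀ u y, r (bil (core (mark μ A)) u y) = bil (core (mark μ B)) (p u) (q y))
    {y : (J ⊕ T) ⊕ ((K ⊕ (N × C)) ⊕ X) → F} (hy : ∀ c, y (.inr c) = 0) :
    vanishCount μ (fun t => y (.inl (.inr t))) ≤ vanishCount μ (fun t => q y (.inl (.inr t))) := by
  classical
  have := Fintype.ofFinite F
  let D := {a : N // μ a ⬝ᵥ (fun t => y (.inl (.inr t))) = 0}
  let D' := {a : N // μ a ⬝ᵥ (fun t => q y (.inl (.inr t))) = 0}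
  let f : (D × C → F) → (Unit ⊕ (I ⊕ (N × C)) → F) := fun x =>
    Sum.elim 0 (Sum.elim 0 fun a => if ha : μ a.1 ⬝ᵥ (fun t => y (.inl (.inr t))) = 0 then
      x (⟨a.1, ha⟩, a.2) else 0)
  let g : (Unit ⊕ (I ⊕ (N × C)) → F) → (Unit ⊕ (I ⊕ (D' × C)) → F) := fun u =>
    Sum.elim (fun a => u (.inl a)) (Sum.elim (fun i => u (.inr (.inl i)))
      fun a => u (.inr (.inr (a.1.1, a.2))))
  have hf : ∀ x, bil (core (mark μ A)) (f x) y = 0 := by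
    intro x
    rw [bil_core_mark_eq_zero_iff hy]
    refine ⟨?_, fun a => ?_⟩
    · exact bil_zero_left _ _
    · by_cases ha : μ a.1 ⬝ᵥ (fun t => y (.inl (.inr t))) = 0
      · exact .inr ha
      · exact .inl (dif_neg ha)
  -- `f` embeds the functions on `D × C` into the annihilator of `y`, and `g` is injective on the
  -- annihilator of `q y`
  have hinj : Function.Injective (g ∘ p ∘ f) := by
    intro x x' hx
    have hg : p (f x) = p (f x') := by
      have key : ∀ x, ∀ a : N × C, p (f x) (.inr (.inr a)) = 0 ∨
          μ a.1 ⬝ᵥ (fun t => q y (.inl (.inr t))) = 0 := fun x =>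
        ((bil_core_mark_eq_zero_iff (core_preserves h hy) (p (f x))).1
          (by rw [← h, hf, map_zero])).2
      funext b
      rcases b with b | b | b
      · exact congrFun hx (.inl b)
      · exact congrFun hx (.inr (.inl b))
      · by_cases hb : μ b.1 ⬝ᵥ (fun t => q y (.inl (.inr t))) = 0
        · exact congrFun hx (.inr (.inr (⟨b.1, hb⟩, b.2)))
        · rw [(key x b).resolve_right hb, (key x' b).resolve_right hb]
    funext a
    have := congrFun (p.injective hg) (.inr (.inr (a.1.1, a.2)))
    simpa [f, a.1.2] using this
  -- the additive map `p` need not be linear, so the annihilators are compared by cardinality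
  have hcard := Fintype.card_le_of_injective _ hinj
  simp only [Fintype.card_fun, Fintype.card_sum, Fintype.card_prod, Fintype.card_unit] at hcard
  rw [Nat.pow_le_pow_iff_right Fintype.one_lt_card] at hcard
  rw [vanishCount, vanishCount, Nat.card_eq_fintype_card, Nat.card_eq_fintype_card]
  change Fintype.card D ≤ Fintype.card D'
  by_contra! hlt
  have := Nat.mul_le_mul_right (Fintype.card C) (Nat.succ_le_of_lt hlt)
  rw [Nat.succ_mul] at this
  omega

theorem vanishCount_eq [Finite F] (hC : Fintype.card I + 1 < Fintype.card C)
    (h : ∀ u y, r (bil (core (mark μ A)) u y) = bil (core (mark μ B)) (p u) (q y))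
    {y : (J ⊕ T) ⊕ ((K ⊕ (N × C)) ⊕ X) → F} (hy : ∀ c, y (.inr c) = 0) :
    vanishCount μ (fun t => q y (.inl (.inr t))) = vanishCount μ (fun t => y (.inl (.inr t))) := by
  refine le_antisymm ?_ (vanishCount_le hC h hy)
  have := vanishCount_le hC (core_equiv_symm h) (core_preserves h hy)
  rwa [AddEquiv.symm_apply_apply] at this

/-- Linear forms on the plane whose kernels are the lines through `(1, 0)`, `(0, 1)`, `(1, 1)` and
`(1, α)`.  The lines are told apart by the multiplicities `1`, `2`, `3` and `4`. -/
def markForms (α : F) : Fin 10 → Fin 2 → F :=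
  ![![0, 1], ![1, 0], ![1, 0], ![1, -1], ![1, -1], ![1, -1], ![α, -1], ![α, -1], ![α, -1],
    ![α, -1]]

open Classical in
theorem vanishCount_markForms (α : F) (t : Fin 2 → F) :
    vanishCount (markForms α) t = (if t 1 = 0 then 1 else 0) + (if t 0 = 0 then 2 else 0) +
      (if t 0 = t 1 then 3 else 0) + (if α * t 0 = t 1 then 4 else 0) := by
  have h : ∀ s : F, s + -t 1 = 0 ↔ s = t 1 := fun s => by rw [← sub_eq_add_neg, sub_eq_zero]
  rw [vanishCount, Nat.card_eq_fintype_card, Fintype.card_subtype, Finset.card_filter]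
  simp only [Fin.sum_univ_succ, markForms, dotProduct]
  simp [h]
  split_ifs <;> rfl

/-! The sums of multiplicities `1`, `2`, `3` and `4` determine the line through a nonzero point. -/

open Classical in
theorem line_one {α a b : F} (h : (if b = 0 then 1 else 0) + (if a = 0 then 2 else 0) +
    (if a = b then 3 else 0) + (if α * a = b then 4 else 0) = 1) :
    b = 0 ∧ a ≠ 0 := by
  split_ifs at h <;> simp_all

open Classical in
theorem line_two {α a b : F} (h : (if b = 0 then 1 else 0) + (if a = 0 then 2 else 0) +
    (if a = b then 3 else 0) + (if α * a = b then 4 else 0) = 2) :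
    a = 0 ∧ b ≠ 0 := by
  split_ifs at h <;> simp_all

open Classical in
theorem line_three {α a b : F} (h : (if b = 0 then 1 else 0) + (if a = 0 then 2 else 0) +
    (if a = b then 3 else 0) + (if α * a = b then 4 else 0) = 3) :
    a = b := by
  split_ifs at h <;> simp_all

open Classical in
theorem line_four {α a b : F} (h : (if b = 0 then 1 else 0) + (if a = 0 then 2 else 0) +
    (if a = b then 3 else 0) + (if α * a = b then 4 else 0) = 4) :
    α * a = b := by
  split_ifs at h <;> simp_all

open Classical in
theorem lines_meet {α a b : F} (h : (if b = 0 then 1 else 0) + (if a = 0 then 2 else 0) +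
    (if a = b then 3 else 0) + (if α * a = b then 4 else 0) = 10) :
    a = 0 ∧ b = 0 := by
  split_ifs at h <;> simp_all

section Plane
variable {α : F} {p : (Unit ⊕ (I ⊕ (Fin 10 × C)) → F) ≃+ (Unit ⊕ (I ⊕ (Fin 10 × C)) → F)}
  {q : ((J ⊕ Fin 2) ⊕ ((K ⊕ (Fin 10 × C)) ⊕ X) → F) ≃+
    ((J ⊕ Fin 2) ⊕ ((K ⊕ (Fin 10 × C)) ⊕ X) → F)}
  {r : ((Unit ⊕ (I ⊕ (Fin 10 × C))) × ((K ⊕ (Fin 10 × C)) ⊕ X) → F) ≃+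
    ((Unit ⊕ (I ⊕ (Fin 10 × C))) × ((K ⊕ (Fin 10 × C)) ⊕ X) → F)}

/-- An additive equivalence of marked core arrays preserves the four lines, and hence the
parameter `α` of the fourth one. -/
theorem mark_smul_eq [Finite F] [Nonempty X] (hC : Fintype.card I + 1 < Fintype.card C)
    (hα0 : α ≠ 0) (hα1 : α ≠ 1)
    (h : ∀ u y, r (bil (core (mark (markForms α) A)) u y) =
      bil (core (mark (markForms α) B)) (p u) (q y)) (z) : r (α • z) = α • r z := by
  obtain ⟨γ, -, hγ⟩ := core_semilinear h
  rw [hγ]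
  congr 1
  have : Nonempty C := Fintype.card_pos_iff.1 (by omega)
  obtain ⟨e⟩ := this
  -- on the plane, `q` transforms multiplication by `α` into multiplication by `γ α`
  have hq : ∀ {y : (J ⊕ Fin 2) ⊕ ((K ⊕ (Fin 10 × C)) ⊕ X) → F}, (∀ c, y (.inr c) = 0) →
      ∀ a, markForms α a ⬝ᵥ (fun t => q (α • y) (.inl (.inr t))) =
        γ α * (markForms α a ⬝ᵥ fun t => q y (.inl (.inr t))) := by
    intro y hy a
    let u := p.symm (Pi.single (.inr (.inr (a, e))) 1)
    have h1 : bil (core (mark (markForms α) B)) (p u) (q (α • y)) =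
        γ α • bil (core (mark (markForms α) B)) (p u) (q y) := by
      rw [← h, ← h, bil_smul_right, hγ]
    have h2 := congrFun h1 (.inl (), .inl (.inr (a, e)))
    rw [Pi.smul_apply, bil_core_inl_inl, bil_core_inl_inl, bil_mark_inr, bil_mark_inr] at h2
    simp only [u, AddEquiv.apply_symm_apply] at h2
    simpa using h2
  let y : Fin 2 → (J ⊕ Fin 2) ⊕ ((K ⊕ (Fin 10 × C)) ⊕ X) → F :=
    fun t => Pi.single (.inl (.inr t)) 1
  have hy : ∀ t c, y t (.inr c) = 0 := fun t c => by simp [y]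
  have hy' : ∀ t s, y t (.inl (.inr s)) = if s = t then 1 else 0 := fun t c => by
    simp [y, Pi.single_apply]
  -- the basis vectors and the vectors `(1, 1)` and `(1, α)` stay on their lines
  have c0 := vanishCount_eq hC h (hy 0)
  have c1 := vanishCount_eq hC h (hy 1)
  have c2 := vanishCount_eq hC h (y := y 0 + y 1) fun c => by simp [hy]
  have c3 := vanishCount_eq hC h (y := y 0 + α • y 1) fun c => by simp [hy]
  have s0 := hq (hy 1) 0
  have s1 := hq (hy 1) 1
  simp only [vanishCount_markForms, hy', map_add, Pi.add_apply, Pi.smul_apply] at c0 c1 c2 c3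
  have e0 : ∀ t : Fin 2 → F, markForms α 0 ⬝ᵥ t = t 1 := fun t => by
    simp [markForms, dotProduct]
  have e1 : ∀ t : Fin 2 → F, markForms α 1 ⬝ᵥ t = t 0 := fun t => by
    simp [markForms, dotProduct]
  rw [e0, e0] at s0
  rw [e1, e1] at s1
  rw [s0, s1] at c3
  generalize q (y 0) (.inl (.inr 0)) = a at *
  generalize q (y 0) (.inl (.inr 1)) = b at *
  generalize q (y 1) (.inl (.inr 0)) = c at *
  generalize q (y 1) (.inl (.inr 1)) = d at *
  obtain ⟨rfl, -⟩ := line_one (c0.trans (by simp [hα0]))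
  obtain ⟨rfl, hd⟩ := line_two (c1.trans (by simp))
  have c2' := line_three (c2.trans (by simp [hα1]))
  have c3' := line_four (c3.trans (by simp [hα0, hα1.symm]))
  rw [add_zero, zero_add] at c2'
  rw [mul_zero, add_zero, zero_add, c2'] at c3'
  exact (mul_right_cancel₀ hd c3').symm

/-- An additive equivalence of marked core arrays recovers the array. -/
theorem exists_trans_of_core_mark [Finite F] [Nonempty X]
    (hC : Fintype.card I + 1 < Fintype.card C)
    (h : ∀ u y, r (bil (core (mark (markForms α) A)) u y) =
      bil (core (mark (markForms α) B)) (p u) (q y)) (hr : ∀ (c : F) z, r (c • z) = c • r z) :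
    ∃ P Q R, trans A P Q R = B := by
  obtain ⟨P, R, hPR⟩ := exists_trans_of_core h hr
  -- all marking forms vanish on `J`, and nothing else in the plane but zero has this property
  have hQ : ∀ j t, q.symm (Pi.single (.inl (.inl j)) 1) (.inl (.inr t)) = 0 := by
    intro j t
    have h1 := vanishCount_eq hC (core_equiv_symm h) (y := Pi.single (.inl (.inl j)) 1) (by simp)
    simp only [vanishCount_markForms] at h1
    generalize q.symm (Pi.single (.inl (.inl j)) 1) = x at *
    have h2 : x (.inl (.inr 0)) = 0 ∧ x (.inl (.inr 1)) = 0 := lines_meet (h1.trans (by simp))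
    fin_cases t
    · exact h2.1
    · exact h2.2
  refine ⟨fun i i' => P (.inl i) (.inl i'), fun j j' => q.symm (Pi.single (.inl (.inl j')) 1)
    (.inl (.inl j)), fun k k' => R (.inl k) (.inl k'), ?_⟩
  funext i' j' k'
  have := congrFun₃ hPR (.inl i') (.inl j') (.inl k')
  simpa [trans, Fintype.sum_sum_type, mark, hQ] using this

/-- Additively equivalent marked core arrays come from isomorphic arrays, if `α` generates the
multiplicative group of `F`. -/
theorem exists_gl_of_core_mark [Finite F] [Nonempty X]
    (hC : Fintype.card I + 1 < Fintype.card C) (hα0 : α ≠ 0) (hα1 : α ≠ 1)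
    (hα : ∀ c : F, c ≠ 0 → ∃ n : ℕ, α ^ n = c)
    (h : ∀ u y, r (bil (core (mark (markForms α) A)) u y) =
      bil (core (mark (markForms α) B)) (p u) (q y)) :
    ∃ (P : GL I F) (Q : GL J F) (R : GL K F), trans A P.1 Q.1 R.1 = B := by
  have hr : ∀ (c : F) z, r (c • z) = c • r z := by
    intro c z
    by_cases hc : c = 0
    · simp [hc]
    obtain ⟨n, rfl⟩ := hα c hc
    induction n with
    | zero => simp
    | succ n ih =>
      rw [pow_succ', mul_smul, mark_smul_eq hC hα0 hα1 h, ih (pow_ne_zero _ hα0), mul_smul]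
  exact exists_gl_trans_eq_of_mutual (exists_trans_of_core_mark hC h hr)
    (exists_trans_of_core_mark hC (core_equiv_symm h) fun c z => by
      rw [AddEquiv.symm_apply_eq, hr, AddEquiv.apply_symm_apply])

end Plane
end Mark

/-! ### Heisenberg groups of bilinear maps -/

section Heisenberg
variable {F : Type u} [Field F] {ι ζ : Type*} [Fintype ι] [Fintype ζ] [DecidableEq ι]
  [DecidableEq ζ]

/-- The Heisenberg group of the bilinear map with coefficients `T`: the set `F ^ ι × F ^ ζ` with
the product `(v, z) * (v', z') = (v + v', z + z' + T (v, v'))`. -/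
@[ext] structure Heis (T : ι → ι → ζ → F) where
  v : ι → F
  z : ζ → F

namespace Heis
variable {S T : ι → ι → ζ → F}

open scoped commutatorElement

instance : Mul (Heis T) := ⟨fun g h => ⟨g.v + h.v, g.z + h.z + bil T g.v h.v⟩⟩
instance : One (Heis T) := ⟨⟨0, 0⟩⟩
instance : Inv (Heis T) := ⟨fun g => ⟨-g.v, -g.z + bil T g.v g.v⟩⟩

@[simp] theorem mul_v (g h : Heis T) : (g * h).v = g.v + h.v := rfl
@[simp] theorem mul_z (g h : Heis T) : (g * h).z = g.z + h.z + bil T g.v h.v := rfl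
@[simp] theorem one_v : (1 : Heis T).v = 0 := rfl
@[simp] theorem one_z : (1 : Heis T).z = 0 := rfl
@[simp] theorem inv_v (g : Heis T) : (g⁻¹).v = -g.v := rfl
@[simp] theorem inv_z (g : Heis T) : (g⁻¹).z = -g.z + bil T g.v g.v := rfl

instance : Group (Heis T) :=
  Group.ofLeftAxioms
    (fun a b c => by
      ext1
      · simp [add_assoc]
      · simp only [mul_z, mul_v, bil_add_left, bil_add_right]; abel)
    (fun a => by ext1 <;> simp)
    (fun a => by
      ext1
      · simp
      · simp only [mul_z, inv_z, inv_v, one_z]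
        rw [← neg_one_smul F a.v, bil_smul_left, neg_one_smul]
        abel)

/-- The projection to the quotient by the central subgroup `F ^ ζ`. -/
def proj (T : ι → ι → ζ → F) : Heis T →* Multiplicative (ι → F) where
  toFun g := .ofAdd g.v
  map_one' := rfl
  map_mul' _ _ := rfl

theorem mem_ker_proj {g : Heis T} : g ∈ (proj T).ker ↔ g.v = 0 := Iff.rfl

theorem commutator_eq (g h : Heis T) : ⁅g, h⁆ = ⟨0, bil T g.v h.v - bil T h.v g.v⟩ := by
  rw [commutatorElement_def, mul_assoc, ← mul_inv_rev, mul_inv_eq_iff_eq_mul]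
  ext1
  · simp [add_comm]
  · simp only [mul_z, mul_v, bil_zero_left]
    abel

theorem pow_eq (hT : ∀ x, bil T x x = 0) (g : Heis T) (n : ℕ) : g ^ n = ⟨n • g.v, n • g.z⟩ := by
  induction n with
  | zero => ext1 <;> simp
  | succ n ih =>
    rw [pow_succ, ih]
    ext1
    · simp only [mul_v, succ_nsmul]
    · simp only [mul_z, succ_nsmul]
      rw [← Nat.cast_smul_eq_nsmul F n g.v, bil_smul_left, hT, smul_zero, add_zero]

theorem pow_char (p : ℕ) [CharP F p] (hT : ∀ x, bil T x x = 0) (g : Heis T) : g ^ p = 1 := by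
  rw [pow_eq hT, ← Nat.cast_smul_eq_nsmul F, ← Nat.cast_smul_eq_nsmul F, CharP.cast_eq_zero,
    zero_smul, zero_smul]
  rfl

theorem bil_swap (hT : ∀ x, bil T x x = 0) (x y : ι → F) : bil T y x = -bil T x y := by
  have h := hT (x + y)
  rw [bil_add_left, bil_add_right, bil_add_right, hT, hT, zero_add, add_zero] at h
  exact eq_neg_of_add_eq_zero_right h

/-- If the coordinates on `F ^ ζ` are values of `T`, and `2` is invertible, then `F ^ ζ` is the
commutator subgroup. -/
theorem mem_commutator_iff (h2 : (2 : F) ≠ 0) (hT : ∀ x, bil T x x = 0)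
    (hT' : ∀ z, ∃ i j, T i j = Pi.single z 1) (g : Heis T) :
    g ∈ commutator (Heis T) ↔ g.v = 0 := by
  constructor
  · have : commutator (Heis T) ≤ (proj T).ker := by
      rw [commutator_def, Subgroup.commutator_le]
      intro g _ h _
      rw [mem_ker_proj, commutator_eq]
    exact fun h => this h
  · intro hg
    have key : ∀ z : ζ → F, (⟨0, z⟩ : Heis T) ∈ commutator (Heis T) := by
      intro z
      rw [← Finset.univ_sum_single z]
      refine Finset.sum_induction _ (fun z => (⟨0, z⟩ : Heis T) ∈ commutator (Heis T))
        (fun a b ha hb => ?_) (one_mem _) fun k _ => ?_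
      · have := mul_mem ha hb
        have e : (⟨0, a⟩ * ⟨0, b⟩ : Heis T) = ⟨0, a + b⟩ := by ext1 <;> simp
        rwa [e] at this
      · obtain ⟨i, j, hij⟩ := hT' k
        have := Subgroup.commutator_mem_commutator (Subgroup.mem_top
          (⟨(z k / 2) • Pi.single i 1, 0⟩ : Heis T)) (Subgroup.mem_top ⟨Pi.single j 1, 0⟩)
        rw [commutator_eq, bil_swap hT ((z k / 2) • _), sub_neg_eq_add, ← two_smul F,
          bil_smul_left, bil_single, hij, smul_smul, mul_div_cancel₀ _ h2] at this
        rwa [← Pi.single_smul, smul_eq_mul, mul_one] at this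
    have := key g.z
    rwa [← hg] at this

theorem commutator_le_center : commutator (Heis T) ≤ Subgroup.center (Heis T) := by
  rw [commutator_def, Subgroup.commutator_le]
  intro g _ h _
  rw [commutator_eq, Subgroup.mem_center_iff]
  intro k
  ext1
  · simp
  · simp [add_comm]

theorem isNilpotent : Group.IsNilpotent (Heis T) := by
  rw [Subgroup.nilpotent_iff_lowerCentralSeries]
  exact ⟨2, Subgroup.lowerCentralSeries_succ_eq_bot ⊤ commutator_le_center⟩

theorem nilpotencyClass_eq (h2 : (2 : F) ≠ 0) (hT : ∀ x, bil T x x = 0)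
    (hT' : ∀ z, ∃ i j, T i j = Pi.single z 1) [Nonempty ζ] :
    Group.nilpotencyClass (Heis T) = 2 := by
  have := isNilpotent (T := T)
  refine le_antisymm ?_ ?_
  · rw [← Subgroup.lowerCentralSeries_eq_bot_iff_nilpotencyClass_le]
    exact Subgroup.lowerCentralSeries_succ_eq_bot ⊤ commutator_le_center
  · by_contra! h
    have h1 := Subgroup.lowerCentralSeries_eq_bot_iff_nilpotencyClass_le.2 (Nat.le_of_lt_succ h)
    rw [Subgroup.top_lowerCentralSeries_one] at h1
    obtain ⟨k⟩ := ‹Nonempty ζ›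
    have h3 := (mem_commutator_iff h2 hT hT' ⟨0, Pi.single k 1⟩).2 rfl
    rw [h1, Subgroup.mem_bot] at h3
    have := congrFun (congrArg Heis.z h3) k
    simp at this

/-- Isomorphisms of Heisenberg groups induce additive isomorphisms of the bilinear maps, namely
on the commutator subgroups and on the quotients by them. -/
theorem exists_addEquiv (h2 : (2 : F) ≠ 0) (hS : ∀ x, bil S x x = 0)
    (hS' : ∀ z, ∃ i j, S i j = Pi.single z 1) (hT : ∀ x, bil T x x = 0)
    (hT' : ∀ z, ∃ i j, T i j = Pi.single z 1) (θ : Heis S ≃* Heis T) :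
    ∃ (φ : (ι → F) ≃+ (ι → F)) (ψ : (ζ → F) ≃+ (ζ → F)),
      ∀ x y, ψ (bil S x y) = bil T (φ x) (φ y) := by
  have hz : ∀ {S T : ι → ι → ζ → F} (_ : ∀ x, bil S x x = 0)
      (_ : ∀ z, ∃ i j, S i j = Pi.single z 1) (_ : ∀ x, bil T x x = 0)
      (_ : ∀ z, ∃ i j, T i j = Pi.single z 1) (θ : Heis S ≃* Heis T) (z : ζ → F),
      (θ ⟨0, z⟩).v = 0 := by
    intro S T hS hS' hT hT' θ z
    have h1 := Subgroup.mem_map_of_mem θ.toMonoidHom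
      ((mem_commutator_iff h2 hS hS' ⟨0, z⟩).2 rfl)
    rw [commutator_def, Subgroup.map_commutator, ← MonoidHom.range_eq_map,
      MonoidHom.range_eq_top.2 θ.surjective, ← commutator_def] at h1
    exact (mem_commutator_iff h2 hT hT' _).1 h1
  have hv : ∀ {S T : ι → ι → ζ → F} (θ : Heis S ≃* Heis T) (_ : ∀ z, (θ ⟨0, z⟩).v = 0)
      (g : Heis S), (θ g).v = (θ ⟨g.v, 0⟩).v := by
    intro S T θ h g
    have e : g = ⟨g.v, 0⟩ * ⟨0, g.z⟩ := by ext1 <;> simp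
    conv_lhs => rw [e]
    rw [map_mul, mul_v, h, add_zero]
  have h1 := hz hS hS' hT hT' θ
  have h1' := hz hT hT' hS hS' θ.symm
  have h3 : ∀ z, θ ⟨0, z⟩ = ⟨0, (θ ⟨0, z⟩).z⟩ := fun z => by ext1 <;> simp [h1]
  have h3' : ∀ z, θ.symm ⟨0, z⟩ = ⟨0, (θ.symm ⟨0, z⟩).z⟩ := fun z => by ext1 <;> simp [h1']
  refine ⟨{ toFun := fun x => (θ ⟨x, 0⟩).v
            invFun := fun x => (θ.symm ⟨x, 0⟩).v
            left_inv := fun x => by beta_reduce; rw [← hv θ.symm h1']; simp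
            right_inv := fun x => by beta_reduce; rw [← hv θ h1]; simp
            map_add' := fun x y => ?_ },
    { toFun := fun z => (θ ⟨0, z⟩).z
      invFun := fun z => (θ.symm ⟨0, z⟩).z
      left_inv := fun z => by beta_reduce; rw [← h3]; simp
      right_inv := fun z => by beta_reduce; rw [← h3']; simp
      map_add' := fun x y => ?_ }, fun x y => ?_⟩
  · rw [← mul_v, ← map_mul, hv θ h1 (_ * _)]
    rfl
  · have e : (⟨0, x + y⟩ : Heis S) = ⟨0, x⟩ * ⟨0, y⟩ := by ext1 <;> simp
    rw [e, map_mul, mul_z, h1, bil_zero_left, add_zero]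
  · have h4 := map_commutatorElement θ.toMonoidHom ⟨x, 0⟩ ⟨y, 0⟩
    have h5 := congrArg Heis.z h4
    rw [commutator_eq, commutator_eq, bil_swap hS x, bil_swap hT (θ.toMonoidHom ⟨x, 0⟩).v] at h5
    simp only [sub_neg_eq_add] at h5
    have e : (⟨0, bil S x y + bil S x y⟩ : Heis S) = ⟨0, bil S x y⟩ * ⟨0, bil S x y⟩ := by
      ext1 <;> simp
    rw [e, map_mul, mul_z] at h5
    change (θ _).z + (θ _).z + bil T (θ _).v _ = _ at h5
    rw [h1, bil_zero_left, add_zero, ← two_smul F, ← two_smul F] at h5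
    exact smul_right_injective _ h2 h5

/-- Isomorphisms of bilinear maps induce isomorphisms of the Heisenberg groups. -/
theorem nonempty_mulEquiv (h : BilIso S T) : Nonempty (Heis S ≃* Heis T) := by
  obtain ⟨φ, ψ, h⟩ := h
  exact ⟨{ toFun := fun g => ⟨φ g.v, ψ g.z⟩
           invFun := fun g => ⟨φ.symm g.v, ψ.symm g.z⟩
           left_inv := fun g => by simp
           right_inv := fun g => by simp
           map_mul' := fun g g' => by ext1 <;> simp [h] }⟩

/-! ### Matrices for Heisenberg groups -/

/-- The block unitriangular matrix with the rows `v` and `z` and the matrix `T (·, v)` above the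
diagonal. -/
def toMatrix (g : Heis T) : Matrix (Unit ⊕ (ι ⊕ ζ)) (Unit ⊕ (ι ⊕ ζ)) F := fun a b =>
  match a, b with
  | .inl _, .inl _ => 1
  | .inl _, .inr (.inl i) => g.v i
  | .inl _, .inr (.inr k) => g.z k
  | .inr (.inl i), .inr (.inl j) => if i = j then 1 else 0
  | .inr (.inl i), .inr (.inr k) => ∑ j, T i j k * g.v j
  | .inr (.inr k), .inr (.inr l) => if k = l then 1 else 0
  | _, _ => 0

/-- A faithful matrix representation of the Heisenberg group. -/
def toMatrixHom (T : ι → ι → ζ → F) : Heis T →* Matrix (Unit ⊕ (ι ⊕ ζ)) (Unit ⊕ (ι ⊕ ζ)) F where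
  toFun := toMatrix
  map_one' := by
    ext a b
    rcases a with a | a | a <;> rcases b with b | b | b <;>
      simp [toMatrix, Matrix.one_apply]
  map_mul' g h := by
    ext a b
    rcases a with a | a | a <;> rcases b with b | b | b <;>
      simp [toMatrix, Matrix.mul_apply, Fintype.sum_sum_type, bil, Finset.mul_sum, mul_add,
        Finset.sum_add_distrib, add_comm, mul_left_comm]
    rw [add_left_comm, ← add_assoc]
    congr! 3
    ring

/-- The representation by matrices whose rows and columns are numbered. -/
def rep (T : ι → ι → ζ → F) {n : ℕ} (e : Unit ⊕ (ι ⊕ ζ) ≃ Fin n) : Heis T →* GL (Fin n) F :=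
  MonoidHom.toHomUnits
    ((Matrix.reindexAlgEquiv F F e : _ →* Matrix (Fin n) (Fin n) F).comp (toMatrixHom T))

theorem rep_apply {n : ℕ} (e : Unit ⊕ (ι ⊕ ζ) ≃ Fin n) (g : Heis T) (i j : Fin n) :
    (rep T e g).1 i j = g.toMatrix (e.symm i) (e.symm j) := rfl

theorem rep_injective {n : ℕ} (e : Unit ⊕ (ι ⊕ ζ) ≃ Fin n) : Function.Injective (rep T e) := by
  intro g h hgh
  have key : ∀ a b, g.toMatrix a b = h.toMatrix a b := fun a b => by
    have := congrFun₂ (congrArg (fun g : GL (Fin n) F => g.1) hgh) (e a) (e b)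
    rw [rep_apply, rep_apply] at this
    simpa using this
  ext1
  · exact funext fun i => key (.inl ()) (.inr (.inl i))
  · exact funext fun k => key (.inl ()) (.inr (.inr k))

/-- Generators of the Heisenberg group: the multiples of the standard basis vectors. -/
def gen (T : ι → ι → ζ → F) : F × (ι ⊕ ζ) → Heis T
  | (c, .inl i) => ⟨Pi.single i c, 0⟩
  | (c, .inr k) => ⟨0, Pi.single k c⟩

theorem closure_gen : Subgroup.closure (Set.range (gen T)) = ⊤ := by
  have hz : ∀ z : ζ → F, (⟨0, z⟩ : Heis T) ∈ Subgroup.closure (Set.range (gen T)) := by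
    intro z
    rw [← Finset.univ_sum_single z]
    refine Finset.sum_induction _
      (fun z => (⟨0, z⟩ : Heis T) ∈ Subgroup.closure (Set.range (gen T)))
      (fun a b ha hb => ?_) (one_mem _) fun k _ => Subgroup.subset_closure ⟨(z k, .inr k), rfl⟩
    have := mul_mem ha hb
    have e : (⟨0, a⟩ * ⟨0, b⟩ : Heis T) = ⟨0, a + b⟩ := by ext1 <;> simp
    rwa [e] at this
  have hv : ∀ v : ι → F, ∃ z, (⟨v, z⟩ : Heis T) ∈ Subgroup.closure (Set.range (gen T)) := by
    intro v
    rw [← Finset.univ_sum_single v]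
    refine Finset.sum_induction _
      (fun v => ∃ z, (⟨v, z⟩ : Heis T) ∈ Subgroup.closure (Set.range (gen T)))
      (fun a b ha hb => ?_) ⟨0, one_mem _⟩
      fun i _ => ⟨0, Subgroup.subset_closure ⟨(v i, .inl i), rfl⟩⟩
    obtain ⟨z, hz⟩ := ha
    obtain ⟨z', hz'⟩ := hb
    exact ⟨_, mul_mem hz hz'⟩
  refine eq_top_iff.2 fun g _ => ?_
  obtain ⟨z, h⟩ := hv g.v
  have e : g = ⟨g.v, z⟩ * ⟨0, g.z - z⟩ := by ext1 <;> simp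
  rw [e]
  exact mul_mem h (hz _)

variable {n d : ℕ} (e : Unit ⊕ (ι ⊕ ζ) ≃ Fin n) (e' : F × (ι ⊕ ζ) ≃ Fin d)

/-- The matrices of the generators. -/
def genMatrix (T : ι → ι → ζ → F) (t : Fin d) : GL (Fin n) F := rep T e (gen T (e'.symm t))

theorem generatedGroup_genMatrix : generatedGroup (genMatrix e e' T) = (rep T e).range := by
  have h : genMatrix e e' T = rep T e ∘ gen T ∘ e'.symm := rfl
  rw [generatedGroup, h, Set.range_comp, e'.symm.surjective.range_comp, ← MonoidHom.map_closure,
    closure_gen, ← MonoidHom.range_eq_map]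

/-- The matrix group is the Heisenberg group. -/
noncomputable def equivGenerated (T : ι → ι → ζ → F) :
    Heis T ≃* generatedGroup (genMatrix e e' T) :=
  (MonoidHom.ofInjective (rep_injective e)).trans
    (MulEquiv.subgroupCongr (generatedGroup_genMatrix e e').symm)

theorem generatedGroup_spec (p : ℕ) [CharP F p] (h2 : (2 : F) ≠ 0) (hT : ∀ x, bil T x x = 0)
    (hT' : ∀ z, ∃ i j, T i j = Pi.single z 1) [Nonempty ζ] :
    IsPGroup p (generatedGroup (genMatrix e e' T)) ∧
      (∀ g : generatedGroup (genMatrix e e' T), g ^ p = 1) ∧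
      Group.nilpotencyClass (generatedGroup (genMatrix e e' T)) = 2 := by
  let f := equivGenerated e e' T
  have h1 : ∀ g : generatedGroup (genMatrix e e' T), g ^ p = 1 := fun g => by
    rw [← f.apply_symm_apply g, ← map_pow, pow_char p hT, map_one]
  have := isNilpotent (T := T)
  have := Group.nilpotent_of_mulEquiv f
  exact ⟨fun g => ⟨1, by rw [pow_one, h1]⟩, h1, (le_antisymm
    (Group.nilpotencyClass_le_of_surjective f.toMonoidHom f.surjective)
    (Group.nilpotencyClass_le_of_surjective f.symm.toMonoidHom f.symm.surjective)).trans
    (nilpotencyClass_eq h2 hT hT')⟩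

end Heis
end Heisenberg

/-! ### The reduction to isomorphism of matrix groups -/

section GroupExpressions
variable {F : Type u} [Field F]

/-- For an index `t = i * D + r` with `i < n` and `r < D`, the expression `f i r`. -/
def blockExpr (D t : NatExpr) : {n : ℕ} → (Fin n → NatExpr → FieldExpr F) → FieldExpr F
  | 0, _ => .const 0
  | n + 1, f => .ifLt t (.const n * D) (blockExpr D t fun i => f i.castSucc)
      (f (Fin.last n) (t - .const n * D))

theorem eval_blockExpr {D t : NatExpr} {ρ : ℕ → ℕ} {x : ℕ → F} {n d r : ℕ}
    (f : Fin n → NatExpr → FieldExpr F) (i : Fin n) (hD : D.eval ρ = d)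
    (ht : t.eval ρ = i * d + r) (hr : r < d) :
    (blockExpr D t f).eval ρ x = (f i (t - .const i * D)).eval ρ x := by
  induction n with
  | zero => exact i.elim0
  | succ n ih =>
    rw [blockExpr, FieldExpr.eval_ifLt, NatExpr.eval_mul, NatExpr.eval_const, hD, ht]
    induction i using Fin.lastCases with
    | last =>
      rw [if_neg (by rw [Fin.val_last]; omega)]
      rfl
    | cast i =>
      have h : (i + 1) * d ≤ n * d := Nat.mul_le_mul_right d i.2
      rw [if_pos (by rw [Fin.val_castSucc]; rw [add_mul, one_mul] at h; omega)]
      exact ih (fun i => f i.castSucc) i ht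

variable {I J K ι ζ N : Type*} [Fintype I] [Fintype J] [Fintype K] [DecidableEq I] [DecidableEq J]
  [DecidableEq K] [Fintype ι] [Fintype ζ] [DecidableEq ι] [DecidableEq ζ] {a b c d w : ℕ}
  {ρ : ℕ → ℕ} {x : ℕ → F} {g : NatExpr → NatExpr → NatExpr → FieldExpr F}

/-- The entries of the marked array. -/
def markExpr (μ : Fin w → Fin 2 → F) (dI dJ dK dC : NatExpr)
    (g : NatExpr → NatExpr → NatExpr → FieldExpr F) (i j k : NatExpr) : FieldExpr F :=
  .ifLt i dI (.ifLt j dJ (.ifLt k dK (g i j k) (.const 0)) (.const 0))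
    (.ifLt j dJ (.const 0) (.ifEq (k + dI) (dK + i)
      (.ifLt j (dJ + 1) (blockExpr dC (i - dI) fun a _ => .const (μ a 0))
        (blockExpr dC (i - dI) fun a _ => .const (μ a 1))) (.const 0)))

theorem computes_mark (μ : Fin w → Fin 2 → F) {A : I → J → K → F} {eI : I ≃ Fin a} {eJ : J ≃ Fin b}
    {eK : K ≃ Fin c} (hg : Computes ρ x g eI eJ eK A) {dI dJ dK dC : NatExpr} (hI : dI.eval ρ = a)
    (hJ : dJ.eval ρ = b) (hK : dK.eval ρ = c) (hC : dC.eval ρ = d) :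
    Computes ρ x (markExpr μ dI dJ dK dC g)
      (sumE eI (prodE (Equiv.refl (Fin w)) (Equiv.refl (Fin d)))) (sumE eJ (Equiv.refl (Fin 2)))
      (sumE eK (prodE (Equiv.refl (Fin w)) (Equiv.refl (Fin d)))) (mark μ A) := by
  intro i j k u v t hi hj hk
  simp only [markExpr, FieldExpr.eval_ifLt, FieldExpr.eval_ifEq, NatExpr.eval_add, hI, hJ, hK,
    NatExpr.eval_one, FieldExpr.eval_const]
  rcases u with u | u
  · rw [sumE_inl] at hi
    have hu := (eI u).2
    rw [if_pos (by omega)]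
    rcases v with v | v
    · rw [sumE_inl] at hj
      have hv := (eJ v).2
      rw [if_pos (by omega)]
      rcases t with t | t
      · rw [sumE_inl] at hk
        have ht := (eK t).2
        rw [if_pos (by omega)]
        exact hg _ _ _ _ _ _ hi hj hk
      · rw [sumE_inr] at hk
        rw [if_neg (by omega)]
        rfl
    · rw [sumE_inr] at hj
      rw [if_neg (by omega)]
      rfl
  · rw [sumE_inr] at hi
    rw [if_neg (by omega)]
    rcases v with v | v
    · rw [sumE_inl] at hj
      have hv := (eJ v).2
      rw [if_pos (by omega)]
      rfl
    · rw [sumE_inr] at hj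
      rw [if_neg (by omega)]
      rcases t with t | t
      · rw [sumE_inl] at hk
        have ht := (eK t).2
        rw [if_neg (by omega)]
        rfl
      · rw [sumE_inr] at hk
        have hm : mark μ A (.inr u) (.inr v) (.inr t) = if t = u then μ u.1 v else 0 := rfl
        rw [hm]
        refine if_congr ?_ ?_ rfl
        · rw [hi, hk, add_assoc c, add_comm a, Nat.add_left_cancel_iff,
            Nat.add_right_cancel_iff, Fin.val_inj, Equiv.apply_eq_iff_eq]
        · have hi' : (i - dI).eval ρ = (u.1 : ℕ) * d + (u.2 : ℕ) := by
            rw [NatExpr.eval_sub, hi, hI, Nat.add_sub_cancel_left, prodE_apply]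
            rfl
          rw [eval_blockExpr _ u.1 hC hi' u.2.2, eval_blockExpr _ u.1 hC hi' u.2.2, hj]
          simp only [FieldExpr.eval_const, Equiv.refl_apply]
          fin_cases v
          · exact if_pos (by simp)
          · exact if_neg (by simp)

/-- The directions of the generators of a Heisenberg group: the matrices of `gen T (c, a)` have
the entries `c * genDir T a i j` off the diagonal. -/
def genDir (T : ι → ι → ζ → F) : ι ⊕ ζ → Unit ⊕ (ι ⊕ ζ) → Unit ⊕ (ι ⊕ ζ) → F
  | a, .inl _, .inr b => if a = b then 1 else 0
  | .inl j, .inr (.inl i), .inr (.inr k) => T i j k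
  | _, _, _ => 0

theorem toMatrix_gen (T : ι → ι → ζ → F) (c : F) (s : ι ⊕ ζ) (i j : Unit ⊕ (ι ⊕ ζ)) :
    (Heis.gen T (c, s)).toMatrix i j = if i = j then 1 else c * genDir T s i j := by
  rcases s with s | s <;> rcases i with i | i | i <;> rcases j with j | j | j <;>
    simp [Heis.gen, Heis.toMatrix, genDir, Pi.single_apply, eq_comm, mul_comm]

/-- The entries of `genDir`. -/
def genDirExpr (dE : NatExpr) (g : NatExpr → NatExpr → NatExpr → FieldExpr F) (s i j : NatExpr) :
    FieldExpr F :=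
  .ifLt i 1 (.ifLt j 1 (.const 0) (.ifEq s (j - 1) (.const 1) (.const 0)))
    (.ifLt s dE (.ifLt i (1 + dE) (.ifLt j (1 + dE) (.const 0) (g (i - 1) s (j - (1 + dE))))
      (.const 0)) (.const 0))

theorem computes_genDir {T : ι → ι → ζ → F} {e₁ : ι ≃ Fin a} {e₃ : ζ ≃ Fin c}
    (hg : Computes ρ x g e₁ e₁ e₃ T) {dE : NatExpr} (hE : dE.eval ρ = a) :
    Computes ρ x (genDirExpr dE g) (sumE e₁ e₃) (sumE unitE (sumE e₁ e₃))
      (sumE unitE (sumE e₁ e₃)) (genDir T) := by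
  intro s i j u v t hs hi hj
  simp only [genDirExpr, FieldExpr.eval_ifLt, FieldExpr.eval_ifEq, NatExpr.eval_add, hE,
    NatExpr.eval_one, NatExpr.eval_sub, FieldExpr.eval_const]
  rcases v with v | v
  · rw [sumE_inl, unitE_apply] at hi
    rw [if_pos (by omega)]
    rcases t with t | t
    · rw [sumE_inl, unitE_apply] at hj
      rw [if_pos (by omega)]
      rcases u with u | u <;> rfl
    · rw [sumE_inr] at hj
      rw [if_neg (by omega)]
      have hd : genDir T u (.inl v) (.inr t) = if u = t then 1 else 0 := by
        rcases u with u | u <;> rfl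
      rw [hd, hs, hj, Nat.add_sub_cancel_left]
      refine if_congr ?_ rfl rfl
      rw [Fin.val_inj, Equiv.apply_eq_iff_eq]
  · rw [sumE_inr] at hi
    rw [if_neg (by omega)]
    rcases u with u | u
    · rw [sumE_inl] at hs
      have hu := (e₁ u).2
      rw [if_pos (by omega)]
      rcases v with v | v
      · rw [sumE_inl] at hi
        have hv := (e₁ v).2
        rw [if_pos (by omega)]
        rcases t with t | t | t
        · rw [sumE_inl, unitE_apply] at hj
          rw [if_pos (by omega)]
          rfl
        · rw [sumE_inr, sumE_inl] at hj
          have ht := (e₁ t).2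
          rw [if_pos (by omega)]
          rfl
        · rw [sumE_inr, sumE_inr] at hj
          rw [if_neg (by omega)]
          exact hg _ _ _ _ _ _ (by simp [hi]) hs (by
            rw [NatExpr.eval_sub, NatExpr.eval_add, NatExpr.eval_one, hE, hj]
            omega)
      · rw [sumE_inr] at hi
        rw [if_neg (by omega)]
        rcases t with t | t <;> rfl
    · rw [sumE_inr] at hs
      rw [if_neg (by omega)]
      rcases v with v | v <;> rcases t with t | t <;> rfl

/-- The entries of the generators of a Heisenberg group, where `D` is the number of basis vectors
and `cs` enumerates the field. -/
def genExpr {n : ℕ} (cs : Fin n → F) (D : NatExpr) (g : NatExpr → NatExpr → NatExpr → FieldExpr F)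
    (t i j : NatExpr) : FieldExpr F :=
  .ifEq i j (.const 1) (blockExpr D t fun a r => (g r i j).scale (cs a))

theorem computes_gen {n : ℕ} (e : F ≃ Fin n) {T : ι → ι → ζ → F} {e₁ : ι ⊕ ζ ≃ Fin a}
    {e₂ : Unit ⊕ (ι ⊕ ζ) ≃ Fin b} (hg : Computes ρ x g e₁ e₂ e₂ (genDir T)) {D : NatExpr}
    (hD : D.eval ρ = a) :
    Computes ρ x (genExpr e.symm D g) (prodE e e₁) e₂ e₂ (fun s => (Heis.gen T s).toMatrix) := by
  intro t i j u v w ht hi hj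
  obtain ⟨c, s⟩ := u
  refine Eq.trans ?_ (toMatrix_gen T c s v w).symm
  rw [genExpr, FieldExpr.eval_ifEq, FieldExpr.eval_const]
  refine if_congr ?_ rfl ?_
  · rw [hi, hj, Fin.val_inj, Equiv.apply_eq_iff_eq]
  · rw [prodE_apply] at ht
    rw [eval_blockExpr _ (e c) hD ht (e₁ s).2, FieldExpr.eval_scale, Equiv.symm_apply_apply]
    refine congrArg (c * ·) (hg _ _ _ s v w ?_ hi hj)
    rw [NatExpr.eval_sub, NatExpr.eval_mul, NatExpr.eval_const, hD, ht, Nat.add_sub_cancel_left]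

end GroupExpressions

section GroupReduction
variable {F : Type u} [Field F]

/-- The numbering of the marked first index set. -/
abbrev numMI (ℓ : ℕ) : Fin ℓ ⊕ (Fin 10 × Fin (ℓ + 2)) ≃ Fin (ℓ + 10 * (ℓ + 2)) :=
  sumE (Equiv.refl _) (prodE (Equiv.refl _) (Equiv.refl _))

/-- The numbering of the marked second index set. -/
abbrev numMJ (n : ℕ) : Fin n ⊕ Fin 2 ≃ Fin (n + 2) := sumE (Equiv.refl _) (Equiv.refl _)

/-- The numbering of the marked third index set. -/
abbrev numMK (ℓ m : ℕ) : Fin m ⊕ (Fin 10 × Fin (ℓ + 2)) ≃ Fin (m + 10 * (ℓ + 2)) :=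
  sumE (Equiv.refl _) (prodE (Equiv.refl _) (Equiv.refl _))

/-- The numbering of the set `Unit ⊕ I`, where `I` is the marked first index set. -/
abbrev numMU (ℓ : ℕ) := sumE unitE (numMI ℓ)

/-- The numbering of the set `K ⊕ X`, where `K` is the marked third index set. -/
abbrev numMS (ℓ m : ℕ) := sumE (numMK ℓ m) (Equiv.refl (Fin (ℓ + 10 * (ℓ + 2) + 2)))

/-- The numbering of the index set of the symmetrized core array of the marked array. -/
abbrev numME (ℓ n m : ℕ) := sumE (numMU ℓ) (sumE (numMJ n) (numMS ℓ m))

/-- The numbering of the third index set of the core array of the marked array. -/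
abbrev numMZ (ℓ m : ℕ) := prodE (numMU ℓ) (numMS ℓ m)

/-- The numbering of the basis vectors of the Heisenberg group. -/
abbrev numMEZ (ℓ n m : ℕ) := sumE (numME ℓ n m) (numMZ ℓ m)

/-- The alternating bilinear map of an array whose Heisenberg group is the image of the array. -/
def altMark (α : F) {ℓ n m : ℕ} (A : Arr F ℓ n m) :=
  sym (-1) (core (X := Fin (ℓ + 10 * (ℓ + 2) + 2)) (mark (C := Fin (ℓ + 2)) (markForms α) A))

theorem altMark_self (α : F) {ℓ n m : ℕ} (A : Arr F ℓ n m) (x) : bil (altMark α A) x x = 0 :=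
  sym_self x

theorem exists_altMark_eq_single (α : F) {ℓ n m : ℕ} (A : Arr F ℓ n m) (z) :
    ∃ i j, altMark α A i j = Pi.single z 1 :=
  exists_sym_core_eq_single _ _ z

/-- Isomorphism of the Heisenberg groups is isomorphism of the arrays. -/
theorem exists_trans_iff_heis [Finite F] (p : ℕ) [Fact p.Prime] [CharP F p] (hp : p ≠ 2) {α : F}
    (hα0 : α ≠ 0) (hα1 : α ≠ 1) (hα : ∀ c : F, c ≠ 0 → ∃ n : ℕ, α ^ n = c) {ℓ n m : ℕ}
    (A B : Arr F ℓ n m) :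
    (∃ (P : GL (Fin ℓ) F) (Q : GL (Fin n) F) (R : GL (Fin m) F), trans A P.1 Q.1 R.1 = B) ↔
      Nonempty (Heis (altMark α A) ≃* Heis (altMark α B)) := by
  constructor
  · intro h
    exact Heis.nonempty_mulEquiv (bilIso_of_trans
      (exists_trans_sym_core (-1) (exists_trans_mark (markForms α) h)))
  · rintro ⟨θ⟩
    have h2 : (2 : F) ≠ 0 := Ring.two_ne_zero (by rwa [ringChar.eq F p])
    obtain ⟨φ, ψ, h⟩ := Heis.exists_addEquiv h2 (altMark_self α A) (exists_altMark_eq_single α A)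
      (altMark_self α B) (exists_altMark_eq_single α B) θ
    let := ZMod.algebra F p
    obtain ⟨p', q, hpq⟩ := core_equiv_of_sym (ZMod p) (by simp [add_comm])
      (φ.toLinearEquiv fun c x => ZMod.map_smul φ.toAddMonoidHom c x) ψ h
    exact exists_gl_of_core_mark (by simp) hα0 hα1 hα hpq

theorem reduces_matrixGroupIso [Finite F] {sz : F → ℕ} (hsz : IsSizeMeasure sz) (p : ℕ)
    (hprime : p.Prime) (hp : p ≠ 2) [CharP F p] :
    PolyTimeReduces sz (tensorIso F) (matrixGroupIso F p) := by
  have := Fact.mk hprime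
  have h2 : (2 : F) ≠ 0 := Ring.two_ne_zero (by rwa [ringChar.eq F p])
  obtain ⟨α, hα0, hα1, hα⟩ : ∃ α : F, α ≠ 0 ∧ α ≠ 1 ∧ ∀ c : F, c ≠ 0 → ∃ n : ℕ, α ^ n = c := by
    obtain ⟨α, hα⟩ := IsCyclic.exists_monoid_generator (α := Fˣ)
    have hα' : ∀ c : F, c ≠ 0 → ∃ n : ℕ, (α : F) ^ n = c := by
      intro c hc
      obtain ⟨n, hn⟩ := hα (Units.mk0 c hc)
      exact ⟨n, by simpa using congrArg Units.val hn⟩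
    -- the powers of `1` do not include `-1`, as the characteristic is odd
    refine ⟨α, α.ne_zero, fun h1 => ?_, hα'⟩
    obtain ⟨n, hn⟩ := hα' (-1) (neg_ne_zero.2 one_ne_zero)
    rw [h1, one_pow, eq_neg_iff_add_eq_zero, one_add_one_eq_two] at hn
    exact h2 hn
  let e : F ≃ Fin (Nat.card F) := Finite.equivFin F
  let dM : NatExpr := .const 10 * (.var 0 + 2)
  let dI : NatExpr := .var 0 + dM
  let dJ : NatExpr := .var 1 + 2
  let dK : NatExpr := .var 2 + dM
  let dE : NatExpr := (1 + dI) + (dJ + (dK + (dI + 2)))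
  let dZ : NatExpr := (1 + dI) * (dK + (dI + 2))
  refine reduces_of_expr hsz (.const (Nat.card F) * (dE + dZ)) (1 + (dE + dZ)) (1 + (dE + dZ))
    (genExpr e.symm (dE + dZ) (genDirExpr dE (symExpr (-1) (1 + dI) (coreExpr dJ dK (dI + 2)
      (markExpr (markForms α) (.var 0) (.var 1) (.var 2) (.var 0 + 2) inputExpr))))
      (.var 3) (.var 4) (.var 5)) _ _ _ (fun ℓ n m ρ hρ => ?_)
    (fun {ℓ n m} A => ren (prodE e (numMEZ ℓ n m)) (sumE unitE (numMEZ ℓ n m))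
      (sumE unitE (numMEZ ℓ n m)) fun s => (Heis.gen (altMark α A) s).toMatrix) ?_ ?_
  · have h0 : ρ ((0 : Fin 20) : ℕ) = ℓ := hρ.h0
    have h1 : ρ ((1 : Fin 20) : ℕ) = n := hρ.h1
    have h2 : ρ ((2 : Fin 20) : ℕ) = m := hρ.h2
    simp only [dE, dZ, dI, dJ, dK, dM, NatExpr.eval_add, NatExpr.eval_mul, NatExpr.eval_var,
      NatExpr.eval_const, NatExpr.eval_one, NatExpr.eval_two, h0, h1, h2]
    exact ⟨trivial, trivial, trivial⟩
  · intro ℓ n m A ρ hρ i j k hi hj hk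
    have h0 : ρ ((0 : Fin 20) : ℕ) = ℓ := hρ.h0
    have h1 : ρ ((1 : Fin 20) : ℕ) = n := hρ.h1
    have h2 : ρ ((2 : Fin 20) : ℕ) = m := hρ.h2
    refine (computes_gen e (computes_genDir (computes_sym (-1) (computes_core
      (computes_mark (markForms α) (computes_input A hρ) ?_ ?_ ?_ ?_) ?_ ?_ ?_) ?_) ?_)
      ?_).eval_eq i j k hi hj hk <;>
    simp only [dE, dZ, dI, dJ, dK, dM, NatExpr.eval_add, NatExpr.eval_mul, NatExpr.eval_var,
      NatExpr.eval_const, NatExpr.eval_one, NatExpr.eval_two, h0, h1, h2]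
  · intro ℓ n m A B
    let eq := fun A : Arr F ℓ n m =>
      Heis.equivGenerated (sumE unitE (numMEZ ℓ n m)) (prodE e (numMEZ ℓ n m)) (altMark α A)
    have hV := fun A : Arr F ℓ n m => Heis.generatedGroup_spec (sumE unitE (numMEZ ℓ n m))
      (prodE e (numMEZ ℓ n m)) p h2 (altMark_self α A) (exists_altMark_eq_single α A)
    refine ⟨(_, _), ⟨_, hV A⟩, ⟨_, hV B⟩, .inr rfl, rfl, rfl, ?_⟩
    rw [tensorIso_iff, exists_trans_iff_heis p hp hα0 hα1 hα]
    exact ⟨fun ⟨θ⟩ => ⟨((eq A).symm.trans θ).trans (eq B)⟩,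
      fun ⟨θ⟩ => ⟨((eq A).trans θ).trans (eq B).symm⟩⟩

end GroupReduction

end TensorIso

theorem mainTheorem1 {F : Type u} [Field F] (sz : F → ℕ) (hsz : TensorIso.IsSizeMeasure sz) :
    (∀ p : ℕ, p.Prime → p ≠ 2 → CharP F p → Finite F →
      TensorIso.PolyTimeReduces sz (TensorIso.tensorIso F) (TensorIso.matrixGroupIso F p)) ∧
    (TensorIso.PolyTimeReduces sz (TensorIso.tensorIso F) (TensorIso.matrixSpaceIsometry F) ∧
      TensorIso.PolyTimeReduces sz (TensorIso.tensorIso F) (TensorIso.alternatingIsometry F) ∧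
      TensorIso.PolyTimeReduces sz (TensorIso.tensorIso F) (TensorIso.symmetricIsometry F)) ∧
    (TensorIso.PolyTimeReduces sz (TensorIso.tensorIso F) (TensorIso.matrixSpaceConjugacy F) ∧
      TensorIso.PolyTimeReduces sz (TensorIso.tensorIso F) (TensorIso.matrixLieConjugacy F) ∧
      TensorIso.PolyTimeReduces sz (TensorIso.tensorIso F) (TensorIso.matrixAssocConjugacy F)) ∧
    (TensorIso.PolyTimeReduces sz (TensorIso.tensorIso F) (TensorIso.algebraIso F) ∧
      TensorIso.PolyTimeReduces sz (TensorIso.tensorIso F) (TensorIso.commUnitalAlgebraIso F) ∧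
      TensorIso.PolyTimeReduces sz (TensorIso.tensorIso F) (TensorIso.commNilpotentAlgebraIso F) ∧
      TensorIso.PolyTimeReduces sz (TensorIso.tensorIso F) (TensorIso.nilpotentLieAlgebraIso F)) ∧
    (TensorIso.PolyTimeReduces sz (TensorIso.tensorIso F) (TensorIso.cubicFormEquiv F) ∧
      TensorIso.PolyTimeReduces sz (TensorIso.tensorIso F) (TensorIso.trilinearFormEquiv F)) := by
  refine ⟨fun p hp hp2 hchar hfin => ?_, ⟨?_, ?_, ?_⟩, ⟨?_, ?_, ?_⟩, ⟨?_, ?_, ?_, ?_⟩, ?_, ?_⟩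
  · exact TensorIso.reduces_matrixGroupIso hsz p hp hp2
  · exact (TensorIso.reduces_symmetricIsometry hsz).of_restrict
  · exact TensorIso.reduces_alternatingIsometry hsz
  · exact TensorIso.reduces_symmetricIsometry hsz
  · exact (TensorIso.reduces_matrixLieConjugacy hsz).of_restrict
  · exact TensorIso.reduces_matrixLieConjugacy hsz
  · exact TensorIso.reduces_matrixAssocConjugacy hsz
  · exact (TensorIso.reduces_nilpotentLie hsz).of_restrict
  · exact TensorIso.reduces_commUnital hsz
  · exact TensorIso.reduces_commNilpotent hsz
  · exact TensorIso.reduces_nilpotentLie hsz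
  · exact TensorIso.reduces_cubicFormEquiv hsz
  · exact TensorIso.reduces_trilinearFormEquiv hsz
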